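/- **Theorem (Nachtergaele–Starr).** Let $\Delta>1$ and let $q\in(0,1)$ be given by $\Delta=(q+q^{-1})/2$. For $L\ge 1$ consider on $\mathcal H_{[1,L]}=(\mathbb C^2)^{\otimes L}$ the spin-$\tfrac12$ XXZ Hamiltonian with $++$ boundary fields $$H^{++}_{[1,L]}=-\sum_{x=1}^{L-1}\Big[\tfrac1\Delta\big(S^1_xS^1_{x+1}+S^2_xS^2_{x+1}\big)+\big(S^3_xS^3_{x+1}-\tfrac14\big)\Big]-A(\Delta)\,(S^3_1+S^3_L),\qquad A(\Delta)=\tfrac12\sqrt{1-\Delta^{-2}},$$ where $S^i_x$ are the spin-$\tfrac12$ matrices at site $x$. It leaves invariant the subspace $\mathcal H_{L,n}$ of states with exactly $n$ down spins. Let $\lambda_{L,n}(1)\le\lambda_{L,n}(2)\le\dots$ be the eigenvalues, with multiplicity, of its restriction to $\mathcal H_{L,n}$, let $\psi_{L,n}(1),\psi_{L,n}(2),\dots$ be any corresponding orthonormal basis of eigenvectors, and let $\mathcal H^{k}_{L,n}=\mathrm{span}\{\psi_{L,n}(j):1\le j\le k\}$. For an interval $[a,b]$ of sites (possibly empty) and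 $0\le m\le b-a+1$ define the kink and antikink states $$\psi^{+-}_{[a,b]}(m)=\sum_{a\le x_1<\dots<x_m\le b}q^{\sum_{k}(b+1-x_k)}\prod_{k=1}^m S^-_{x_k}\,|{\uparrow}\cdots{\uparrow}\rangle_{[a,b]},\qquad \psi^{-+}_{[a,b]}(m)=\sum_{a\le x_1<\dots<x_m\le b}q^{\sum_{k}(x_k+1-a)}\prod_{k=1}^m S^-_{x_k}\,|{\uparrow}\cdots{\uparrow}\rangle_{[a,b]},$$ and, for $\lfloor n/2\rfloor\le x\le L-\lceil n/2\rceil$, the droplet states $$\xi_{L,n}(x)=\psi^{+-}_{[1,x]}(\lfloor n/2\rfloor)\otimes\psi^{-+}_{[x+1,L]}(\lceil n/2\rceil).$$ Let $\mathcal K_{L,n}=\mathrm{span}\{\xi_{L,n}(x):\lfloor n/2\rfloor\le x\le L-\lceil n/2\rceil\}$. Write $\mathrm{Proj}(\cdot)$ for orthogonal projections, $\|\cdot\|$ for the operator norm, and $\gamma=1-\Delta^{-1}$. Then there are a constant $C$ and an integer $N$, depending only on $\Delta$ (equivalently on $q$), such that for all integers $1\le n\le L$: (a) $\lambda_{L,n}(1),\dots,\lambda_{L,n}(L-n+1)\in[A(\Delta)-Cq^n,\;A(\Delta)+Cq^n]$;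 (b) if $n\ge N$, then every further eigenvalue satisfies $\lambda_{L,n}(j)\ge A(\Delta)+\gamma-Cn^{-1/4}$, $j\ge L-n+2$; (c) if $n\ge N$, then $\|\mathrm{Proj}(\mathcal K_{L,n})-\mathrm{Proj}(\mathcal H^{L-n+1}_{L,n})\|\le Cq^{n/2}$. -/

import Mathlib

open scoped Matrix

noncomputable section

namespace XXZ

/-- The sites `a, a + 1, …, b` of the chain `[a, b]`; there are none if `b < a`. -/
abbrev Site (a b : ℕ) : Type := ↥(Finset.Icc a b)

/-- Classical configurations on `[a, b]`: the value `0` is spin up, the value `1` is spin down. -/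
abbrev Config (a b : ℕ) : Type := Site a b → Fin 2

/-- The Hilbert space of the chain `[a, b]`, i.e. the tensor product over `x ∈ [a, b]` of copies
of `ℂ²`, in coordinates with respect to its orthonormal product basis of classical
configurations. -/
abbrev Space (a b : ℕ) : Type := EuclideanSpace ℂ (Config a b)

/-- The number of down spins of a configuration. -/
def downCount {a b : ℕ} (σ : Config a b) : ℕ :=
  (Finset.univ.filter fun y => σ y = 1).card

/-! ### Spin operators and the Hamiltonian -/

/-- The spin-1/2 matrix `S¹`. -/
def spin1 : Matrix (Fin 2) (Fin 2) ℂ := (1 / 2 : ℂ) • !![0, 1; 1, 0]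

/-- The spin-1/2 matrix `S²`. -/
def spin2 : Matrix (Fin 2) (Fin 2) ℂ := (1 / 2 : ℂ) • !![0, -Complex.I; Complex.I, 0]

/-- The spin-1/2 matrix `S³`. -/
def spin3 : Matrix (Fin 2) (Fin 2) ℂ := (1 / 2 : ℂ) • !![1, 0; 0, -1]

/-- The one-site matrix `M` acting at the site `x` of the chain `[a, b]` (and as the identity at
all other sites), as a matrix in the basis of configurations. It is only used for `x ∈ [a, b]`;
for other `x` it is `0`. -/
def onSite (a b x : ℕ) (M : Matrix (Fin 2) (Fin 2) ℂ) :
    Matrix (Config a b) (Config a b) ℂ :=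
  fun σ τ =>
    if h : x ∈ Finset.Icc a b then
      if ∀ y, y ≠ (⟨x, h⟩ : Site a b) → σ y = τ y then M (σ ⟨x, h⟩) (τ ⟨x, h⟩) else 0
    else 0

/-- The boundary field strength `A(Δ) = (1/2) √(1 - Δ⁻²)`. -/
def fieldA (Δ : ℝ) : ℝ := 1 / 2 * Real.sqrt (1 - (Δ ^ 2)⁻¹)

/-- The matrix of the XXZ Hamiltonian on `[1, L]` with `++` boundary fields,
`- ∑_{x=1}^{L-1} (Δ⁻¹ (S¹_x S¹_{x+1} + S²_x S²_{x+1}) + (S³_x S³_{x+1} - 1/4))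
- A(Δ) (S³_1 + S³_L)`. -/
def hamiltonianMatrix (L : ℕ) (Δ : ℝ) : Matrix (Config 1 L) (Config 1 L) ℂ :=
  -∑ x ∈ Finset.Ico 1 L,
      ((Δ : ℂ)⁻¹ • (onSite 1 L x spin1 * onSite 1 L (x + 1) spin1
          + onSite 1 L x spin2 * onSite 1 L (x + 1) spin2)
        + (onSite 1 L x spin3 * onSite 1 L (x + 1) spin3 - (1 / 4 : ℂ) • 1))
    - (fieldA Δ : ℂ) • (onSite 1 L 1 spin3 + onSite 1 L L spin3)

/-- The Hamiltonian as an operator on the Hilbert space of `[1, L]`. -/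
def hamiltonian (L : ℕ) (Δ : ℝ) : Space 1 L →ₗ[ℂ] Space 1 L :=
  Matrix.toEuclideanLin (hamiltonianMatrix L Δ)

/-- The subspace `H_{L,n}` of the states with exactly `n` down spins. -/
def sector (L n : ℕ) : Submodule ℂ (Space 1 L) where
  carrier := {ψ | ∀ σ : Config 1 L, downCount σ ≠ n → ψ σ = 0}
  zero_mem' := by intro σ _; simp
  add_mem' := by intro φ ψ hφ hψ σ h; simp [hφ σ h, hψ σ h]
  smul_mem' := by intro c ψ hψ σ h; simp [hψ σ h]

/-- The eigenvalues, in nondecreasing order and with multiplicity, of the Hamiltonian restricted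
to `H_{L,n}`, together with an orthonormal basis of corresponding eigenvectors. The indices
start at `0`. -/
structure Eigensystem (L n : ℕ) (Δ : ℝ) where
  /-- the eigenvalues -/
  val : Fin (Module.finrank ℂ (sector L n)) → ℝ
  /-- the eigenvectors -/
  vec : OrthonormalBasis (Fin (Module.finrank ℂ (sector L n))) ℂ (sector L n)
  val_mono : Monotone val
  eigen : ∀ j, hamiltonian L Δ (vec j : Space 1 L) = (val j : ℂ) • (vec j : Space 1 L)

/-- The span of the first `k` eigenvectors. -/
def Eigensystem.lowSpace {L n : ℕ} {Δ : ℝ} (e : Eigensystem L n Δ) (k : ℕ) :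
    Submodule ℂ (Space 1 L) :=
  Submodule.span ℂ {v | ∃ j : Fin (Module.finrank ℂ (sector L n)), (j : ℕ) < k ∧ v = (e.vec j : Space 1 L)}

/-! ### Kinks, antikinks and droplets -/

/-- The product basis vector `(∏_{x ∈ X} S⁻_x) |↑ ⋯ ↑⟩`, whose down spins are exactly at the
sites in `X`. -/
def ket {a b : ℕ} (X : Finset (Site a b)) : Space a b :=
  EuclideanSpace.single (fun y => if y ∈ X then (1 : Fin 2) else 0) (1 : ℂ)

/-- The kink state `ψ^{+-}_{[a,b]}(n)`, a sum over the sets `X = {x₁ < ⋯ < x_n}` of sites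
with weights `q ^ ∑ (b + 1 - x_k)`. -/
def kink (q : ℝ) (a b n : ℕ) : Space a b :=
  ∑ X ∈ (Finset.univ : Finset (Site a b)).powersetCard n,
    ((q : ℂ) ^ (∑ x ∈ X, (b + 1 - (x : ℕ)))) • ket X

/-- The antikink state `ψ^{-+}_{[a,b]}(n)`, a sum over the sets `X = {x₁ < ⋯ < x_n}` of sites
with weights `q ^ ∑ (x_k + 1 - a)`. -/
def antikink (q : ℝ) (a b n : ℕ) : Space a b :=
  ∑ X ∈ (Finset.univ : Finset (Site a b)).powersetCard n,
    ((q : ℂ) ^ (∑ x ∈ X, ((x : ℕ) + 1 - a))) • ket X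

/-- The tensor product of a state on `[1, x]` and a state on `[x + 1, L]`, as a state
on `[1, L]`. -/
def tensor {L x : ℕ} (hx : x ≤ L) (φ : Space 1 x) (χ : Space (x + 1) L) : Space 1 L :=
  WithLp.toLp 2 fun σ =>
    φ (fun y => σ ⟨y, Finset.Icc_subset_Icc le_rfl hx y.2⟩) *
      χ (fun y => σ ⟨y, Finset.Icc_subset_Icc (Nat.le_add_left 1 x) le_rfl y.2⟩)

/-- The droplet state `ξ_{L,n}(x) = ψ^{+-}_{[1,x]}(⌊n/2⌋) ⊗ ψ^{-+}_{[x+1,L]}(⌈n/2⌉)`; the natural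
number divisions `n / 2` and `(n + 1) / 2` are `⌊n/2⌋` and `⌈n/2⌉`. -/
def droplet (q : ℝ) (L n x : ℕ) (hx : x ≤ L) : Space 1 L :=
  tensor hx (kink q 1 x (n / 2)) (antikink q (x + 1) L ((n + 1) / 2))

/-- The droplet subspace `K_{L,n}`, the span of `ξ_{L,n}(x)`, `⌊n/2⌋ ≤ x ≤ L - ⌈n/2⌉`. -/
def dropletSpace (q : ℝ) (L n : ℕ) : Submodule ℂ (Space 1 L) :=
  Submodule.span ℂ
    {v | ∃ (x : ℕ) (hx : x ≤ L), n / 2 ≤ x ∧ x + (n + 1) / 2 ≤ L ∧ v = droplet q L n x hx}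

end XXZ

end

/-!
The up spins of a configuration with `n` down spins are regarded as walls between `K = L - n + 1`
urns, numbered from `0` to `L - n`, and the down spins as particles in these urns (`occ`). The
Hamiltonian then becomes a zero range process: a nonempty urn sends a particle to a neighbouring
urn, whatever its occupation number (`urnOp`, `hamiltonian_urnState`). A droplet is a
configuration with nearly all particles in one urn `y`. The function `q ^ spread`, where `spread` is
the total distance of the particles from `y`, satisfies the eigenvalue equation for `A(Δ)` except
where the urn `y` is empty (`urnOp_pow_spread`), and there it is at most `q ^ n`.

*The gap.* Conditioned on the urn `y` being nonempty, this urn is as good as an inexhaustible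
reservoir, and the quadratic form of `H + A(Δ)` becomes `2 A(Δ)` plus a multiple of a sum `G` of
terms `b† b` with `b = a_i - q a_{i'}`, where `i'` is next to `i` on the way to `y` and the `a_i` are
annihilation operators with `a_i a_j† = δ_ij + a_j† a_i (1 - δ_ij)`. These relations give
`G² ≥ (1 - q)² G` (`IsFreeFock.bondSum_sq_ge`), hence the gap `1 - Δ⁻¹` above the unique ground
state `q ^ spread` of `G` (`IsFreeFock.gap`, `gap_urns`). The restriction to configurations with a
nonempty urn `y` is achieved by the localization functions `loc`, the components of the unit vector in
the direction of the occupation numbers: their squares sum to `1`, they vanish where the urn is empty,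
and moving one particle changes them so little that localizing costs a factor `1 + O(1 / n)` only
(`urnForm_ge`). By the min-max principle all but `K` eigenvalues are at least
`A(Δ) + 1 - Δ⁻¹ - O(1 / n)` (`val_ge`).

*The low energy states.* Superpositions of the `K` functions `q ^ spread` are approximate
eigenvectors with a residue of order `q ^ (n / 2)` and an expectation of `H - A(Δ)` of order `q ^ n`
(`sum_norm_residueFn_sq_le`, `norm_sum_conj_mul_residueFn_le`), and they are nearly orthogonal
(`sum_norm_sq_coeff_le`). With the gap, this locates the `K` lowest eigenvalues and eigenvectors
(`abs_val_sub_le`, `norm_high_le`).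

*The droplet states.* The state `ξ_{L,n}(x)` is, up to normalization, the function `q ^ spread` for
`y = x - ⌊n/2⌋`, cut off to the configurations with a median of the particles in `y`
(`droplet_eq`). Away from these at least about half of the particles have left `y`, and the cut-off
changes superpositions by a relative amount of order `q ^ (n / 2)`
(`sum_norm_dropFn_sub_cutFn_sq_le`). Hence the droplet space and the low energy space are close
(`norm_starProjection_sub_low_le`).
-/


noncomputable section

namespace XXZ

/-! ### A spectral gap from commutation relations -/

theorem re_inner_le_half {E : Type*} [NormedAddCommGroup E] [InnerProductSpace ℂ E] (x y : E) :
    (inner ℂ x y).re ≤ (‖x‖ ^ 2 + ‖y‖ ^ 2) / 2 := by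
  have h1 : (inner ℂ x y).re ≤ ‖x‖ * ‖y‖ := @re_inner_le_norm ℂ E _ _ _ x y
  nlinarith [sq_nonneg (‖x‖ - ‖y‖)]

section Bochner

open ContinuousLinearMap

variable {E : Type*} [NormedAddCommGroup E] [InnerProductSpace ℂ E] [CompleteSpace E]

/-- The operators `A i` are commuting annihilation operators of a "free" Fock space: they obey
`A i A i† = 1` and `A i A j† = A j† A i` for `i ≠ j`, but no relation for `A i† A i`. The identity
operator is allowed as one of the `A i`; it models a reservoir. -/
structure IsFreeFock (A : ℕ → E →L[ℂ] E) : Prop where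
  comm : ∀ i j x, A i (A j x) = A j (A i x)
  coisometry : ∀ i x, A i (adjoint (A i) x) = x
  comm_adjoint : ∀ i j x, i ≠ j → A i (adjoint (A j) x) = adjoint (A j) (A i x)

/-- The operator that annihilates the ground state along the bond from the urn `i` to the
urn `t i`. -/
def bondOp (A : ℕ → E →L[ℂ] E) (t : ℕ → ℕ) (q : ℝ) (i : ℕ) : E →L[ℂ] E :=
  A i - (q : ℂ) • A (t i)

/-- The orthogonal projection `1 - A i† A i` on the states with an empty urn `i`. -/
def vacOp (A : ℕ → E →L[ℂ] E) (i : ℕ) : E →L[ℂ] E :=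
  1 - adjoint (A i) * A i

/-- The sum of `b† b` over the bond operators `b`. -/
def bondSum (A : ℕ → E →L[ℂ] E) (t : ℕ → ℕ) (q : ℝ) (J : Finset ℕ) : E →L[ℂ] E :=
  ∑ a ∈ J, adjoint (bondOp A t q a) * bondOp A t q a

variable {A : ℕ → E →L[ℂ] E} {t : ℕ → ℕ} {q : ℝ} {J : Finset ℕ}

theorem vacOp_apply (i : ℕ) (x : E) : vacOp A i x = x - adjoint (A i) (A i x) := rfl

theorem IsFreeFock.inner_vacOp (hA : IsFreeFock A) (i : ℕ) (x y : E) :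
    inner ℂ (vacOp A i x) (vacOp A i y) = inner ℂ x y - inner ℂ (A i x) (A i y) := by
  simp only [vacOp_apply, inner_sub_left, inner_sub_right, adjoint_inner_left, adjoint_inner_right,
    map_sub, hA.coisometry, sub_self, inner_zero_left, sub_zero]

/-- Moving annihilators past creators; only equal indices leave a vacuum term. -/
theorem IsFreeFock.inner_adjoint (hA : IsFreeFock A) (i j : ℕ) (x y : E) :
    inner ℂ (adjoint (A i) x) (adjoint (A j) y) =
      inner ℂ (A j x) (A i y) + if i = j then inner ℂ (vacOp A i x) (vacOp A i y) else 0 := by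
  split_ifs with h
  · subst h
    rw [hA.inner_vacOp, adjoint_inner_left, hA.coisometry]
    ring
  · rw [adjoint_inner_left, hA.comm_adjoint i j y h, adjoint_inner_right, add_zero]

theorem adjoint_bondOp (a : ℕ) (x : E) :
    adjoint (bondOp A t q a) x = adjoint (A a) x - (q : ℂ) • adjoint (A (t a)) x := by
  rw [bondOp, map_sub, map_smulₛₗ, Complex.conj_ofReal]
  rfl

theorem IsFreeFock.inner_adjoint_bondOp (hA : IsFreeFock A) (a c : ℕ) (x y : E) :
    inner ℂ (adjoint (bondOp A t q a) x) (adjoint (bondOp A t q c) y) =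
      inner ℂ (bondOp A t q c x) (bondOp A t q a y)
      + (if a = c then inner ℂ (vacOp A a x) (vacOp A a y) else 0)
      - q * (if a = t c then inner ℂ (vacOp A a x) (vacOp A a y) else 0)
      - q * (if t a = c then inner ℂ (vacOp A c x) (vacOp A c y) else 0)
      + q ^ 2 * (if t a = t c then inner ℂ (vacOp A (t a) x) (vacOp A (t a) y) else 0) := by
  rw [adjoint_bondOp, adjoint_bondOp]
  simp only [inner_sub_left, inner_sub_right, inner_smul_left, inner_smul_right,
    hA.inner_adjoint, bondOp, sub_apply, smul_apply, Complex.conj_ofReal]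
  have e : (if t a = c then inner ℂ (vacOp A (t a) x) (vacOp A (t a) y) else 0)
      = (if t a = c then inner ℂ (vacOp A c x) (vacOp A c y) else 0) := by
    split_ifs with h
    · rw [h]
    · rfl
  rw [e]
  ring

theorem IsFreeFock.norm_vacOp_sq (hA : IsFreeFock A) (i : ℕ) (x : E) :
    ‖vacOp A i x‖ ^ 2 = ‖x‖ ^ 2 - ‖A i x‖ ^ 2 := by
  have h := congrArg Complex.re (hA.inner_vacOp i x x)
  simpa only [inner_self_eq_norm_sq_to_K, Complex.sub_re, Complex.coe_algebraMap,
    ← Complex.ofReal_pow, Complex.ofReal_re] using h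

theorem IsFreeFock.bondOp_comm (hA : IsFreeFock A) (a c : ℕ) (x : E) :
    bondOp A t q c (bondOp A t q a x) = bondOp A t q a (bondOp A t q c x) := by
  simp only [bondOp, sub_apply, smul_apply, map_sub, map_smul, smul_sub]
  rw [hA.comm c a, hA.comm c (t a), hA.comm (t c) a, hA.comm (t c) (t a)]
  rw [smul_comm]
  abel

theorem IsFreeFock.norm_bondOp_sq_ge (hA : IsFreeFock A) (hq : 0 ≤ q) (a : ℕ) (x : E) :
    (1 - q) * (‖x‖ ^ 2 - ‖vacOp A a x‖ ^ 2) - (q - q ^ 2) * (‖x‖ ^ 2 - ‖vacOp A (t a) x‖ ^ 2)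
      ≤ ‖bondOp A t q a x‖ ^ 2 := by
  have h1 : ‖bondOp A t q a x‖ ^ 2
      = ‖A a x‖ ^ 2 - 2 * (q * (inner ℂ (A a x) (A (t a) x)).re) + q ^ 2 * ‖A (t a) x‖ ^ 2 := by
    rw [bondOp, sub_apply, smul_apply, @norm_sub_sq ℂ, inner_smul_right, norm_smul]
    simp [mul_pow]
  have h2 := re_inner_le_half (A a x) (A (t a) x)
  rw [h1, hA.norm_vacOp_sq, hA.norm_vacOp_sq]
  nlinarith [mul_le_mul_of_nonneg_left h2 hq]

/-- The sum `G` of `b† b` over the bonds satisfies `G² ≥ (1 - q)² G`: in `⟨φ, G² φ⟩` the terms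
`‖b b' φ‖²` are nonnegative, and the vacuum terms of the commutators on the diagonal compensate
those of neighbouring bonds. -/
theorem IsFreeFock.bondSum_sq_ge (hA : IsFreeFock A) (hq : 0 ≤ q)
    (hne : ∀ a ∈ J, t a ≠ a) (hinj : ∀ a ∈ J, ∀ c ∈ J, t a ∈ J → t a = t c → a = c)
    (hres : ∀ a ∈ J, t a ∉ J → ∀ x, vacOp A (t a) x = 0) (φ : E) :
    (1 - q) ^ 2 * ∑ a ∈ J, ‖bondOp A t q a φ‖ ^ 2 ≤ ‖bondSum A t q J φ‖ ^ 2 := by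
  set ψ : ℕ → E := fun a => bondOp A t q a φ with hψ
  set N : ℕ → E → ℝ := fun i x => ‖vacOp A i x‖ ^ 2 with hN
  have hN0 : ∀ i x, 0 ≤ N i x := fun i x => by positivity
  have hsum : bondSum A t q J φ = ∑ a ∈ J, adjoint (bondOp A t q a) (ψ a) := by
    simp [bondSum, sum_apply, hψ]
  have hexp : ‖bondSum A t q J φ‖ ^ 2 = ∑ a ∈ J, ∑ c ∈ J,
      (inner ℂ (adjoint (bondOp A t q a) (ψ a)) (adjoint (bondOp A t q c) (ψ c))).re := by
    have := @inner_self_eq_norm_sq_to_K ℂ E _ _ _ (bondSum A t q J φ)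
    have h2 := congrArg Complex.re this
    simp only [Complex.coe_algebraMap, ← Complex.ofReal_pow, Complex.ofReal_re] at h2
    rw [← h2, hsum, sum_inner]
    simp only [inner_sum, Complex.re_sum]
  -- Lower bounds on the matrix elements, in the form in which they can be summed: a pair of bonds
  -- with `a = t c` or `c = t a` costs at most `q / 2` times two vacuum terms.
  have hpair : ∀ a ∈ J, ∀ c ∈ J,
      (if a = c then (1 - q) ^ 2 * ‖ψ a‖ ^ 2 + q * N a (ψ a) + q * N (t a) (ψ a) else 0)
        - q / 2 * (if a = t c then N (t c) (ψ (t c)) + N (t c) (ψ c) else 0)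
        - q / 2 * (if c = t a then N (t a) (ψ (t a)) + N (t a) (ψ a) else 0) ≤
      (inner ℂ (adjoint (bondOp A t q a) (ψ a)) (adjoint (bondOp A t q c) (ψ c))).re := by
    intro a ha c hc
    rw [hA.inner_adjoint_bondOp]
    have hcc : bondOp A t q c (ψ a) = bondOp A t q a (ψ c) := hA.bondOp_comm a c φ
    have hself : ∀ z : E, (inner ℂ z z).re = ‖z‖ ^ 2 := fun z => by
      rw [inner_self_eq_norm_sq_to_K]; simp [← Complex.ofReal_pow]
    have hre : ∀ (r : ℝ) (z : ℂ), ((r : ℂ) * z).re = r * z.re := fun r z => by simp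
    have hre2 : ∀ (r : ℝ) (z : ℂ), ((r : ℂ) ^ 2 * z).re = r ^ 2 * z.re := fun r z => by
      rw [← Complex.ofReal_pow, hre]
    rw [Complex.add_re, Complex.sub_re, Complex.sub_re, Complex.add_re, hre, hre, hre2, hcc, hself]
    by_cases hac : a = c
    · subst hac
      have h1 : a ≠ t a := fun h => hne a ha h.symm
      simp only [if_true, if_neg h1, if_neg (hne a ha), hself, Complex.zero_re]
      have := hA.norm_bondOp_sq_ge hq (t := t) a (ψ a)
      simp only [hN]
      nlinarith [this]
    · have h4 : (if t a = t c then inner ℂ (vacOp A (t a) (ψ a)) (vacOp A (t a) (ψ c)) else 0) = 0 := by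
        split_ifs with h
        -- Two bonds end at the same urn only if that urn is the reservoir, which has no vacuum.
        · by_cases hJ : t a ∈ J
          · exact absurd (hinj a ha c hc hJ h) hac
          · rw [hres a ha hJ]; simp
        · rfl
      have h2 : (if a = t c then inner ℂ (vacOp A a (ψ a)) (vacOp A a (ψ c)) else 0).re
          ≤ 1 / 2 * (if a = t c then N (t c) (ψ (t c)) + N (t c) (ψ c) else 0) := by
        split_ifs with h
        · rw [← h]
          linarith [re_inner_le_half (vacOp A a (ψ a)) (vacOp A a (ψ c))]
        · simp
      have h3 : (if t a = c then inner ℂ (vacOp A c (ψ a)) (vacOp A c (ψ c)) else 0).re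
          ≤ 1 / 2 * (if c = t a then N (t a) (ψ (t a)) + N (t a) (ψ a) else 0) := by
        by_cases h : t a = c
        · rw [if_pos h, if_pos h.symm, h]
          linarith [re_inner_le_half (vacOp A c (ψ a)) (vacOp A c (ψ c))]
        · rw [if_neg h, if_neg (fun h' => h h'.symm)]; simp
      rw [h4, if_neg hac, if_neg hac]
      have h5 := mul_le_mul_of_nonneg_left h2 hq
      have h6 := mul_le_mul_of_nonneg_left h3 hq
      have h7 : 0 ≤ ‖bondOp A t q a (ψ c)‖ ^ 2 := by positivity
      simp only [Complex.zero_re]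
      nlinarith
  -- Every urn is the target `t c` of at most one bond `c`, apart from the reservoir.
  have hcross : ∑ c ∈ J, (if t c ∈ J then N (t c) (ψ (t c)) + N (t c) (ψ c) else 0)
      ≤ ∑ a ∈ J, N a (ψ a) + ∑ a ∈ J, N (t a) (ψ a) := by
    rw [← Finset.sum_filter, Finset.sum_add_distrib]
    refine add_le_add ?_ (Finset.sum_le_sum_of_subset_of_nonneg (Finset.filter_subset _ _)
      fun _ _ _ => hN0 _ _)
    rw [← Finset.sum_image (f := fun a => N a (ψ a)) (s := J.filter fun c => t c ∈ J) (g := t)]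
    · refine Finset.sum_le_sum_of_subset_of_nonneg ?_ fun _ _ _ => hN0 _ _
      intro a ha
      obtain ⟨c, hc, rfl⟩ := Finset.mem_image.1 ha
      exact (Finset.mem_filter.1 hc).2
    · intro a ha c hc h
      exact hinj a (Finset.mem_filter.1 ha).1 c (Finset.mem_filter.1 hc).1
        (Finset.mem_filter.1 ha).2 h
  have hlow : ∑ a ∈ J, ∑ c ∈ J,
      ((if a = c then (1 - q) ^ 2 * ‖ψ a‖ ^ 2 + q * N a (ψ a) + q * N (t a) (ψ a) else 0)
        - q / 2 * (if a = t c then N (t c) (ψ (t c)) + N (t c) (ψ c) else 0)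
        - q / 2 * (if c = t a then N (t a) (ψ (t a)) + N (t a) (ψ a) else 0))
      = ∑ a ∈ J, ((1 - q) ^ 2 * ‖ψ a‖ ^ 2 + q * N a (ψ a) + q * N (t a) (ψ a))
        - q * ∑ c ∈ J, (if t c ∈ J then N (t c) (ψ (t c)) + N (t c) (ψ c) else 0) := by
    simp only [Finset.sum_sub_distrib, ← Finset.mul_sum]
    rw [Finset.sum_comm (f := fun a c => if a = t c then N (t c) (ψ (t c)) + N (t c) (ψ c) else 0)]
    simp only [Finset.sum_ite_eq, Finset.sum_ite_eq']
    rw [Finset.sum_congr rfl fun a ha => if_pos ha]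
    ring
  rw [hexp]
  refine le_trans ?_ (Finset.sum_le_sum fun a ha => Finset.sum_le_sum fun c hc => hpair a ha c hc)
  rw [hlow, Finset.sum_add_distrib, Finset.sum_add_distrib, ← Finset.mul_sum, ← Finset.mul_sum,
    ← Finset.mul_sum]
  nlinarith [mul_le_mul_of_nonneg_left hcross hq]

theorem inner_bondSum (x y : E) :
    inner ℂ (bondSum A t q J x) y = ∑ a ∈ J, inner ℂ (bondOp A t q a x) (bondOp A t q a y) := by
  simp [bondSum, sum_apply, adjoint_inner_left]

/-- On the orthogonal complement of its kernel, the sum of `b† b` is at least `(1 - q)²`. -/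
theorem IsFreeFock.gap (hA : IsFreeFock A) (hq : 0 ≤ q)
    (hne : ∀ a ∈ J, t a ≠ a) (hinj : ∀ a ∈ J, ∀ c ∈ J, t a ∈ J → t a = t c → a = c)
    (hres : ∀ a ∈ J, t a ∉ J → ∀ x, vacOp A (t a) x = 0) (g : E)
    (hg : ∀ w, (∀ a ∈ J, bondOp A t q a w = 0) → inner ℂ w g = 0) :
    (1 - q) ^ 2 * ‖g‖ ^ 2 ≤ ∑ a ∈ J, ‖bondOp A t q a g‖ ^ 2 := by
  set T := bondSum A t q J with hT
  have hself : adjoint T = T := by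
    simp [hT, bondSum, map_sum, ← star_eq_adjoint, star_mul]
  -- `T` is selfadjoint, so that the complement of its kernel is the closure of its range. On the
  -- range the bound is the one on `T²`, by the Cauchy-Schwarz inequality.
  have hmem : g ∈ T.range.topologicalClosure := by
    rw [← hself, ← orthogonal_ker]
    intro w hw
    refine hg w ?_
    have h0 : ∑ a ∈ J, ‖bondOp A t q a w‖ ^ 2 = 0 := by
      have h1 : inner ℂ (T w) w = 0 := by
        have : T w = 0 := hw
        rw [this, inner_zero_left]
      rw [hT, inner_bondSum] at h1
      have h2 := congrArg Complex.re h1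
      simpa [inner_self_eq_norm_sq_to_K, ← Complex.ofReal_pow] using h2
    intro a ha
    have := (Finset.sum_eq_zero_iff_of_nonneg fun a _ => by positivity).1 h0 a ha
    simpa using this
  have hclosed : IsClosed {g : E | (1 - q) ^ 2 * ‖g‖ ^ 2 ≤ ∑ a ∈ J, ‖bondOp A t q a g‖ ^ 2} := by
    apply isClosed_le <;> fun_prop
  have hsub : (T.range : Set E) ⊆
      {g : E | (1 - q) ^ 2 * ‖g‖ ^ 2 ≤ ∑ a ∈ J, ‖bondOp A t q a g‖ ^ 2} := by
    rintro _ ⟨w, rfl⟩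
    show (1 - q) ^ 2 * ‖T w‖ ^ 2 ≤ ∑ a ∈ J, ‖bondOp A t q a (T w)‖ ^ 2
    set D := ∑ a ∈ J, ‖bondOp A t q a (T w)‖ ^ 2
    set D' := ∑ a ∈ J, ‖bondOp A t q a w‖ ^ 2 with hD'
    have h1 : (1 - q) ^ 2 * D' ≤ ‖T w‖ ^ 2 := hA.bondSum_sq_ge hq hne hinj hres w
    have h2 : ‖T w‖ ^ 2 ≤ ∑ a ∈ J, ‖bondOp A t q a w‖ * ‖bondOp A t q a (T w)‖ := by
      have := @inner_self_eq_norm_sq_to_K ℂ E _ _ _ (T w)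
      have h3 := congrArg Complex.re this
      simp only [Complex.coe_algebraMap, ← Complex.ofReal_pow, Complex.ofReal_re] at h3
      rw [← h3]
      conv_lhs => rw [hT]
      rw [inner_bondSum, Complex.re_sum]
      exact Finset.sum_le_sum fun a _ => @re_inner_le_norm ℂ E _ _ _ _ _
    have h3 := Finset.sum_mul_sq_le_sq_mul_sq J (fun a => ‖bondOp A t q a w‖)
      (fun a => ‖bondOp A t q a (T w)‖)
    have hD0 : 0 ≤ D := Finset.sum_nonneg fun _ _ => by positivity
    have h4 : (‖T w‖ ^ 2) ^ 2 ≤ D' * D :=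
      le_trans (pow_le_pow_left₀ (by positivity) h2 2) h3
    rcases eq_or_lt_of_le (show 0 ≤ ‖T w‖ ^ 2 by positivity) with h0 | h0
    · rw [← h0, mul_zero]; exact hD0
    · have h5 : (1 - q) ^ 2 * (‖T w‖ ^ 2) ^ 2 ≤ ‖T w‖ ^ 2 * D := by
        nlinarith [mul_le_mul_of_nonneg_left h4 (sq_nonneg (1 - q)),
          mul_le_mul_of_nonneg_right h1 hD0]
      by_contra hlt
      push Not at hlt
      nlinarith [mul_lt_mul_of_pos_left hlt h0]
  exact closure_minimal hsub hclosed hmem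

end Bochner

/-! ### Occupation numbers of urns -/

/-- The configuration with a single particle, in the urn `i`. -/
abbrev unit (i : ℕ) : ℕ → ℕ := Pi.single i 1

/-- The configurations of `n` particles in the urns `0, …, K - 1`. -/
abbrev urns (K n : ℕ) : Finset (ℕ → ℕ) := Finset.piAntidiag (Finset.range K) n

/-- The urn next to `i` on the way to `y` (for `i ≠ y`). -/
def toward (y i : ℕ) : ℕ := if i < y then i + 1 else i - 1

/-- The distance between the urns `i` and `y`. -/
def urnDist (y i : ℕ) : ℕ := (i - y) + (y - i)

/-- The total distance of the particles from the urn `y`. -/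
def spread (K y : ℕ) (m : ℕ → ℕ) : ℕ := ∑ i ∈ Finset.range K, urnDist y i * m i

theorem spread_add (K y : ℕ) (m m' : ℕ → ℕ) :
    spread K y (m + m') = spread K y m + spread K y m' := by
  simp [spread, mul_add, Finset.sum_add_distrib]

theorem spread_unit {K y i : ℕ} (hi : i < K) : spread K y (unit i) = urnDist y i := by
  rw [spread, Finset.sum_eq_single i]
  · simp [unit]
  · intro j _ hj; simp [unit, hj]
  · intro h; exact absurd (Finset.mem_range.2 hi) h

theorem urnDist_toward {y i : ℕ} (h : i ≠ y) : urnDist y (toward y i) + 1 = urnDist y i := by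
  unfold urnDist toward; split_ifs <;> omega

theorem toward_lt {K y i : ℕ} (hy : y < K) (hi : i < K) : toward y i < K := by
  unfold toward; split_ifs <;> omega

theorem sub_unit_add {m : ℕ → ℕ} {i : ℕ} (h : m i ≠ 0) : m - unit i + unit i = m := by
  funext j
  by_cases hj : j = i
  · subst hj; simp only [Pi.add_apply, Pi.sub_apply, unit, Pi.single_eq_same]; omega
  · simp [unit, hj]

theorem add_unit_sub (m : ℕ → ℕ) (i : ℕ) : m + unit i - unit i = m := by
  funext j; simp

theorem mem_urns {K n : ℕ} {ℓ : ℕ → ℕ} :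
    ℓ ∈ urns K n ↔ ∑ i ∈ Finset.range K, ℓ i = n ∧ ∀ i, ℓ i ≠ 0 → i < K := by
  simp [urns]

theorem sum_add_unit {K j : ℕ} (hj : j < K) (η : ℕ → ℕ) :
    ∑ i ∈ Finset.range K, (η + unit j) i = ∑ i ∈ Finset.range K, η i + 1 := by
  simp [Finset.sum_add_distrib, unit, Finset.sum_pi_single', hj]

theorem add_unit_mem {K n j : ℕ} (hj : j < K) {η : ℕ → ℕ} :
    η + unit j ∈ urns K (n + 1) ↔ η ∈ urns K n := by
  rw [mem_urns, mem_urns, sum_add_unit hj]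
  refine and_congr (by omega) (forall_congr' fun i => ?_)
  by_cases h : i = j
  · subst h; simp [hj]
  · simp [unit, h]

/-- Removing one particle from the nonempty urn `j`. -/
theorem sum_urns_succ {M : Type*} [AddCommMonoid M] {K j : ℕ} (n : ℕ) (hj : j < K)
    (F : (ℕ → ℕ) → M) :
    ∑ ℓ ∈ urns K (n + 1), (if ℓ j ≠ 0 then F ℓ else 0) = ∑ η ∈ urns K n, F (η + unit j) := by
  rw [← Finset.sum_filter]
  symm
  refine Finset.sum_bij (fun η _ => η + unit j) ?_ ?_ ?_ ?_
  · intro η hη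
    exact Finset.mem_filter.2 ⟨(add_unit_mem hj).2 hη, by simp [unit]⟩
  · intro a _ b _ h; exact add_right_cancel h
  · intro ℓ hℓ
    obtain ⟨h1, h2⟩ := Finset.mem_filter.1 hℓ
    exact ⟨ℓ - unit j, (add_unit_mem hj).1 (by rwa [sub_unit_add h2]), sub_unit_add h2⟩
  · intro _ _; rfl

/-! ### The spectral gap next to a full urn -/

/-- The Hilbert space of square summable functions of the occupation numbers. -/
abbrev Fock : Type := lp (fun _ : ℕ → ℕ => ℂ) 2

theorem add_unit_injective (i : ℕ) : Function.Injective fun m : ℕ → ℕ => m + unit i :=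
  fun _ _ h => add_right_cancel h

theorem summable_shift (i : ℕ) (f : Fock) :
    Summable fun m : ℕ → ℕ => ‖f (m + unit i)‖ ^ (2 : ENNReal).toReal :=
  ((lp.memℓp f).summable (by simp)).comp_injective (add_unit_injective i)

/-- The annihilation operator `(A f)(m) = f (m + unit i)`. -/
def annih (i : ℕ) : Fock →L[ℂ] Fock :=
  LinearMap.mkContinuous
    { toFun := fun f => ⟨fun m => f (m + unit i), memℓp_gen (summable_shift i f)⟩
      map_add' := fun _ _ => rfl
      map_smul' := fun _ _ => rfl } 1 (by
    intro f
    rw [one_mul]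
    have h2 : (0 : ℝ) < (2 : ENNReal).toReal := by simp
    refine (Real.rpow_le_rpow_iff (norm_nonneg _) (norm_nonneg _) h2).1 ?_
    rw [lp.norm_rpow_eq_tsum h2, lp.norm_rpow_eq_tsum h2]
    exact tsum_comp_le_tsum_of_inj ((lp.memℓp f).summable h2)
      (fun _ => by positivity) (add_unit_injective i))

theorem annih_apply (i : ℕ) (f : Fock) (m : ℕ → ℕ) : annih i f m = f (m + unit i) := rfl

open scoped Classical in
theorem annih_single (i : ℕ) (x : ℕ → ℕ) (c : ℂ) :
    annih i (lp.single 2 x c) = if x i ≠ 0 then lp.single 2 (x - unit i) c else 0 := by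
  ext m
  rw [annih_apply, lp.single_apply]
  split_ifs with h
  · rw [lp.single_apply]
    by_cases hm : m + unit i = x
    · subst hm
      rw [add_unit_sub]; simp
    · rw [Pi.single_eq_of_ne hm, Pi.single_eq_of_ne]
      rintro rfl
      exact hm (sub_unit_add h)
  · rw [Pi.single_eq_of_ne]
    · rfl
    · rintro rfl; simp [unit] at h

open scoped Classical in
theorem adjoint_annih_apply (i : ℕ) (f : Fock) (m : ℕ → ℕ) :
    ContinuousLinearMap.adjoint (annih i) f m = if m i ≠ 0 then f (m - unit i) else 0 := by
  have h : inner ℂ (lp.single 2 m (1 : ℂ)) (ContinuousLinearMap.adjoint (annih i) f)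
      = ContinuousLinearMap.adjoint (annih i) f m := by
    rw [lp.inner_single_left]; simp
  rw [← h, ContinuousLinearMap.adjoint_inner_right, annih_single]
  split_ifs with h1
  · rw [lp.inner_single_left]; simp
  · simp

/-- The annihilation operators, with the identity in place of the one for the urn `y`, which
thereby becomes an inexhaustible reservoir. -/
def reservoirOp (y i : ℕ) : Fock →L[ℂ] Fock := if i = y then 1 else annih i

theorem isFreeFock_reservoirOp (y : ℕ) : IsFreeFock (reservoirOp y) where
  comm i j x := by
    unfold reservoirOp
    split_ifs
    · rfl
    · rfl
    · rfl
    · ext m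
      simp only [annih_apply]
      rw [add_assoc, add_comm (unit i), ← add_assoc]
  coisometry i x := by
    unfold reservoirOp
    split_ifs
    · rw [← ContinuousLinearMap.star_eq_adjoint, star_one]; rfl
    · ext m
      rw [annih_apply, adjoint_annih_apply, if_pos (by simp [unit]), add_unit_sub]
  comm_adjoint i j x hij := by
    unfold reservoirOp
    have h1 : ContinuousLinearMap.adjoint (1 : Fock →L[ℂ] Fock) = 1 := by
      rw [← ContinuousLinearMap.star_eq_adjoint, star_one]
    split_ifs
    · rfl
    · rfl
    · rw [h1]; rfl
    · ext m
      simp only [annih_apply, adjoint_annih_apply]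
      have h2 : (m + unit i) j = m j := by simp [unit, hij.symm]
      rw [h2]
      split_ifs with h3
      · have h4 : m + unit i - unit j = m - unit j + unit i := by
          funext k
          by_cases hk : k = j
          · subst hk; simp [unit, hij.symm]
          · simp [unit, hk]
        rw [h4]
      · rfl

theorem vacOp_reservoir (y : ℕ) (x : Fock) : vacOp (reservoirOp y) y x = 0 := by
  have h1 : ContinuousLinearMap.adjoint (1 : Fock →L[ℂ] Fock) = 1 := by
    rw [← ContinuousLinearMap.star_eq_adjoint, star_one]
  rw [vacOp_apply, reservoirOp, if_pos rfl, h1]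
  simp

open scoped Classical in
theorem norm_sum_single_sq {α : Type*} (s : Finset α) (ρ : α → ℕ → ℕ) (hρ : Set.InjOn ρ s)
    (c : α → ℂ) :
    ‖∑ x ∈ s, (lp.single 2 (ρ x) (c x) : Fock)‖ ^ 2 = ∑ x ∈ s, ‖c x‖ ^ 2 := by
  have h := @inner_self_eq_norm_sq_to_K ℂ Fock _ _ _ (∑ x ∈ s, (lp.single 2 (ρ x) (c x) : Fock))
  have h2 := congrArg Complex.re h
  simp only [Complex.coe_algebraMap, ← Complex.ofReal_pow, Complex.ofReal_re] at h2
  rw [← h2, sum_inner, Complex.re_sum]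
  refine Finset.sum_congr rfl fun x hx => ?_
  rw [inner_sum, Finset.sum_eq_single x]
  · rw [lp.inner_single_left, lp.single_apply_self, inner_self_eq_norm_sq_to_K]
    simp [← Complex.ofReal_pow]
  · intro z hz hzx
    rw [lp.inner_single_left, lp.single_apply_ne, inner_zero_right]
    intro h; exact hzx (hρ hz hx h.symm)
  · intro h; exact absurd hx h

/-- A state annihilated by all bond operators is a multiple of `q ^ spread`. -/
theorem eq_of_bondOp_eq_zero {q : ℝ} {K y : ℕ} (hy : y < K) (w : Fock)
    (hw : ∀ i ∈ (Finset.range K).erase y, bondOp (reservoirOp y) (toward y) q i w = 0) (N : ℕ) :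
    ∀ m : ℕ → ℕ, m y = 0 → (∀ i, m i ≠ 0 → i < K) → spread K y m = N → w m = (q : ℂ) ^ N * w 0 := by
  induction N using Nat.strong_induction_on with
  | _ N ih =>
    intro m hmy hm hN
    by_cases h0 : m = 0
    · subst h0
      have : N = 0 := by rw [← hN]; simp [spread]
      simp [this]
    · obtain ⟨i, hi⟩ : ∃ i, m i ≠ 0 := by
        by_contra h; push Not at h; exact h0 (funext h)
      have hiK := hm i hi
      have hiy : i ≠ y := by rintro rfl; exact hi hmy
      have hb : bondOp (reservoirOp y) (toward y) q i w (m - unit i) = 0 := by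
        rw [hw i (Finset.mem_erase.2 ⟨hiy, Finset.mem_range.2 hiK⟩)]; rfl
      have hm' := sub_unit_add hi
      have hS : spread K y (m - unit i) + urnDist y i = N := by
        rw [← hN, ← spread_unit hiK, ← spread_add, hm']
      have hd := urnDist_toward hiy
      have htK := toward_lt hy hiK
      have hsupp : ∀ j, (m - unit i) j ≠ 0 → j < K := fun j hj => hm j (by
        intro h; apply hj; simp [h])
      have hmy' : (m - unit i) y = 0 := by simp [hmy]
      have hexp : bondOp (reservoirOp y) (toward y) q i w (m - unit i)
          = w m - q * (reservoirOp y (toward y i) w) (m - unit i) := by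
        rw [bondOp]
        simp only [_root_.sub_apply, _root_.smul_apply]
        rw [lp.coeFn_sub, lp.coeFn_smul, Pi.sub_apply, Pi.smul_apply, smul_eq_mul]
        congr 1
        rw [reservoirOp, if_neg hiy, annih_apply, hm']
      rw [hexp, sub_eq_zero] at hb
      rw [hb]
      by_cases hty : toward y i = y
      · have hd0 : urnDist y (toward y i) = 0 := by rw [hty]; simp [urnDist]
        rw [reservoirOp, if_pos hty]
        rw [show (1 : Fock →L[ℂ] Fock) w = w from rfl,
          ih (N - 1) (by omega) (m - unit i) hmy' hsupp (by omega), ← mul_assoc, ← pow_succ']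
        congr 2; omega
      · rw [reservoirOp, if_neg hty, annih_apply,
          ih (N - 1) (by omega) (m - unit i + unit (toward y i)) ?_ ?_ ?_, ← mul_assoc, ← pow_succ']
        · congr 2; omega
        · rw [Pi.add_apply, hmy']; simp [unit, Ne.symm hty]
        · intro j hj
          by_cases hjt : j = toward y i
          · rw [hjt]; exact htK
          · exact hsupp j (by simpa [unit, hjt] using hj)
        · rw [spread_add, spread_unit htK]; omega

theorem update_zero_injOn (K n y : ℕ) (hy : y < K) :
    Set.InjOn (fun ℓ : ℕ → ℕ => Function.update ℓ y 0) (urns K n : Set (ℕ → ℕ)) := by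
  intro a ha b hb h
  have h1 : ∀ i, i ≠ y → a i = b i := fun i hi => by
    have := congrFun h i
    simpa [hi] using this
  have ha' := (mem_urns.1 ha).1
  have hb' := (mem_urns.1 hb).1
  rw [← Finset.add_sum_erase _ _ (Finset.mem_range.2 hy)] at ha' hb'
  have h2 : ∑ i ∈ (Finset.range K).erase y, a i = ∑ i ∈ (Finset.range K).erase y, b i :=
    Finset.sum_congr rfl fun i hi => h1 i (Finset.ne_of_mem_erase hi)
  funext i
  by_cases hi : i = y
  · subst hi; omega
  · exact h1 i hi

open scoped Classical in
/-- For functions supported on configurations with a particle in the urn `y` and orthogonal to the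
ground state `q ^ spread`, the urn `y` is as good as a reservoir, and the gap is `(1 - q)²`. -/
theorem gap_urns {q : ℝ} (hq : 0 ≤ q) {K y : ℕ} (hy : y < K) (n : ℕ) (g : (ℕ → ℕ) → ℂ)
    (hsupp : ∀ ℓ, ℓ y = 0 → g ℓ = 0)
    (horth : ∑ ℓ ∈ urns K (n + 1), (q : ℂ) ^ spread K y ℓ * g ℓ = 0) :
    (1 - q) ^ 2 * ∑ ℓ ∈ urns K (n + 1), ‖g ℓ‖ ^ 2 ≤
      ∑ η ∈ urns K n, ∑ i ∈ (Finset.range K).erase y,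
        ‖g (η + unit i) - q * g (η + unit (toward y i))‖ ^ 2 := by
  -- With a reservoir in the urn `y` its occupation number is forgotten; it can be recovered from
  -- the total number of particles.
  set ρ : (ℕ → ℕ) → ℕ → ℕ := fun ℓ => Function.update ℓ y 0 with hρ
  set G : Fock := ∑ ℓ ∈ urns K (n + 1), lp.single 2 (ρ ℓ) (g ℓ) with hG
  have hA : ∀ j, j < K → reservoirOp y j G = ∑ η ∈ urns K n, lp.single 2 (ρ η) (g (η + unit j)) := by
    intro j hj
    have e1 : ∑ η ∈ urns K n, (lp.single 2 (ρ η) (g (η + unit j)) : Fock)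
        = ∑ ℓ ∈ urns K (n + 1), if ℓ j ≠ 0 then lp.single 2 (ρ (ℓ - unit j)) (g ℓ) else 0 := by
      rw [sum_urns_succ n hj (fun ℓ => (lp.single 2 (ρ (ℓ - unit j)) (g ℓ) : Fock))]
      simp only [add_unit_sub]
    rw [e1, hG, map_sum]
    refine Finset.sum_congr rfl fun ℓ _ => ?_
    unfold reservoirOp
    by_cases hjy : j = y
    · subst hjy
      rw [if_pos rfl]
      split_ifs with h
      · have : ρ (ℓ - unit j) = ρ ℓ := by
          funext k
          by_cases hk : k = j
          · subst hk; simp [hρ]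
          · simp [hρ, hk, unit]
        rw [this]; rfl
      · rw [hsupp ℓ (not_not.1 h), lp.single_zero, map_zero]
    · rw [if_neg hjy, annih_single]
      have h1 : ρ ℓ j = ℓ j := by simp [hρ, hjy]
      rw [h1]
      split_ifs with h
      · congr 1
        funext k
        by_cases hk : k = y
        · subst hk; simp [hρ]
        · simp [hρ, hk]
      · rfl
  have hb : ∀ i ∈ (Finset.range K).erase y, bondOp (reservoirOp y) (toward y) q i G =
      ∑ η ∈ urns K n, lp.single 2 (ρ η) (g (η + unit i) - q * g (η + unit (toward y i))) := by
    intro i hi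
    have hiK := Finset.mem_range.1 (Finset.mem_of_mem_erase hi)
    rw [bondOp, _root_.sub_apply, _root_.smul_apply, hA i hiK,
      hA _ (toward_lt hy hiK), Finset.smul_sum, ← Finset.sum_sub_distrib]
    refine Finset.sum_congr rfl fun η _ => ?_
    rw [lp.single_sub, ← smul_eq_mul (q : ℂ), lp.single_smul]
  have key := (isFreeFock_reservoirOp y).gap hq (J := (Finset.range K).erase y) (t := toward y)
    ?_ ?_ ?_ G ?_
  · rw [hG, norm_sum_single_sq _ ρ (update_zero_injOn K _ y hy)] at key
    refine key.trans (le_of_eq ?_)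
    rw [Finset.sum_comm]
    refine Finset.sum_congr rfl fun i hi => ?_
    rw [← hG, hb i hi, norm_sum_single_sq _ ρ (update_zero_injOn K _ y hy)]
  · intro a ha
    have := Finset.ne_of_mem_erase ha
    unfold toward; split_ifs <;> omega
  · intro a ha c hc hta h
    have h1 := Finset.ne_of_mem_erase ha
    have h2 := Finset.ne_of_mem_erase hc
    have h3 := Finset.ne_of_mem_erase hta
    unfold toward at h h3
    split_ifs at h h3 <;> omega
  · intro a ha hta x
    have h1 : toward y a = y := by
      by_contra h
      exact hta (Finset.mem_erase.2 ⟨h, Finset.mem_range.2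
        (toward_lt hy (Finset.mem_range.1 (Finset.mem_of_mem_erase ha)))⟩)
    rw [h1, vacOp_reservoir]
  · intro w hw
    have h1 : inner ℂ w G
        = (starRingEnd ℂ) (w 0) * ∑ ℓ ∈ urns K (n + 1), (q : ℂ) ^ spread K y ℓ * g ℓ := by
      rw [hG, inner_sum, Finset.mul_sum]
      refine Finset.sum_congr rfl fun ℓ hℓ => ?_
      rw [lp.inner_single_right, eq_of_bondOp_eq_zero hy w hw (spread K y ℓ) (ρ ℓ) (by simp [hρ])]
      · simp; ring
      · intro i hi
        refine (mem_urns.1 hℓ).2 i ?_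
        by_cases hiy : i = y
        · subst hiy; simp [hρ] at hi
        · simpa [hρ, hiy] using hi
      · refine Finset.sum_congr rfl fun i _ => ?_
        by_cases hiy : i = y
        · subst hiy; simp [urnDist]
        · simp [hρ, hiy]
    rw [h1, horth, mul_zero]

/-! ### The Hamiltonian in terms of occupation numbers -/

/-- The hopping amplitude `1 / (2 Δ)` as a function of `q`. -/
def hop (q : ℝ) : ℝ := q / (1 + q ^ 2)

/-- The boundary field `A(Δ)` as a function of `q`. -/
def field (q : ℝ) : ℝ := (1 - q ^ 2) / (2 * (1 + q ^ 2))

/-- The gap `1 - 1 / Δ` as a function of `q`. -/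
def gap (q : ℝ) : ℝ := (1 - q) ^ 2 / (1 + q ^ 2)

theorem gap_eq (q : ℝ) : gap q = 1 - 2 * hop q := by
  have : (1 + q ^ 2) ≠ 0 := by positivity
  unfold gap hop; field_simp; ring

theorem hop_nonneg {q : ℝ} (hq : 0 ≤ q) : 0 ≤ hop q := by unfold hop; positivity

theorem hop_le_half (q : ℝ) : hop q ≤ 1 / 2 := by
  have : 0 ≤ gap q := by unfold gap; positivity
  rw [gap_eq] at this; linarith

theorem gap_pos {q : ℝ} (hq1 : q < 1) : 0 < gap q := by
  have : 0 < 1 - q := by linarith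
  unfold gap; positivity

theorem field_nonneg {q : ℝ} (hq : 0 ≤ q) (hq1 : q < 1) : 0 ≤ field q := by
  have : 0 ≤ 1 - q ^ 2 := by nlinarith
  unfold field; positivity

theorem field_le_half (q : ℝ) : field q ≤ 1 / 2 := by
  unfold field
  rw [div_le_div_iff₀ (by positivity) (by positivity)]
  nlinarith [sq_nonneg q]

/-- The Hamiltonian, up to the constant `A(Δ)`, of one particle in the urns `0, …, M`, i.e. of one
down spin among `M` up spins. -/
def oneOp (q : ℝ) (M : ℕ) (v : ℕ → ℂ) (i : ℕ) : ℂ :=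
  (if i = 0 then field q * v i else v i / 2 - hop q * v (i - 1))
    + (if i = M then field q * v i else v i / 2 - hop q * v (i + 1))

/-- The part of the quadratic form of `oneOp` that belongs to a bond between two urns. -/
def bondForm (q : ℝ) (z w : ℂ) : ℝ :=
  ‖z‖ ^ 2 / 2 + ‖w‖ ^ 2 / 2 - 2 * hop q * (inner ℂ z w).re

/-- The quadratic form of `oneOp`. -/
def oneForm (q : ℝ) (M : ℕ) (v : ℕ → ℂ) : ℝ :=
  ∑ i ∈ Finset.range M, bondForm q (v i) (v (i + 1)) + field q * (‖v 0‖ ^ 2 + ‖v M‖ ^ 2)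

theorem norm_sub_smul_sq (q : ℝ) (z w : ℂ) :
    ‖z - q * w‖ ^ 2 = ‖z‖ ^ 2 - 2 * q * (inner ℂ z w).re + q ^ 2 * ‖w‖ ^ 2 := by
  have h := inner_smul_right (𝕜 := ℂ) z w (q : ℂ)
  rw [smul_eq_mul] at h
  rw [@norm_sub_sq ℂ, h, norm_mul, mul_pow]
  simp
  ring

theorem bondForm_eq_left (q : ℝ) (z w : ℂ) :
    bondForm q z w = 1 / (1 + q ^ 2) * ‖z - q * w‖ ^ 2 + field q * (‖w‖ ^ 2 - ‖z‖ ^ 2) := by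
  have : (1 + q ^ 2) ≠ 0 := by positivity
  rw [norm_sub_smul_sq, bondForm, hop, field]
  field_simp
  ring

theorem bondForm_comm (q : ℝ) (z w : ℂ) : bondForm q z w = bondForm q w z := by
  have h : (inner ℂ z w).re = (inner ℂ w z).re := by
    rw [← inner_conj_symm]; simp
  unfold bondForm; rw [h]; ring

theorem sum_erase_toward {α : Type*} [AddCommMonoid α] {M y : ℕ} (hy : y ≤ M) (F : ℕ → ℕ → α) :
    ∑ i ∈ (Finset.range (M + 1)).erase y, F i (toward y i)
      = ∑ i ∈ Finset.range y, F i (i + 1) + ∑ i ∈ Finset.Ico y M, F (i + 1) i := by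
  have h : (Finset.range (M + 1)).erase y = Finset.range y ∪ Finset.Ico (y + 1) (M + 1) := by
    ext i; simp only [Finset.mem_erase, Finset.mem_range, Finset.mem_union, Finset.mem_Ico]; omega
  rw [h, Finset.sum_union, ← Finset.sum_Ico_add' (fun i => F i (toward y i)) y M 1]
  · congr 1
    · refine Finset.sum_congr rfl fun i hi => ?_
      rw [toward, if_pos (Finset.mem_range.1 hi)]
    · refine Finset.sum_congr rfl fun i hi => ?_
      have := (Finset.mem_Ico.1 hi).1
      rw [toward, if_neg (by omega)]; rfl
  · refine Finset.disjoint_left.2 fun i hi hi' => ?_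
    have h1 := Finset.mem_range.1 hi
    have h2 := (Finset.mem_Ico.1 hi').1
    omega

/-- Orienting all bonds towards the urn `y`, the boundary terms telescope to a term at `y`. -/
theorem oneForm_eq (q : ℝ) {M y : ℕ} (hy : y ≤ M) (v : ℕ → ℂ) :
    oneForm q M v = 1 / (1 + q ^ 2) *
      ∑ i ∈ (Finset.range (M + 1)).erase y, ‖v i - q * v (toward y i)‖ ^ 2
      + 2 * field q * ‖v y‖ ^ 2 := by
  rw [sum_erase_toward hy fun i j => ‖v i - q * v j‖ ^ 2, oneForm,
    ← Finset.sum_range_add_sum_Ico _ hy]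
  have h1 : ∑ i ∈ Finset.range y, bondForm q (v i) (v (i + 1))
      = 1 / (1 + q ^ 2) * ∑ i ∈ Finset.range y, ‖v i - q * v (i + 1)‖ ^ 2
        + field q * (‖v y‖ ^ 2 - ‖v 0‖ ^ 2) := by
    rw [← Finset.sum_range_sub (fun i => ‖v i‖ ^ 2), Finset.mul_sum, Finset.mul_sum,
      ← Finset.sum_add_distrib]
    exact Finset.sum_congr rfl fun i _ => bondForm_eq_left _ _ _
  have h2 : ∑ i ∈ Finset.Ico y M, bondForm q (v i) (v (i + 1))
      = 1 / (1 + q ^ 2) * ∑ i ∈ Finset.Ico y M, ‖v (i + 1) - q * v i‖ ^ 2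
        - field q * (‖v M‖ ^ 2 - ‖v y‖ ^ 2) := by
    rw [← Finset.sum_Ico_sub (fun i => ‖v i‖ ^ 2) hy, Finset.mul_sum, Finset.mul_sum,
      ← Finset.sum_sub_distrib]
    refine Finset.sum_congr rfl fun i _ => ?_
    rw [bondForm_comm, bondForm_eq_left]; ring
  rw [h1, h2]
  ring

theorem sum_conj_mul_oneOp (q : ℝ) (M : ℕ) (v : ℕ → ℂ) :
    ∑ i ∈ Finset.range (M + 1), (starRingEnd ℂ) (v i) * oneOp q M v i = oneForm q M v := by
  have hc : ∀ z : ℂ, (starRingEnd ℂ) z * z = ((‖z‖ ^ 2 : ℝ) : ℂ) := fun z => by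
    rw [Complex.conj_mul']; push_cast; rfl
  have hr : ∀ z w : ℂ, (starRingEnd ℂ) z * w + (starRingEnd ℂ) w * z
      = ((2 * (inner ℂ z w).re : ℝ) : ℂ) := fun z w => by
    have h := Complex.add_conj (inner ℂ z w)
    rw [inner_conj_symm] at h
    rw [RCLike.inner_apply', RCLike.inner_apply'] at h
    rw [RCLike.inner_apply', h]
  unfold oneOp
  simp only [mul_add, Finset.sum_add_distrib]
  rw [Finset.sum_range_succ', Finset.sum_range_succ _ M]
  have e1 : ∀ i ∈ Finset.range M, (starRingEnd ℂ) (v i) *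
      (if i = M then field q * v i else v i / 2 - hop q * v (i + 1))
      = (starRingEnd ℂ) (v i) * (v i / 2 - hop q * v (i + 1)) := fun i hi => by
    rw [if_neg (Finset.mem_range.1 hi).ne]
  rw [Finset.sum_congr rfl e1]
  simp only [Nat.add_eq_zero_iff, one_ne_zero, and_false, if_false, if_true, Nat.add_sub_cancel]
  have e2 : ∑ i ∈ Finset.range M, (starRingEnd ℂ) (v (i + 1)) * (v (i + 1) / 2 - hop q * v i)
      + ∑ i ∈ Finset.range M, (starRingEnd ℂ) (v i) * (v i / 2 - hop q * v (i + 1))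
      = ((∑ i ∈ Finset.range M, bondForm q (v i) (v (i + 1)) : ℝ) : ℂ) := by
    rw [← Finset.sum_add_distrib, Complex.ofReal_sum]
    refine Finset.sum_congr rfl fun i _ => ?_
    have h := hr (v i) (v (i + 1))
    have h3 := hc (v i)
    have h4 := hc (v (i + 1))
    unfold bondForm
    push_cast at h h3 h4 ⊢
    linear_combination (1 / 2 : ℂ) * h3 + (1 / 2 : ℂ) * h4 - (hop q : ℂ) * h
  have h0 := hc (v 0)
  have hM := hc (v M)
  unfold oneForm
  push_cast at e2 h0 hM ⊢
  linear_combination e2 + (field q : ℂ) * h0 + (field q : ℂ) * hM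

/-- The operator `oneOp` maps the vector `q ^ |j - y|` to a multiple of the unit vector at `y`. -/
theorem oneOp_pow_urnDist {q : ℝ} {M y : ℕ} (hy : y ≤ M) (i : ℕ) :
    oneOp q M (fun j => (q : ℂ) ^ urnDist y j) i = if i = y then 2 * (field q : ℂ) else 0 := by
  have hne : (1 + (q : ℂ) ^ 2) ≠ 0 := by
    have : (1 + q ^ 2) ≠ 0 := by positivity
    exact_mod_cast this
  have hin : (1 / 2 : ℂ) - hop q * q = field q := by
    unfold hop field; push_cast; field_simp; ring
  have hout : (q : ℂ) / 2 - hop q = - field q * q := by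
    unfold hop field; push_cast; field_simp; ring
  set d := urnDist y i with hd
  have hleft : i ≤ y → (if i = 0 then field q * (q : ℂ) ^ d
      else (q : ℂ) ^ d / 2 - hop q * (q : ℂ) ^ urnDist y (i - 1)) = field q * (q : ℂ) ^ d := by
    intro h
    split_ifs with h0
    · rfl
    · have : urnDist y (i - 1) = d + 1 := by rw [hd]; unfold urnDist; omega
      rw [this, pow_succ]; linear_combination (q : ℂ) ^ d * hin
  have hright : y ≤ i → (if i = M then field q * (q : ℂ) ^ d
      else (q : ℂ) ^ d / 2 - hop q * (q : ℂ) ^ urnDist y (i + 1)) = field q * (q : ℂ) ^ d := by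
    intro h
    split_ifs with h0
    · rfl
    · have : urnDist y (i + 1) = d + 1 := by rw [hd]; unfold urnDist; omega
      rw [this, pow_succ]; linear_combination (q : ℂ) ^ d * hin
  have hback : ∀ d', d = d' + 1 →
      (q : ℂ) ^ d / 2 - hop q * (q : ℂ) ^ d' = - field q * (q : ℂ) ^ d := by
    intro d' h
    rw [h, pow_succ]; linear_combination (q : ℂ) ^ d' * hout
  unfold oneOp
  rcases lt_trichotomy i y with h | h | h
  · rw [hleft h.le, if_neg (show i ≠ M by omega), if_neg h.ne,
      hback (urnDist y (i + 1)) (by rw [hd]; unfold urnDist; omega)]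
    ring
  · rw [hleft h.le, hright h.ge, if_pos h]
    have : d = 0 := by rw [hd, h]; unfold urnDist; omega
    rw [this]; ring
  · rw [hright h.le, if_neg (show i ≠ 0 by omega), if_neg h.ne',
      hback (urnDist y (i - 1)) (by rw [hd]; unfold urnDist; omega)]
    ring

/-- The Hamiltonian, up to the constant `A(Δ)`, on functions of the occupation numbers of the urns
`0, …, M`: one particle in each nonempty urn is subject to `oneOp`. -/
def urnOp (q : ℝ) (M : ℕ) (g : (ℕ → ℕ) → ℂ) (ℓ : ℕ → ℕ) : ℂ :=
  ∑ i ∈ Finset.range (M + 1),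
    if ℓ i ≠ 0 then oneOp q M (fun j => g (ℓ - unit i + unit j)) i else 0

/-- The quadratic form of `urnOp` for `n + 1` particles. -/
def urnForm (q : ℝ) (M n : ℕ) (g : (ℕ → ℕ) → ℂ) : ℝ :=
  ∑ η ∈ urns (M + 1) n, oneForm q M fun i => g (η + unit i)

theorem sum_conj_mul_urnOp (q : ℝ) (M n : ℕ) (g : (ℕ → ℕ) → ℂ) :
    ∑ ℓ ∈ urns (M + 1) (n + 1), (starRingEnd ℂ) (g ℓ) * urnOp q M g ℓ = urnForm q M n g := by
  unfold urnOp urnForm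
  simp only [Finset.mul_sum, mul_ite, mul_zero]
  rw [Finset.sum_comm, Complex.ofReal_sum]
  simp_rw [← sum_conj_mul_oneOp]
  rw [Finset.sum_comm (s := urns (M + 1) n)]
  refine Finset.sum_congr rfl fun i hi => ?_
  rw [sum_urns_succ n (Finset.mem_range.1 hi)
    (fun ℓ => (starRingEnd ℂ) (g ℓ) * oneOp q M (fun j => g (ℓ - unit i + unit j)) i)]
  simp only [add_unit_sub]

/-- The states `q ^ spread` satisfy the eigenvalue equation on the configurations with a particle
in the urn `y`. -/
theorem urnOp_pow_spread {q : ℝ} {M y : ℕ} (hy : y ≤ M) (ℓ : ℕ → ℕ) :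
    urnOp q M (fun m => (q : ℂ) ^ spread (M + 1) y m) ℓ
      = if ℓ y ≠ 0 then 2 * field q * (q : ℂ) ^ spread (M + 1) y ℓ else 0 := by
  have hlin : ∀ (c : ℂ) (v : ℕ → ℂ) (i : ℕ), oneOp q M (fun j => c * v j) i = c * oneOp q M v i := by
    intro c v i; unfold oneOp; split_ifs <;> ring
  have hcongr : ∀ (v w : ℕ → ℂ) (i : ℕ), i ≤ M → (∀ j ≤ M, v j = w j) →
      oneOp q M v i = oneOp q M w i := by
    intro v w i hi h
    unfold oneOp
    rw [h i hi, h (i - 1) (by omega)]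
    by_cases h0 : i = M
    · simp [h0]
    · rw [h (i + 1) (by omega)]
  have key : ∀ i ∈ Finset.range (M + 1), (if ℓ i ≠ 0 then
      oneOp q M (fun j => (q : ℂ) ^ spread (M + 1) y (ℓ - unit i + unit j)) i else 0)
      = if i = y then (if ℓ y ≠ 0 then 2 * field q * (q : ℂ) ^ spread (M + 1) y ℓ else 0)
        else 0 := by
    intro i hi
    rw [hcongr _ (fun j => (q : ℂ) ^ spread (M + 1) y (ℓ - unit i) * (q : ℂ) ^ urnDist y j) i
      (Nat.lt_succ_iff.1 (Finset.mem_range.1 hi)) (fun j hj => by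
        rw [spread_add, spread_unit (Nat.lt_succ_of_le hj), pow_add]), hlin, oneOp_pow_urnDist hy]
    by_cases hiy : i = y
    · subst hiy
      rw [if_pos rfl, if_pos rfl]
      split_ifs with h
      · have h1 : spread (M + 1) i (ℓ - unit i) = spread (M + 1) i ℓ := by
          conv_rhs => rw [← sub_unit_add h, spread_add, spread_unit (Nat.lt_succ_of_le hy)]
          simp [urnDist]
        rw [h1]; ring
      · rfl
    · rw [if_neg hiy, if_neg hiy]; simp
  rw [urnOp, Finset.sum_congr rfl key, Finset.sum_ite_eq', if_pos (Finset.mem_range.2 (by omega))]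

/-! ### Bounds on the quadratic form -/

theorem abs_two_re_inner_le (z w : ℂ) : |2 * (inner ℂ z w).re| ≤ ‖z‖ ^ 2 + ‖w‖ ^ 2 := by
  have h1 := re_inner_le_half z w
  have h2 := re_inner_le_half (-z) w
  rw [inner_neg_left, norm_neg, Complex.neg_re] at h2
  rw [abs_le]; constructor <;> linarith

theorem bondForm_ge {q : ℝ} (hq : 0 ≤ q) (z w : ℂ) :
    gap q / 2 * (‖z‖ ^ 2 + ‖w‖ ^ 2) ≤ bondForm q z w := by
  have h := mul_le_mul_of_nonneg_left (abs_le.1 (abs_two_re_inner_le z w)).2 (hop_nonneg hq)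
  rw [gap_eq, bondForm]; nlinarith

theorem bondForm_le {q : ℝ} (hq : 0 ≤ q) (z w : ℂ) : bondForm q z w ≤ ‖z‖ ^ 2 + ‖w‖ ^ 2 := by
  have h := mul_le_mul_of_nonneg_left (abs_le.1 (abs_two_re_inner_le z w)).1 (hop_nonneg hq)
  have h2 := hop_le_half q
  rw [bondForm]; nlinarith [sq_nonneg ‖z‖, sq_nonneg ‖w‖]

theorem oneForm_nonneg {q : ℝ} (hq : 0 ≤ q) (hq1 : q < 1) (M : ℕ) (v : ℕ → ℂ) :
    0 ≤ oneForm q M v := by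
  have := field_nonneg hq hq1
  have := gap_pos hq1
  refine add_nonneg (Finset.sum_nonneg fun i _ => le_trans (by positivity) (bondForm_ge hq _ _))
    (by positivity)

theorem oneForm_le {q : ℝ} (hq : 0 ≤ q) (M : ℕ) (v : ℕ → ℂ) :
    oneForm q M v ≤ 3 * ∑ i ∈ Finset.range (M + 1), ‖v i‖ ^ 2 := by
  have h1 : ∑ i ∈ Finset.range M, bondForm q (v i) (v (i + 1))
      ≤ ∑ i ∈ Finset.range M, ‖v i‖ ^ 2 + ∑ i ∈ Finset.range M, ‖v (i + 1)‖ ^ 2 := by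
    rw [← Finset.sum_add_distrib]
    exact Finset.sum_le_sum fun i _ => bondForm_le hq _ _
  have h2 := Finset.sum_range_succ (fun i => ‖v i‖ ^ 2) M
  have h3 := Finset.sum_range_succ' (fun i => ‖v i‖ ^ 2) M
  have h4 : 0 ≤ ∑ i ∈ Finset.range M, ‖v i‖ ^ 2 := Finset.sum_nonneg fun _ _ => by positivity
  have h5 : 0 ≤ ∑ i ∈ Finset.range M, ‖v (i + 1)‖ ^ 2 := Finset.sum_nonneg fun _ _ => by positivity
  have h6 := mul_le_mul_of_nonneg_right (field_le_half q)
    (show 0 ≤ ‖v 0‖ ^ 2 + ‖v M‖ ^ 2 by positivity)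
  have h7 : 0 ≤ ‖v 0‖ ^ 2 := by positivity
  have h8 : 0 ≤ ‖v M‖ ^ 2 := by positivity
  unfold oneForm
  linarith

theorem urnForm_nonneg {q : ℝ} (hq : 0 ≤ q) (hq1 : q < 1) (M n : ℕ) (g : (ℕ → ℕ) → ℂ) :
    0 ≤ urnForm q M n g :=
  Finset.sum_nonneg fun _ _ => oneForm_nonneg hq hq1 M _

theorem urnForm_le {q : ℝ} (hq : 0 ≤ q) (M n : ℕ) (g : (ℕ → ℕ) → ℂ) :
    urnForm q M n g ≤ 3 * (n + 1) * ∑ ℓ ∈ urns (M + 1) (n + 1), ‖g ℓ‖ ^ 2 := by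
  have h1 : urnForm q M n g
      ≤ ∑ η ∈ urns (M + 1) n, 3 * ∑ i ∈ Finset.range (M + 1), ‖g (η + unit i)‖ ^ 2 :=
    Finset.sum_le_sum fun η _ => oneForm_le hq M _
  refine h1.trans ?_
  rw [← Finset.mul_sum, Finset.sum_comm, mul_assoc]
  refine mul_le_mul_of_nonneg_left ?_ (by norm_num)
  have h2 : ∀ i ∈ Finset.range (M + 1), ∑ η ∈ urns (M + 1) n, ‖g (η + unit i)‖ ^ 2
      ≤ ∑ ℓ ∈ urns (M + 1) (n + 1), (ℓ i : ℝ) * ‖g ℓ‖ ^ 2 := by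
    intro i hi
    rw [← sum_urns_succ n (Finset.mem_range.1 hi) (fun ℓ => ‖g ℓ‖ ^ 2)]
    refine Finset.sum_le_sum fun ℓ _ => ?_
    split_ifs with h
    · have : (1 : ℝ) ≤ ℓ i := by exact_mod_cast Nat.one_le_iff_ne_zero.2 h
      nlinarith [sq_nonneg ‖g ℓ‖]
    · positivity
  refine (Finset.sum_le_sum h2).trans (le_of_eq ?_)
  rw [Finset.sum_comm, Finset.mul_sum]
  refine Finset.sum_congr rfl fun ℓ hℓ => ?_
  rw [← Finset.sum_mul, ← Nat.cast_sum, (mem_urns.1 hℓ).1]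
  push_cast; rfl

/-! ### Localization at one urn -/

/-- The Euclidean length of the vector of occupation numbers. -/
def occNorm (M : ℕ) (ℓ : ℕ → ℕ) : ℝ := Real.sqrt (∑ i ∈ Finset.range (M + 1), (ℓ i : ℝ) ^ 2)

/-- The localization function of the urn `y`: the cosine of the angle between the vector of
occupation numbers and the `y`-axis. The squares sum to `1`. -/
def loc (M y : ℕ) (ℓ : ℕ → ℕ) : ℝ := ℓ y / occNorm M ℓ

theorem occNorm_sq (M : ℕ) (ℓ : ℕ → ℕ) :
    occNorm M ℓ ^ 2 = ∑ i ∈ Finset.range (M + 1), (ℓ i : ℝ) ^ 2 :=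
  Real.sq_sqrt (Finset.sum_nonneg fun _ _ => by positivity)

theorem le_occNorm_sq {M n : ℕ} {ℓ : ℕ → ℕ} (h : ℓ ∈ urns (M + 1) n) : (n : ℝ) ≤ occNorm M ℓ ^ 2 := by
  rw [occNorm_sq, ← (mem_urns.1 h).1, Nat.cast_sum]
  refine Finset.sum_le_sum fun i _ => ?_
  exact_mod_cast Nat.le_self_pow two_ne_zero (ℓ i)

theorem occNorm_pos {M n : ℕ} {ℓ : ℕ → ℕ} (h : ℓ ∈ urns (M + 1) (n + 1)) : 0 < occNorm M ℓ := by
  have h1 := le_occNorm_sq h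
  have h2 : 0 ≤ occNorm M ℓ := Real.sqrt_nonneg _
  rcases h2.eq_or_lt with h3 | h3
  · rw [← h3] at h1; push_cast at h1; nlinarith [Nat.cast_nonneg (α := ℝ) n]
  · exact h3

theorem sum_loc_sq {M n : ℕ} {ℓ : ℕ → ℕ} (h : ℓ ∈ urns (M + 1) (n + 1)) :
    ∑ y ∈ Finset.range (M + 1), loc M y ℓ ^ 2 = 1 := by
  have := occNorm_pos h
  simp only [loc, div_pow]
  rw [← Finset.sum_div, ← occNorm_sq, div_self (by positivity)]

/-- Moving one particle turns the vector of occupation numbers by a small angle. -/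
theorem sum_loc_mul_loc {M n i j : ℕ} (hij : i ≠ j) (hi : i ≤ M) (hj : j ≤ M) {η : ℕ → ℕ}
    (h : η ∈ urns (M + 1) n) :
    |1 - ∑ y ∈ Finset.range (M + 1), loc M y (η + unit i) * loc M y (η + unit j)|
      ≤ 1 / (n + 1) := by
  have hi' := (add_unit_mem (Nat.lt_succ_of_le hi)).2 h
  have hj' := (add_unit_mem (Nat.lt_succ_of_le hj)).2 h
  set a := η + unit i with ha
  set b := η + unit j with hb
  have ha0 := occNorm_pos hi'
  have hb0 := occNorm_pos hj'
  have ha1 := le_occNorm_sq hi'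
  have hb1 := le_occNorm_sq hj'
  have ha2 := occNorm_sq M a
  have hb2 := occNorm_sq M b
  set x := occNorm M a
  set z := occNorm M b
  have hdist : ∑ y ∈ Finset.range (M + 1), ((a y : ℝ) - b y) ^ 2 = 2 := by
    have : ∀ y, ((a y : ℝ) - b y) ^ 2 = (if y = i then 1 else 0) + if y = j then 1 else 0 := by
      intro y
      simp only [ha, hb, unit, Pi.add_apply, Pi.single_apply]
      by_cases h1 : y = i
      · have : y ≠ j := h1 ▸ hij
        simp [h1, hij]
      · by_cases h2 : y = j
        · simp [h2, hij.symm]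
        · simp [h1, h2]
    simp only [this, Finset.sum_add_distrib, Finset.sum_ite_eq', Finset.mem_range]
    rw [if_pos (by omega), if_pos (by omega)]; norm_num
  have hinner : ∑ y ∈ Finset.range (M + 1), (a y : ℝ) * b y = (x ^ 2 + z ^ 2) / 2 - 1 := by
    have : ∑ y ∈ Finset.range (M + 1), ((a y : ℝ) - b y) ^ 2
        = x ^ 2 + z ^ 2 - 2 * ∑ y ∈ Finset.range (M + 1), (a y : ℝ) * b y := by
      rw [ha2, hb2, Finset.mul_sum, ← Finset.sum_add_distrib, ← Finset.sum_sub_distrib]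
      exact Finset.sum_congr rfl fun y _ => by ring
    linarith
  have hcs : (∑ y ∈ Finset.range (M + 1), (a y : ℝ) * b y) ≤ x * z := by
    have h1 := Finset.sum_mul_sq_le_sq_mul_sq (Finset.range (M + 1)) (fun y => (a y : ℝ))
      (fun y => (b y : ℝ))
    rw [← ha2, ← hb2, ← mul_pow] at h1
    exact le_of_sq_le_sq h1 (by positivity)
  have hsum : ∑ y ∈ Finset.range (M + 1), loc M y a * loc M y b
      = (∑ y ∈ Finset.range (M + 1), (a y : ℝ) * b y) / (x * z) := by
    rw [Finset.sum_div]
    exact Finset.sum_congr rfl fun y _ => by unfold loc; rw [div_mul_div_comm]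
  have hxz : 0 < x * z := by positivity
  have hn : (n : ℝ) + 1 ≤ x * z := by
    refine le_of_sq_le_sq ?_ hxz.le
    push_cast at ha1 hb1
    rw [mul_pow, sq ((n : ℝ) + 1)]
    exact mul_le_mul ha1 hb1 (by positivity) (by positivity)
  rw [hsum, abs_of_nonneg]
  · rw [sub_le_iff_le_add, ← sub_le_iff_le_add']
    calc 1 - 1 / ((n : ℝ) + 1) ≤ 1 - 1 / (x * z) :=
          sub_le_sub_left (one_div_le_one_div_of_le (by positivity) hn) _
      _ ≤ _ := by
          rw [hinner, le_div_iff₀ hxz, sub_mul, one_div_mul_cancel hxz.ne']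
          nlinarith [sq_nonneg (x - z)]
  · rw [sub_nonneg, div_le_one hxz]; exact hcs

/-- The localization functions cut the quadratic form into pieces at a relative cost `O(1 / n)`:
their squares sum to `1`, and moving one of `n` particles changes them little. -/
theorem sum_oneForm_loc_le {q : ℝ} (hq : 0 ≤ q) (hq1 : q < 1) {M n : ℕ} {η : ℕ → ℕ}
    (h : η ∈ urns (M + 1) n) (v : ℕ → ℂ) :
    ∑ y ∈ Finset.range (M + 1), oneForm q M (fun i => loc M y (η + unit i) * v i)
      ≤ (1 + 2 * hop q / (gap q * (n + 1))) * oneForm q M v := by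
  have hg := gap_pos hq1
  have hh := hop_nonneg hq
  have hf := field_nonneg hq hq1
  have hnorm : ∀ i, i ≤ M →
      ∑ y ∈ Finset.range (M + 1), ‖(loc M y (η + unit i) : ℂ) * v i‖ ^ 2 = ‖v i‖ ^ 2 := by
    intro i hi
    simp only [norm_mul, mul_pow, Complex.norm_real, Real.norm_eq_abs, sq_abs]
    rw [← Finset.sum_mul, sum_loc_sq ((add_unit_mem (Nat.lt_succ_of_le hi)).2 h), one_mul]
  have hbond : ∀ i ∈ Finset.range M,
      ∑ y ∈ Finset.range (M + 1), bondForm q (loc M y (η + unit i) * v i)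
        (loc M y (η + unit (i + 1)) * v (i + 1))
      ≤ (1 + 2 * hop q / (gap q * (n + 1))) * bondForm q (v i) (v (i + 1)) := by
    intro i hi
    have hi := Finset.mem_range.1 hi
    have hin : ∀ (a b : ℝ) (z w : ℂ), (inner ℂ ((a : ℂ) * z) ((b : ℂ) * w)).re
        = a * b * (inner ℂ z w).re := by
      intro a b z w
      have h1 := inner_smul_left (𝕜 := ℂ) z ((b : ℂ) * w) (a : ℂ)
      have h2 := inner_smul_right (𝕜 := ℂ) z w (b : ℂ)
      rw [smul_eq_mul] at h1 h2
      rw [h1, h2, Complex.conj_ofReal, ← mul_assoc, ← Complex.ofReal_mul]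
      simp
    set c := ∑ y ∈ Finset.range (M + 1), loc M y (η + unit i) * loc M y (η + unit (i + 1)) with hc
    have hexp : ∑ y ∈ Finset.range (M + 1), bondForm q (loc M y (η + unit i) * v i)
        (loc M y (η + unit (i + 1)) * v (i + 1))
        = bondForm q (v i) (v (i + 1)) + hop q * ((1 - c) * (2 * (inner ℂ (v i) (v (i + 1))).re)) := by
      unfold bondForm
      simp only [Finset.sum_sub_distrib, Finset.sum_add_distrib, ← Finset.sum_div, ← Finset.mul_sum,
        hin, ← Finset.sum_mul]
      rw [hnorm i hi.le, hnorm (i + 1) hi, ← hc]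
      ring
    have hc1 : |1 - c| ≤ 1 / (n + 1) := sum_loc_mul_loc (by omega) hi.le hi h
    have h2 : (1 - c) * (2 * (inner ℂ (v i) (v (i + 1))).re)
        ≤ 1 / (n + 1) * (‖v i‖ ^ 2 + ‖v (i + 1)‖ ^ 2) := by
      refine (le_abs_self _).trans ?_
      rw [abs_mul]
      exact mul_le_mul hc1 (abs_two_re_inner_le _ _) (abs_nonneg _) (by positivity)
    have h3 := bondForm_ge hq (v i) (v (i + 1))
    have h4 : ‖v i‖ ^ 2 + ‖v (i + 1)‖ ^ 2 ≤ 2 / gap q * bondForm q (v i) (v (i + 1)) := by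
      rw [div_mul_eq_mul_div, le_div_iff₀ hg]; linarith
    rw [hexp, add_mul, one_mul]
    refine add_le_add_right ?_ _
    calc _ ≤ hop q * (1 / (n + 1) * (2 / gap q * bondForm q (v i) (v (i + 1)))) :=
          mul_le_mul_of_nonneg_left (h2.trans (mul_le_mul_of_nonneg_left h4 (by positivity))) hh
      _ = _ := by field_simp
  unfold oneForm
  rw [Finset.sum_add_distrib, ← Finset.mul_sum, Finset.sum_add_distrib, hnorm 0 (Nat.zero_le _),
    hnorm M le_rfl, Finset.sum_comm, mul_add (1 + 2 * hop q / (gap q * (n + 1))), Finset.mul_sum]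
  refine add_le_add (Finset.sum_le_sum hbond) ?_
  refine le_mul_of_one_le_left (by positivity) ?_
  have : 0 ≤ 2 * hop q / (gap q * (n + 1)) := by positivity
  linarith

/-- The spectrum above the droplet band: on the orthogonal complement of the `M + 1` localized
states `loc · q ^ spread` the Hamiltonian is at least `2 A(Δ) + gap`, up to a factor
`1 + O(1 / n)`. -/
theorem urnForm_ge {q : ℝ} (hq : 0 ≤ q) (hq1 : q < 1) (M n : ℕ) (g : (ℕ → ℕ) → ℂ)
    (horth : ∀ y ≤ M, ∑ ℓ ∈ urns (M + 1) (n + 1),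
      (q : ℂ) ^ spread (M + 1) y ℓ * (loc M y ℓ * g ℓ) = 0) :
    (2 * field q + gap q) * ∑ ℓ ∈ urns (M + 1) (n + 1), ‖g ℓ‖ ^ 2
      ≤ (1 + 2 * hop q / (gap q * (n + 1))) * urnForm q M n g := by
  have hloc : ∀ y, y ≤ M → (2 * field q + gap q) *
      ∑ ℓ ∈ urns (M + 1) (n + 1), ‖(loc M y ℓ : ℂ) * g ℓ‖ ^ 2
      ≤ urnForm q M n (fun ℓ => loc M y ℓ * g ℓ) := by
    intro y hy
    have hsupp : ∀ ℓ : ℕ → ℕ, ℓ y = 0 → (loc M y ℓ : ℂ) * g ℓ = 0 := by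
      intro ℓ h; simp [loc, h]
    have h1 := gap_urns hq (Nat.lt_succ_of_le hy) n (fun ℓ => loc M y ℓ * g ℓ) hsupp (horth y hy)
    have h2 := sum_urns_succ n (Nat.lt_succ_of_le hy) (fun ℓ => ‖(loc M y ℓ : ℂ) * g ℓ‖ ^ 2)
    have h3 : ∑ ℓ ∈ urns (M + 1) (n + 1), (if ℓ y ≠ 0 then ‖(loc M y ℓ : ℂ) * g ℓ‖ ^ 2 else 0)
        = ∑ ℓ ∈ urns (M + 1) (n + 1), ‖(loc M y ℓ : ℂ) * g ℓ‖ ^ 2 := by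
      refine Finset.sum_congr rfl fun ℓ _ => ?_
      split_ifs with h
      · rfl
      · rw [hsupp ℓ (not_not.1 h)]; simp
    unfold urnForm
    simp only [oneForm_eq q hy, Finset.sum_add_distrib, ← Finset.mul_sum]
    rw [← h2, h3, add_mul, add_comm]
    refine add_le_add_left ?_ _
    rw [gap, div_mul_eq_mul_div, one_div_mul_eq_div]
    exact div_le_div_of_nonneg_right h1 (by positivity)
  have hsum : ∑ y ∈ Finset.range (M + 1), ∑ ℓ ∈ urns (M + 1) (n + 1), ‖(loc M y ℓ : ℂ) * g ℓ‖ ^ 2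
      = ∑ ℓ ∈ urns (M + 1) (n + 1), ‖g ℓ‖ ^ 2 := by
    rw [Finset.sum_comm]
    refine Finset.sum_congr rfl fun ℓ hℓ => ?_
    simp only [norm_mul, mul_pow, Complex.norm_real, Real.norm_eq_abs, sq_abs]
    rw [← Finset.sum_mul, sum_loc_sq hℓ, one_mul]
  rw [← hsum, Finset.mul_sum]
  calc _ ≤ ∑ y ∈ Finset.range (M + 1), urnForm q M n (fun ℓ => loc M y ℓ * g ℓ) :=
        Finset.sum_le_sum fun y hy => hloc y (Nat.lt_succ_iff.1 (Finset.mem_range.1 hy))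
    _ ≤ _ := by
        unfold urnForm
        rw [Finset.sum_comm, Finset.mul_sum]
        exact Finset.sum_le_sum fun η hη => sum_oneForm_loc_le hq hq1 hη _

/-! ### From sets of down spins to occupation numbers -/

/-- The number of up spins among the sites `1, …, x`, if `D` is the set of the down spins. -/
def ups (D : Finset ℕ) (x : ℕ) : ℕ := Nat.count (fun k => k + 1 ∉ D) x

/-- The occupation numbers of the set `D` of down spins: the up spins are the walls between the
urns, and the urn `i` holds the down spins to the left of which there are `i` up spins. -/
def occ (D : Finset ℕ) (i : ℕ) : ℕ := (D.filter fun p => ups D p = i).card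

theorem ups_zero (D : Finset ℕ) : ups D 0 = 0 := Nat.count_zero _

theorem ups_succ (D : Finset ℕ) (x : ℕ) :
    ups D (x + 1) = ups D x + if x + 1 ∉ D then 1 else 0 := Nat.count_succ _ _

theorem ups_succ_of_mem {D : Finset ℕ} {x : ℕ} (h : x + 1 ∈ D) : ups D (x + 1) = ups D x := by
  rw [ups_succ, if_neg (not_not.2 h), add_zero]

theorem ups_succ_of_notMem {D : Finset ℕ} {x : ℕ} (h : x + 1 ∉ D) :
    ups D (x + 1) = ups D x + 1 := by
  rw [ups_succ, if_pos h]

theorem ups_mono (D : Finset ℕ) : Monotone (ups D) := Nat.count_monotone _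

theorem ups_add_card (D : Finset ℕ) (x : ℕ) : ups D x + (D ∩ Finset.Icc 1 x).card = x := by
  induction x with
  | zero => simp [ups_zero]
  | succ x ih =>
    have h : Finset.Icc 1 (x + 1) = insert (x + 1) (Finset.Icc 1 x) := by
      ext y; simp only [Finset.mem_Icc, Finset.mem_insert]; omega
    rw [h]
    by_cases hx : x + 1 ∈ D
    · rw [ups_succ_of_mem hx, Finset.inter_insert_of_mem hx, Finset.card_insert_of_notMem (by simp)]
      omega
    · rw [ups_succ_of_notMem hx, Finset.inter_insert_of_notMem hx]; omega

theorem ups_last {L : ℕ} {D : Finset ℕ} (hD : D ⊆ Finset.Icc 1 L) : ups D L = L - D.card := by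
  have := ups_add_card D L
  rw [Finset.inter_eq_left.2 hD] at this
  omega

theorem occ_ne_zero {D : Finset ℕ} {i : ℕ} : occ D i ≠ 0 ↔ ∃ p ∈ D, ups D p = i := by
  rw [occ, Finset.card_ne_zero, Finset.filter_nonempty_iff]

theorem occ_mem_urns {L : ℕ} {D : Finset ℕ} (hD : D ⊆ Finset.Icc 1 L) :
    occ D ∈ urns (L - D.card + 1) D.card := by
  have h : ∀ p ∈ D, ups D p < L - D.card + 1 := fun p hp => by
    have := ups_mono D (Finset.mem_Icc.1 (hD hp)).2
    rw [ups_last hD] at this; omega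
  rw [mem_urns]
  refine ⟨?_, fun i hi => ?_⟩
  · exact (Finset.card_eq_sum_card_fiberwise fun p hp => by simpa using h p hp).symm
  · obtain ⟨p, hp, rfl⟩ := occ_ne_zero.1 hi
    exact h p hp

theorem ups_congr {D D' : Finset ℕ} {x : ℕ} (h : ∀ y ≤ x, y ∈ D ↔ y ∈ D') {p : ℕ} (hp : p ≤ x) :
    ups D p = ups D' p := by
  induction p with
  | zero => rw [ups_zero, ups_zero]
  | succ p ih =>
    rw [ups_succ, ups_succ, ih (by omega)]
    simp only [h (p + 1) hp]

/-- The set of down spins is determined by the occupation numbers: at the first difference the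
urns that are being filled differ. -/
theorem eq_of_occ_eq {D D' : Finset ℕ} (h0 : 0 ∉ D) (h0' : 0 ∉ D') (h : occ D = occ D') :
    D = D' := by
  have key : ∀ D D' : Finset ℕ, occ D = occ D' → ∀ x, (∀ y ≤ x, y ∈ D ↔ y ∈ D') →
      x + 1 ∈ D → x + 1 ∈ D' := by
    intro D D' h x hx hD
    by_contra hD'
    have hlt : occ D' (ups D x) < occ D (ups D x) := by
      refine Finset.card_lt_card ((Finset.ssubset_iff_of_subset ?_).2
        ⟨x + 1, Finset.mem_filter.2 ⟨hD, ups_succ_of_mem hD⟩, fun h => hD' (Finset.mem_filter.1 h).1⟩)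
      intro p hp
      obtain ⟨hp1, hp2⟩ := Finset.mem_filter.1 hp
      have hpx : p ≤ x := by
        by_contra hlt
        have h1 := ups_mono D' (show x + 1 ≤ p by omega)
        rw [ups_succ_of_notMem hD', hp2, ups_congr hx le_rfl] at h1
        omega
      exact Finset.mem_filter.2 ⟨(hx p hpx).2 hp1, by rw [ups_congr hx hpx, hp2]⟩
    rw [h] at hlt
    exact lt_irrefl _ hlt
  have all : ∀ x, ∀ y ≤ x, y ∈ D ↔ y ∈ D' := by
    intro x
    induction x with
    | zero => intro y hy; rw [Nat.le_zero.1 hy]; exact iff_of_false h0 h0'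
    | succ x ih =>
      intro y hy
      rcases Nat.le_succ_iff.1 hy with h1 | h1
      · exact ih y h1
      · subst h1
        exact ⟨key D D' h x ih, key D' D h.symm x fun y hy => (ih y hy).symm⟩
  ext x; exact all x x le_rfl

/-- Moving the down spin at `x` to `x + 1`. -/
def moveRight (D : Finset ℕ) (x : ℕ) : Finset ℕ := insert (x + 1) (D.erase x)

/-- Moving the down spin at `x + 1` to `x`. -/
def moveLeft (D : Finset ℕ) (x : ℕ) : Finset ℕ := insert x (D.erase (x + 1))

theorem ups_moveRight {D : Finset ℕ} {x : ℕ} (hx0 : x ≠ 0) (hx : x ∈ D) (hx1 : x + 1 ∉ D) {p : ℕ}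
    (hp : p ≠ x) : ups (moveRight D x) p = ups D p := by
  have hlow : ∀ p < x, ups (moveRight D x) p = ups D p := fun p hp =>
    ups_congr (x := p) (fun y hy => by
      simp only [moveRight, Finset.mem_insert, Finset.mem_erase]
      constructor
      · rintro (h | h)
        · omega
        · exact h.2
      · intro h; right; exact ⟨by omega, h⟩) le_rfl
  rcases lt_or_gt_of_ne hp with h | h
  · exact hlow p h
  · induction p, h using Nat.le_induction with
    | base =>
      obtain ⟨z, rfl⟩ := Nat.exists_eq_succ_of_ne_zero hx0
      simp only [Nat.succ_eq_add_one] at *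
      rw [ups_succ_of_mem (by simp [moveRight]), ups_succ_of_notMem (by simp [moveRight]),
        ups_succ_of_notMem hx1, ups_succ_of_mem hx, hlow z (by omega)]
    | succ p hxp ih =>
      rw [ups_succ, ups_succ, ih (by omega)]
      have : p + 1 ∈ moveRight D x ↔ p + 1 ∈ D := by
        simp only [moveRight, Finset.mem_insert, Finset.mem_erase]
        constructor
        · rintro (h | h)
          · omega
          · exact h.2
        · intro h; right; exact ⟨by omega, h⟩
      simp only [this]

theorem occ_moveRight {D : Finset ℕ} {x : ℕ} (hx0 : x ≠ 0) (hx : x ∈ D) (hx1 : x + 1 ∉ D) :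
    occ (moveRight D x) = occ D - unit (ups D x) + unit (ups D x + 1) := by
  have hsum : occ (moveRight D x) + unit (ups D x) = occ D + unit (ups D x + 1) := by
    funext j
    have h1 : occ (moveRight D x) j = ((D.erase x).filter fun p => ups D p = j).card
        + if ups D x + 1 = j then 1 else 0 := by
      have hsub : ∀ p ∈ moveRight D x, p ≠ x := by
        intro p hp
        simp only [moveRight, Finset.mem_insert, Finset.mem_erase] at hp
        rcases hp with h | h
        · omega
        · exact h.1
      rw [occ, Finset.filter_congr fun p hp => by rw [ups_moveRight hx0 hx hx1 (hsub p hp)],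
        moveRight, Finset.filter_insert, ups_succ_of_notMem hx1]
      split_ifs with h
      · rw [Finset.card_insert_of_notMem (by simp [hx1])]
      · rfl
    have h2 : occ D j = ((D.erase x).filter fun p => ups D p = j).card
        + if ups D x = j then 1 else 0 := by
      conv_lhs => rw [occ, ← Finset.insert_erase hx, Finset.filter_insert]
      rw [Finset.insert_erase hx]
      split_ifs with h
      · rw [Finset.card_insert_of_notMem (by simp)]
      · rfl
    simp only [Pi.add_apply, unit, Pi.single_apply, h1, h2, eq_comm (a := j)]
    omega
  have hne : occ D (ups D x) ≠ 0 := occ_ne_zero.2 ⟨x, hx, rfl⟩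
  refine add_right_cancel (b := unit (ups D x)) ?_
  rw [hsum, add_assoc, add_comm (unit (ups D x + 1)), ← add_assoc, sub_unit_add hne]

theorem occ_moveLeft {D : Finset ℕ} {x : ℕ} (hx0 : x ≠ 0) (hx : x ∉ D) (hx1 : x + 1 ∈ D) :
    occ (moveLeft D x) = occ D - unit (ups D x) + unit (ups D x - 1) := by
  have h1 : x ∈ moveLeft D x := by simp [moveLeft]
  have h2 : x + 1 ∉ moveLeft D x := by simp [moveLeft]
  have h3 : moveRight (moveLeft D x) x = D := by
    have : (moveLeft D x).erase x = D.erase (x + 1) := by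
      rw [moveLeft, Finset.erase_insert]; simp [hx]
    rw [moveRight, this, Finset.insert_erase hx1]
  have h4 := occ_moveRight hx0 h1 h2
  have h5 := ups_moveRight hx0 h1 h2 (show x + 1 ≠ x by omega)
  rw [h3] at h4 h5
  rw [ups_succ_of_mem hx1, ups_succ_of_notMem h2] at h5
  have h6 : occ (moveLeft D x) (ups (moveLeft D x) x) ≠ 0 := occ_ne_zero.2 ⟨x, h1, rfl⟩
  rw [h5, Nat.add_sub_cancel, h4, add_unit_sub, sub_unit_add h6]

theorem exists_right_end {L : ℕ} {D : Finset ℕ} (hD : D ⊆ Finset.Icc 1 L) {i : ℕ}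
    (hi : i < L - D.card) (h : occ D i ≠ 0) : ∃ x ∈ Finset.Ico 1 L, x ∈ D ∧ x + 1 ∉ D ∧ ups D x = i := by
  obtain ⟨p, hp, hpi⟩ := occ_ne_zero.1 h
  obtain ⟨x, hx, hmax⟩ := (D.filter fun p => ups D p = i).exists_max_image id
    ⟨p, Finset.mem_filter.2 ⟨hp, hpi⟩⟩
  obtain ⟨hxD, hxi⟩ := Finset.mem_filter.1 hx
  have hxL := Finset.mem_Icc.1 (hD hxD)
  have hne : x ≠ L := by
    rintro rfl
    rw [ups_last hD] at hxi; omega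
  refine ⟨x, Finset.mem_Ico.2 ⟨hxL.1, by omega⟩, hxD, fun h1 => ?_, hxi⟩
  have := hmax (x + 1) (Finset.mem_filter.2 ⟨h1, by rw [ups_succ_of_mem h1, hxi]⟩)
  simp only [id] at this; omega

theorem exists_left_end {L : ℕ} {D : Finset ℕ} (hD : D ⊆ Finset.Icc 1 L) {i : ℕ}
    (hi : i ≠ 0) (h : occ D i ≠ 0) : ∃ x ∈ Finset.Ico 1 L, x ∉ D ∧ x + 1 ∈ D ∧ ups D x = i := by
  obtain ⟨p, hp, hpi⟩ := occ_ne_zero.1 h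
  obtain ⟨x, hx, hmin⟩ := (D.filter fun p => ups D p = i).exists_min_image id
    ⟨p, Finset.mem_filter.2 ⟨hp, hpi⟩⟩
  obtain ⟨hxD, hxi⟩ := Finset.mem_filter.1 hx
  have hxL := Finset.mem_Icc.1 (hD hxD)
  obtain ⟨z, rfl⟩ := Nat.exists_eq_succ_of_ne_zero (show x ≠ 0 by omega)
  simp only [Nat.succ_eq_add_one] at *
  rw [ups_succ_of_mem hxD] at hxi
  have hz : z ≠ 0 := by
    rintro rfl
    rw [ups_zero] at hxi; exact hi hxi.symm
  refine ⟨z, Finset.mem_Ico.2 ⟨by omega, by omega⟩, fun h1 => ?_, hxD, hxi⟩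
  have := hmin z (Finset.mem_filter.2 ⟨h1, hxi⟩)
  simp only [id] at this; omega

theorem moveRight_subset {L : ℕ} {D : Finset ℕ} (hD : D ⊆ Finset.Icc 1 L) {x : ℕ}
    (hx : x ∈ Finset.Ico 1 L) : moveRight D x ⊆ Finset.Icc 1 L := by
  have := Finset.mem_Ico.1 hx
  refine Finset.insert_subset (Finset.mem_Icc.2 (by omega)) ((Finset.erase_subset _ _).trans hD)

theorem card_moveRight {D : Finset ℕ} {x : ℕ} (hx : x ∈ D) (hx1 : x + 1 ∉ D) :
    (moveRight D x).card = D.card := by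
  rw [moveRight, Finset.card_insert_of_notMem (by simp [hx1]), Finset.card_erase_add_one hx]

/-- Every vector of occupation numbers belongs to a set of down spins: move the particles one by
one from the urn `0` to their places. -/
theorem exists_occ_eq {L n : ℕ} (hn : n ≤ L) {ℓ : ℕ → ℕ} (hℓ : ℓ ∈ urns (L - n + 1) n) :
    ∃ D ⊆ Finset.Icc 1 L, D.card = n ∧ occ D = ℓ := by
  obtain ⟨N, hN⟩ : ∃ N, spread (L - n + 1) 0 ℓ = N := ⟨_, rfl⟩
  induction N using Nat.strong_induction_on generalizing ℓ with
  | _ N ih =>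
    by_cases h : ∃ i, i ≠ 0 ∧ ℓ i ≠ 0
    · obtain ⟨i, hi, hℓi⟩ := h
      obtain ⟨j, rfl⟩ := Nat.exists_eq_succ_of_ne_zero hi
      simp only [Nat.succ_eq_add_one] at *
      have hlt := (mem_urns.1 hℓ).2 _ hℓi
      have hn0 : n ≠ 0 := by
        rintro rfl
        have := (mem_urns.1 hℓ).1
        exact hℓi (Finset.sum_eq_zero_iff.1 this _ (Finset.mem_range.2 hlt))
      obtain ⟨n, rfl⟩ := Nat.exists_eq_succ_of_ne_zero hn0
      simp only [Nat.succ_eq_add_one] at *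
      set η := ℓ - unit (j + 1) with hη
      have hℓη : η + unit (j + 1) = ℓ := sub_unit_add hℓi
      have hηm := (add_unit_mem hlt).1 (hℓη ▸ hℓ)
      have hjlt : j < L - (n + 1) + 1 := by omega
      have hS1 : spread (L - (n + 1) + 1) 0 ℓ = spread (L - (n + 1) + 1) 0 η + (j + 1) := by
        rw [← hℓη, spread_add, spread_unit hlt]; simp [urnDist]
      obtain ⟨D, hD, hc, hocc⟩ := ih (spread (L - (n + 1) + 1) 0 (η + unit j)) (by
        rw [spread_add, spread_unit hjlt, ← hN, hS1]; simp [urnDist]) ((add_unit_mem hjlt).2 hηm) rfl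
      obtain ⟨x, hx, hx1, hx2, hx3⟩ := exists_right_end hD (i := j) (by omega)
        (by rw [hocc]; simp [unit])
      refine ⟨moveRight D x, moveRight_subset hD hx, by rw [card_moveRight hx1 hx2, hc], ?_⟩
      rw [occ_moveRight (by have := (Finset.mem_Ico.1 hx).1; omega) hx1 hx2, hx3, hocc, add_unit_sub,
        hℓη]
    · push Not at h
      refine ⟨Finset.Icc 1 n, Finset.Icc_subset_Icc_right hn, by simp, ?_⟩
      have h1 : ∀ x ≤ n, ups (Finset.Icc 1 n) x = 0 := by
        intro x hx
        have h2 := ups_add_card (Finset.Icc 1 n) x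
        rw [Finset.inter_eq_right.2 (Finset.Icc_subset_Icc_right hx)] at h2
        simp at h2; exact h2
      have hm := (mem_urns.1 hℓ).1
      rw [Finset.sum_range_succ', Finset.sum_eq_zero (fun i _ => h _ (by omega)), zero_add] at hm
      funext i
      by_cases hi : i = 0
      · subst hi
        rw [hm, occ, Finset.filter_true_of_mem fun p hp => h1 p (Finset.mem_Icc.1 hp).2]
        simp
      · rw [h i hi]
        by_contra h2
        obtain ⟨p, hp, hpi⟩ := occ_ne_zero.1 h2
        rw [h1 p (Finset.mem_Icc.1 hp).2] at hpi
        exact hi hpi.symm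

theorem sum_right_ends {α : Type*} [AddCommMonoid α] {L : ℕ} {D : Finset ℕ}
    (hD : D ⊆ Finset.Icc 1 L) (F : ℕ → α) :
    ∑ x ∈ Finset.Ico 1 L, (if x ∈ D ∧ x + 1 ∉ D then F (ups D x) else 0)
      = ∑ i ∈ Finset.range (L - D.card), if occ D i ≠ 0 then F i else 0 := by
  rw [← Finset.sum_filter, ← Finset.sum_filter]
  refine Finset.sum_bij (fun x _ => ups D x) ?_ ?_ ?_ ?_
  · intro x hx
    obtain ⟨h1, h2, h3⟩ := Finset.mem_filter.1 hx
    refine Finset.mem_filter.2 ⟨?_, occ_ne_zero.2 ⟨x, h2, rfl⟩⟩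
    have h4 := ups_mono D (show x + 1 ≤ L by have := (Finset.mem_Ico.1 h1).2; omega)
    rw [ups_succ_of_notMem h3, ups_last hD] at h4
    exact Finset.mem_range.2 h4
  · have key : ∀ x z, x < z → x + 1 ∉ D → ups D x ≠ ups D z := by
      intro x z hxz hx h
      have h4 := ups_mono D (show x + 1 ≤ z by omega)
      rw [ups_succ_of_notMem hx] at h4; omega
    intro x hx z hz h
    rcases lt_trichotomy x z with h1 | h1 | h1
    · exact absurd h (key x z h1 (Finset.mem_filter.1 hx).2.2)
    · exact h1
    · exact absurd h.symm (key z x h1 (Finset.mem_filter.1 hz).2.2)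
  · intro i hi
    obtain ⟨h1, h2⟩ := Finset.mem_filter.1 hi
    obtain ⟨x, hx, hx1, hx2, hx3⟩ := exists_right_end hD (Finset.mem_range.1 h1) h2
    exact ⟨x, Finset.mem_filter.2 ⟨hx, hx1, hx2⟩, hx3⟩
  · intro _ _; rfl

theorem sum_left_ends {α : Type*} [AddCommMonoid α] {L : ℕ} {D : Finset ℕ}
    (hD : D ⊆ Finset.Icc 1 L) (F : ℕ → α) :
    ∑ x ∈ Finset.Ico 1 L, (if x ∉ D ∧ x + 1 ∈ D then F (ups D x) else 0)
      = ∑ i ∈ Finset.range (L - D.card), if occ D (i + 1) ≠ 0 then F (i + 1) else 0 := by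
  rw [Finset.sum_bij (i := fun i _ => i + 1) (s := Finset.range (L - D.card))
    (t := Finset.Ico 1 (L - D.card + 1)) (g := fun i => if occ D i ≠ 0 then F i else 0)
    (fun i hi => Finset.mem_Ico.2 ⟨by omega, by have := Finset.mem_range.1 hi; omega⟩)
    (fun _ _ _ _ h => by omega)
    (fun i hi => ⟨i - 1, Finset.mem_range.2 (by have := Finset.mem_Ico.1 hi; omega),
      by have := Finset.mem_Ico.1 hi; omega⟩) (fun _ _ => rfl)]
  rw [← Finset.sum_filter, ← Finset.sum_filter]
  have hpred : ∀ x ∈ Finset.Ico 1 L, x ∉ D → ∃ z, x = z + 1 ∧ ups D x = ups D z + 1 := by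
    intro x hx h
    obtain ⟨z, rfl⟩ := Nat.exists_eq_succ_of_ne_zero
      (show x ≠ 0 by have := (Finset.mem_Ico.1 hx).1; omega)
    exact ⟨z, rfl, ups_succ_of_notMem h⟩
  refine Finset.sum_bij (fun x _ => ups D x) ?_ ?_ ?_ ?_
  · intro x hx
    obtain ⟨h1, h2, h3⟩ := Finset.mem_filter.1 hx
    refine Finset.mem_filter.2 ⟨?_, occ_ne_zero.2 ⟨x + 1, h3, ups_succ_of_mem h3⟩⟩
    have h4 := ups_mono D (Finset.mem_Ico.1 h1).2.le
    obtain ⟨z, -, hz⟩ := hpred x h1 h2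
    rw [ups_last hD] at h4
    exact Finset.mem_Ico.2 ⟨by omega, by omega⟩
  · have key : ∀ x ∈ Finset.Ico 1 L, ∀ z ∈ Finset.Ico 1 L, x < z → z ∉ D → ups D x ≠ ups D z := by
      intro x _ z hz hxz hzD h
      obtain ⟨w, hw, hw'⟩ := hpred z hz hzD
      have h4 := ups_mono D (show x ≤ w by omega)
      omega
    intro x hx z hz h
    rcases lt_trichotomy x z with h1 | h1 | h1
    · exact absurd h (key x (Finset.mem_filter.1 hx).1 z (Finset.mem_filter.1 hz).1 h1
        (Finset.mem_filter.1 hz).2.1)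
    · exact h1
    · exact absurd h.symm (key z (Finset.mem_filter.1 hz).1 x (Finset.mem_filter.1 hx).1 h1
        (Finset.mem_filter.1 hx).2.1)
  · intro i hi
    obtain ⟨h1, h2⟩ := Finset.mem_filter.1 hi
    obtain ⟨x, hx, hx1, hx2, hx3⟩ := exists_left_end hD
      (by have := (Finset.mem_Ico.1 h1).1; omega) h2
    exact ⟨x, Finset.mem_filter.2 ⟨hx, hx1, hx2⟩, hx3⟩
  · intro _ _; rfl

theorem occ_zero_ne_zero {L : ℕ} {D : Finset ℕ} (hD : D ⊆ Finset.Icc 1 L) :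
    occ D 0 ≠ 0 ↔ 1 ∈ D := by
  rw [occ_ne_zero]
  constructor
  · rintro ⟨p, hp, h⟩
    by_contra h1
    have h2 := ups_mono D (Finset.mem_Icc.1 (hD hp)).1
    rw [h, show (1 : ℕ) = 0 + 1 from rfl, ups_succ_of_notMem h1] at h2
    omega
  · intro h
    exact ⟨1, h, by rw [show (1 : ℕ) = 0 + 1 from rfl, ups_succ_of_mem h, ups_zero]⟩

theorem occ_last_ne_zero {L : ℕ} {D : Finset ℕ} (hD : D ⊆ Finset.Icc 1 L) :
    occ D (L - D.card) ≠ 0 ↔ L ∈ D := by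
  rw [occ_ne_zero, ← ups_last hD]
  constructor
  · rintro ⟨p, hp, h⟩
    by_contra h1
    have hpL := (Finset.mem_Icc.1 (hD hp))
    obtain ⟨z, rfl⟩ := Nat.exists_eq_succ_of_ne_zero (show L ≠ 0 by omega)
    have hz : p ≤ z := by
      rcases Nat.le_succ_iff.1 hpL.2 with h2 | h2
      · exact h2
      · rw [h2] at hp; exact absurd hp h1
    have h2 := ups_mono D hz
    rw [h, Nat.succ_eq_add_one, ups_succ_of_notMem h1] at h2
    omega
  · intro h; exact ⟨L, h, rfl⟩

/-- The action of the Hamiltonian on functions of the occupation numbers. -/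
theorem urnOp_occ {q : ℝ} {L : ℕ} {D : Finset ℕ} (hD : D ⊆ Finset.Icc 1 L) (g : (ℕ → ℕ) → ℂ) :
    urnOp q (L - D.card) g (occ D) =
      ∑ x ∈ Finset.Ico 1 L,
        ((if x ∈ D ∧ x + 1 ∉ D then g (occ D) / 2 - hop q * g (occ (moveRight D x)) else 0)
        + (if x ∉ D ∧ x + 1 ∈ D then g (occ D) / 2 - hop q * g (occ (moveLeft D x)) else 0))
      + ((if 1 ∈ D then field q * g (occ D) else 0) + if L ∈ D then field q * g (occ D) else 0) := by
  set M := L - D.card with hM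
  set ℓ := occ D with hℓ
  have e1 : ∀ i, (if ℓ i ≠ 0 then oneOp q M (fun j => g (ℓ - unit i + unit j)) i else 0)
      = (if ℓ i ≠ 0 then (if i = 0 then field q * g ℓ
          else g ℓ / 2 - hop q * g (ℓ - unit i + unit (i - 1))) else 0)
        + (if ℓ i ≠ 0 then (if i = M then field q * g ℓ
          else g ℓ / 2 - hop q * g (ℓ - unit i + unit (i + 1))) else 0) := by
    intro i
    by_cases h : ℓ i ≠ 0
    · rw [if_pos h, if_pos h, if_pos h, oneOp, sub_unit_add h]
    · rw [if_neg h, if_neg h, if_neg h, add_zero]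
  have e2 : ∑ i ∈ Finset.range (M + 1), (if ℓ i ≠ 0 then (if i = 0 then field q * g ℓ
          else g ℓ / 2 - hop q * g (ℓ - unit i + unit (i - 1))) else 0)
      = ∑ x ∈ Finset.Ico 1 L, (if x ∉ D ∧ x + 1 ∈ D then
          g ℓ / 2 - hop q * g (occ (moveLeft D x)) else 0)
        + if 1 ∈ D then field q * g ℓ else 0 := by
    rw [Finset.sum_range_succ', if_pos rfl]
    simp only [hℓ, occ_zero_ne_zero hD]
    congr 1
    have := sum_left_ends hD (fun i => g ℓ / 2 - hop q * g (ℓ - unit i + unit (i - 1)))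
    rw [← hM, ← hℓ] at this
    simp only [← hℓ, Nat.add_eq_zero_iff, one_ne_zero, and_false, if_false]
    rw [← this]
    refine Finset.sum_congr rfl fun x hx => ?_
    split_ifs with h
    · rw [occ_moveLeft (by have := (Finset.mem_Ico.1 hx).1; omega) h.1 h.2]
    · rfl
  have e3 : ∑ i ∈ Finset.range (M + 1), (if ℓ i ≠ 0 then (if i = M then field q * g ℓ
          else g ℓ / 2 - hop q * g (ℓ - unit i + unit (i + 1))) else 0)
      = ∑ x ∈ Finset.Ico 1 L, (if x ∈ D ∧ x + 1 ∉ D then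
          g ℓ / 2 - hop q * g (occ (moveRight D x)) else 0)
        + if L ∈ D then field q * g ℓ else 0 := by
    rw [Finset.sum_range_succ, if_pos rfl]
    simp only [hℓ, hM, occ_last_ne_zero hD]
    congr 1
    have := sum_right_ends hD (fun i => g ℓ / 2 - hop q * g (ℓ - unit i + unit (i + 1)))
    rw [← hℓ] at this
    simp only [← hℓ]
    rw [Finset.sum_congr rfl fun i hi => by rw [if_neg (Finset.mem_range.1 hi).ne], ← this]
    refine Finset.sum_congr rfl fun x hx => ?_
    split_ifs with h
    · rw [occ_moveRight (by have := (Finset.mem_Ico.1 hx).1; omega) h.1 h.2]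
    · rfl
  rw [urnOp, Finset.sum_congr rfl fun i _ => e1 i, Finset.sum_add_distrib, e2, e3,
    Finset.sum_add_distrib]
  ring

/-! ### The Hamiltonian on states given by occupation numbers -/

/-- The set of the down spins of a configuration. -/
def downSet {L : ℕ} (σ : Config 1 L) : Finset ℕ :=
  (Finset.univ.filter fun y => σ y = 1).map (Function.Embedding.subtype _)

theorem mem_downSet {L : ℕ} {σ : Config 1 L} {x : ℕ} (h : x ∈ Finset.Icc 1 L) :
    x ∈ downSet σ ↔ σ ⟨x, h⟩ = 1 := by
  simp only [downSet, Finset.mem_map, Finset.mem_filter, Finset.mem_univ, true_and,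
    Function.Embedding.subtype_apply, Subtype.exists, exists_and_right, exists_eq_right]
  exact ⟨fun ⟨_, h⟩ => h, fun h' => ⟨h, h'⟩⟩

theorem downSet_subset {L : ℕ} (σ : Config 1 L) : downSet σ ⊆ Finset.Icc 1 L := by
  intro x hx
  obtain ⟨y, -, rfl⟩ := Finset.mem_map.1 hx
  exact y.2

theorem card_downSet {L : ℕ} (σ : Config 1 L) : (downSet σ).card = downCount σ :=
  Finset.card_map _

theorem fin_two_ne_one {s : Fin 2} : s ≠ 1 ↔ s = 0 := by omega

theorem downSet_injective {L : ℕ} : Function.Injective (downSet (L := L)) := by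
  intro σ τ h
  funext y
  have h1 := mem_downSet (σ := σ) y.2
  have h2 := mem_downSet (σ := τ) y.2
  rw [h, h2] at h1
  by_cases h3 : σ y = 1
  · rw [h3]; exact (h1.2 h3).symm
  · have h4 : τ y ≠ 1 := fun h => h3 (h1.1 h)
    rw [fin_two_ne_one.1 h3, fin_two_ne_one.1 h4]

theorem exists_downSet_eq {L : ℕ} {D : Finset ℕ} (hD : D ⊆ Finset.Icc 1 L) :
    ∃ σ : Config 1 L, downSet σ = D := by
  refine ⟨fun y => if (y : ℕ) ∈ D then 1 else 0, ?_⟩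
  ext x
  by_cases hx : x ∈ Finset.Icc 1 L
  · rw [mem_downSet hx]; simp
  · exact iff_of_false (fun h => hx (downSet_subset _ h)) (fun h => hx (hD h))

theorem zero_notMem_downSet {L : ℕ} (σ : Config 1 L) : 0 ∉ downSet σ := fun h => by
  have := Finset.mem_Icc.1 (downSet_subset σ h); omega

/-- The configurations with `n` down spins correspond to the vectors of occupation numbers. -/
theorem sum_config {α : Type*} [AddCommMonoid α] {L n : ℕ} (hn : n ≤ L) (F : (ℕ → ℕ) → α) :
    ∑ σ : Config 1 L, (if downCount σ = n then F (occ (downSet σ)) else 0)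
      = ∑ ℓ ∈ urns (L - n + 1) n, F ℓ := by
  rw [← Finset.sum_filter]
  refine Finset.sum_bij (fun σ _ => occ (downSet σ)) ?_ ?_ ?_ ?_
  · intro σ hσ
    have := occ_mem_urns (downSet_subset σ)
    rwa [card_downSet, (Finset.mem_filter.1 hσ).2] at this
  · intro σ _ τ _ h
    exact downSet_injective (eq_of_occ_eq (zero_notMem_downSet σ) (zero_notMem_downSet τ) h)
  · intro ℓ hℓ
    obtain ⟨D, hD, hc, hocc⟩ := exists_occ_eq hn hℓ
    obtain ⟨σ, rfl⟩ := exists_downSet_eq hD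
    exact ⟨σ, Finset.mem_filter.2 ⟨Finset.mem_univ _, by rw [← card_downSet, hc]⟩, hocc⟩
  · intro _ _; rfl

/-- The state in the sector with `n` down spins whose coefficients are the function `g` of the
occupation numbers. -/
def urnState (L n : ℕ) (g : (ℕ → ℕ) → ℂ) : Space 1 L :=
  WithLp.toLp 2 fun σ => if downCount σ = n then g (occ (downSet σ)) else 0

theorem urnState_apply (L n : ℕ) (g : (ℕ → ℕ) → ℂ) (σ : Config 1 L) :
    urnState L n g σ = if downCount σ = n then g (occ (downSet σ)) else 0 := rfl

theorem urnState_mem_sector (L n : ℕ) (g : (ℕ → ℕ) → ℂ) : urnState L n g ∈ sector L n :=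
  fun _ h => if_neg h

theorem exists_urnState_eq {L n : ℕ} {ψ : Space 1 L} (hψ : ψ ∈ sector L n) :
    ∃ g, urnState L n g = ψ := by
  have hinj : Function.Injective fun σ : Config 1 L => occ (downSet σ) := fun σ τ h =>
    downSet_injective (eq_of_occ_eq (zero_notMem_downSet σ) (zero_notMem_downSet τ) h)
  refine ⟨Function.extend (fun σ : Config 1 L => occ (downSet σ)) (fun σ => ψ σ) 0, ?_⟩
  ext σ
  rw [urnState_apply, hinj.extend_apply (fun σ => ψ σ) 0 σ]
  split_ifs with h
  · rfl
  · exact (hψ σ h).symm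

theorem inner_urnState {L n : ℕ} (hn : n ≤ L) (f g : (ℕ → ℕ) → ℂ) :
    inner ℂ (urnState L n f) (urnState L n g)
      = ∑ ℓ ∈ urns (L - n + 1) n, (starRingEnd ℂ) (f ℓ) * g ℓ := by
  rw [PiLp.inner_apply, ← sum_config hn]
  refine Finset.sum_congr rfl fun σ _ => ?_
  rw [urnState_apply, urnState_apply]
  split_ifs
  · rw [RCLike.inner_apply']
  · simp

theorem norm_urnState_sq {L n : ℕ} (hn : n ≤ L) (g : (ℕ → ℕ) → ℂ) :
    ‖urnState L n g‖ ^ 2 = ∑ ℓ ∈ urns (L - n + 1) n, ‖g ℓ‖ ^ 2 := by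
  rw [EuclideanSpace.norm_sq_eq, ← sum_config hn]
  refine Finset.sum_congr rfl fun σ _ => ?_
  rw [urnState_apply]
  split_ifs <;> simp

theorem onSite_mulVec {L x : ℕ} (h : x ∈ Finset.Icc 1 L) (S : Matrix (Fin 2) (Fin 2) ℂ)
    (φ : Config 1 L → ℂ) (σ : Config 1 L) :
    (onSite 1 L x S *ᵥ φ) σ = ∑ s, S (σ ⟨x, h⟩) s * φ (Function.update σ ⟨x, h⟩ s) := by
  have h1 : ∀ τ : Config 1 L, onSite 1 L x S σ τ * φ τ
      = ∑ s, if τ = Function.update σ ⟨x, h⟩ s then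
          S (σ ⟨x, h⟩) s * φ (Function.update σ ⟨x, h⟩ s) else 0 := by
    intro τ
    rw [onSite, dif_pos h]
    by_cases h2 : ∀ y, y ≠ (⟨x, h⟩ : Site 1 L) → σ y = τ y
    · have h3 : Function.update σ ⟨x, h⟩ (τ ⟨x, h⟩) = τ := by
        funext y
        by_cases hy : y = ⟨x, h⟩
        · subst hy; simp
        · simp [hy, h2 y hy]
      rw [if_pos h2, Finset.sum_eq_single (τ ⟨x, h⟩)]
      · rw [h3, if_pos rfl]
      · intro s _ hs
        rw [if_neg]
        intro h4
        apply hs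
        rw [h4]; simp
      · intro h; exact absurd (Finset.mem_univ _) h
    · rw [if_neg h2, zero_mul, Finset.sum_eq_zero]
      intro s _
      rw [if_neg]
      rintro rfl
      exact h2 fun y hy => by simp [hy]
  rw [Matrix.mulVec, dotProduct, Finset.sum_congr rfl fun τ _ => h1 τ, Finset.sum_comm]
  simp

theorem onSite_spin3_mulVec {L x : ℕ} (h : x ∈ Finset.Icc 1 L) (φ : Config 1 L → ℂ)
    (σ : Config 1 L) :
    (onSite 1 L x spin3 *ᵥ φ) σ = (1 / 2 - if x ∈ downSet σ then 1 else 0) * φ σ := by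
  rw [onSite_mulVec h, Fin.sum_univ_two]
  simp only [mem_downSet h]
  rcases Fin.exists_fin_two.1 ⟨σ ⟨x, h⟩, rfl⟩ with h0 | h0
  · have : Function.update σ ⟨x, h⟩ 0 = σ := by rw [← h0]; simp
    simp [h0, spin3, this]
  · have : Function.update σ ⟨x, h⟩ 1 = σ := by rw [← h0]; simp
    simp [h0, spin3, this]
    ring

/-- The configuration with the spins at `x` and `y` exchanged. -/
def exchange {L : ℕ} (σ : Config 1 L) (x y : Site 1 L) : Config 1 L :=
  Function.update (Function.update σ x (σ y)) y (σ x)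

theorem onSite_hop_mulVec {L x y : ℕ} (hx : x ∈ Finset.Icc 1 L) (hy : y ∈ Finset.Icc 1 L)
    (hxy : x ≠ y) (φ : Config 1 L → ℂ) (σ : Config 1 L) :
    ((onSite 1 L x spin1 * onSite 1 L y spin1 + onSite 1 L x spin2 * onSite 1 L y spin2) *ᵥ φ) σ
      = if σ ⟨x, hx⟩ = σ ⟨y, hy⟩ then 0 else φ (exchange σ ⟨x, hx⟩ ⟨y, hy⟩) / 2 := by
  have hne : (⟨y, hy⟩ : Site 1 L) ≠ ⟨x, hx⟩ := fun h => hxy (congrArg Subtype.val h).symm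
  rw [Matrix.add_mulVec, ← Matrix.mulVec_mulVec, ← Matrix.mulVec_mulVec, Pi.add_apply,
    onSite_mulVec hx, onSite_mulVec hx, Fin.sum_univ_two, Fin.sum_univ_two]
  simp only [onSite_mulVec hy, Fin.sum_univ_two, Function.update_of_ne hne, exchange]
  rcases Fin.exists_fin_two.1 ⟨σ ⟨x, hx⟩, rfl⟩ with h0 | h0 <;>
  rcases Fin.exists_fin_two.1 ⟨σ ⟨y, hy⟩, rfl⟩ with h1 | h1 <;>
  simp [h0, h1, spin1, spin2] <;> ring_nf <;> simp <;> ring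

theorem downSet_exchange_right {L x : ℕ} (hx : x ∈ Finset.Icc 1 L) (hy : x + 1 ∈ Finset.Icc 1 L)
    {σ : Config 1 L} (h1 : x ∈ downSet σ) (h2 : x + 1 ∉ downSet σ) :
    downSet (exchange σ ⟨x, hx⟩ ⟨x + 1, hy⟩) = moveRight (downSet σ) x := by
  ext z
  by_cases hz : z ∈ Finset.Icc 1 L
  · rw [mem_downSet hz, moveRight, Finset.mem_insert, Finset.mem_erase, mem_downSet hz, exchange]
    rw [mem_downSet hx] at h1
    rw [mem_downSet hy] at h2
    by_cases e1 : z = x + 1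
    · subst e1; simp [h1]
    · have e1' : (⟨z, hz⟩ : Site 1 L) ≠ ⟨x + 1, hy⟩ := fun h => e1 (congrArg Subtype.val h)
      rw [Function.update_of_ne e1']
      by_cases e2 : z = x
      · subst e2; simp [h2]
      · have e2' : (⟨z, hz⟩ : Site 1 L) ≠ ⟨x, hx⟩ := fun h => e2 (congrArg Subtype.val h)
        rw [Function.update_of_ne e2']; simp [e1, e2]
  · refine iff_of_false (fun h => hz (downSet_subset _ h)) (fun h => hz ?_)
    rw [moveRight, Finset.mem_insert, Finset.mem_erase] at h
    rcases h with h | h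
    · rw [h]; exact hy
    · exact downSet_subset _ h.2

theorem downSet_exchange_left {L x : ℕ} (hx : x ∈ Finset.Icc 1 L) (hy : x + 1 ∈ Finset.Icc 1 L)
    {σ : Config 1 L} (h1 : x ∉ downSet σ) (h2 : x + 1 ∈ downSet σ) :
    downSet (exchange σ ⟨x, hx⟩ ⟨x + 1, hy⟩) = moveLeft (downSet σ) x := by
  ext z
  by_cases hz : z ∈ Finset.Icc 1 L
  · rw [mem_downSet hz, moveLeft, Finset.mem_insert, Finset.mem_erase, mem_downSet hz, exchange]
    rw [mem_downSet hx] at h1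
    rw [mem_downSet hy] at h2
    by_cases e1 : z = x + 1
    · subst e1; simp [h1]
    · have e1' : (⟨z, hz⟩ : Site 1 L) ≠ ⟨x + 1, hy⟩ := fun h => e1 (congrArg Subtype.val h)
      rw [Function.update_of_ne e1']
      by_cases e2 : z = x
      · subst e2; simp [h2]
      · have e2' : (⟨z, hz⟩ : Site 1 L) ≠ ⟨x, hx⟩ := fun h => e2 (congrArg Subtype.val h)
        rw [Function.update_of_ne e2']; simp [e1, e2]
  · refine iff_of_false (fun h => hz (downSet_subset _ h)) (fun h => hz ?_)
    rw [moveLeft, Finset.mem_insert, Finset.mem_erase] at h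
    rcases h with h | h
    · rw [h]; exact hx
    · exact downSet_subset _ h.2

theorem card_moveLeft {D : Finset ℕ} {x : ℕ} (hx : x ∉ D) (hx1 : x + 1 ∈ D) :
    (moveLeft D x).card = D.card := by
  rw [moveLeft, Finset.card_insert_of_notMem (by simp [hx]), Finset.card_erase_add_one hx1]

theorem bond_mulVec_urnState {Δ q : ℝ} (hop_eq : hop q = 1 / (2 * Δ)) {L n x : ℕ}
    (hx : x ∈ Finset.Ico 1 L) (g : (ℕ → ℕ) → ℂ) {σ : Config 1 L} (hσ : downCount σ = n) :
    (((Δ : ℂ)⁻¹ • (onSite 1 L x spin1 * onSite 1 L (x + 1) spin1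
          + onSite 1 L x spin2 * onSite 1 L (x + 1) spin2)
        + (onSite 1 L x spin3 * onSite 1 L (x + 1) spin3 - (1 / 4 : ℂ) • 1)) *ᵥ
      (urnState L n g).ofLp) σ
    = -((if x ∈ downSet σ ∧ x + 1 ∉ downSet σ then
          g (occ (downSet σ)) / 2 - hop q * g (occ (moveRight (downSet σ) x)) else 0)
        + (if x ∉ downSet σ ∧ x + 1 ∈ downSet σ then
          g (occ (downSet σ)) / 2 - hop q * g (occ (moveLeft (downSet σ) x)) else 0)) := by
  have hx1 := Finset.mem_Ico.1 hx
  have hX : x ∈ Finset.Icc 1 L := Finset.mem_Icc.2 (by omega)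
  have hY : x + 1 ∈ Finset.Icc 1 L := Finset.mem_Icc.2 (by omega)
  have hne : x ≠ x + 1 := by omega
  have hhop : (hop q : ℂ) = (Δ : ℂ)⁻¹ / 2 := by
    rw [hop_eq]; push_cast; rw [one_div, mul_inv]; ring
  rw [Matrix.add_mulVec, Matrix.smul_mulVec, Matrix.sub_mulVec, Matrix.smul_mulVec,
    Matrix.one_mulVec, ← Matrix.mulVec_mulVec, Pi.add_apply, Pi.smul_apply, Pi.sub_apply,
    Pi.smul_apply, onSite_hop_mulVec hX hY hne, onSite_spin3_mulVec hX, onSite_spin3_mulVec hY]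
  have hval : (urnState L n g) σ = g (occ (downSet σ)) := by rw [urnState_apply, if_pos hσ]
  rw [hval, hhop]
  have m1 := mem_downSet (σ := σ) hX
  have m2 := mem_downSet (σ := σ) hY
  by_cases h1 : x ∈ downSet σ <;> by_cases h2 : x + 1 ∈ downSet σ
  · have : σ ⟨x, hX⟩ = σ ⟨x + 1, hY⟩ := by rw [m1.1 h1, m2.1 h2]
    simp [h1, h2, this]; ring
  · have : σ ⟨x, hX⟩ ≠ σ ⟨x + 1, hY⟩ := by
      rw [m1.1 h1]; exact fun h => h2 (m2.2 h.symm)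
    have h3 := downSet_exchange_right hX hY h1 h2
    rw [if_neg this, urnState_apply, if_pos (by rw [← card_downSet, h3, card_moveRight h1 h2, card_downSet, hσ]),
      h3]
    simp [h1, h2]; ring
  · have : σ ⟨x, hX⟩ ≠ σ ⟨x + 1, hY⟩ := by
      rw [m2.1 h2]; exact fun h => h1 (m1.2 h)
    have h3 := downSet_exchange_left hX hY h1 h2
    rw [if_neg this, urnState_apply, if_pos (by rw [← card_downSet, h3, card_moveLeft h1 h2, card_downSet, hσ]),
      h3]
    simp [h1, h2]; ring
  · have : σ ⟨x, hX⟩ = σ ⟨x + 1, hY⟩ := by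
      rw [fin_two_ne_one.1 (fun h => h1 (m1.2 h)), fin_two_ne_one.1 (fun h => h2 (m2.2 h))]
    simp [h1, h2, this]; ring

theorem bond_mulVec_urnState_of_ne {Δ : ℝ} {L n x : ℕ}
    (hx : x ∈ Finset.Ico 1 L) (g : (ℕ → ℕ) → ℂ) {σ : Config 1 L} (hσ : downCount σ ≠ n) :
    (((Δ : ℂ)⁻¹ • (onSite 1 L x spin1 * onSite 1 L (x + 1) spin1
          + onSite 1 L x spin2 * onSite 1 L (x + 1) spin2)
        + (onSite 1 L x spin3 * onSite 1 L (x + 1) spin3 - (1 / 4 : ℂ) • 1)) *ᵥ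
      (urnState L n g).ofLp) σ = 0 := by
  have hx1 := Finset.mem_Ico.1 hx
  have hX : x ∈ Finset.Icc 1 L := Finset.mem_Icc.2 (by omega)
  have hY : x + 1 ∈ Finset.Icc 1 L := Finset.mem_Icc.2 (by omega)
  have hne : x ≠ x + 1 := by omega
  rw [Matrix.add_mulVec, Matrix.smul_mulVec, Matrix.sub_mulVec, Matrix.smul_mulVec,
    Matrix.one_mulVec, ← Matrix.mulVec_mulVec, Pi.add_apply, Pi.smul_apply, Pi.sub_apply,
    Pi.smul_apply, onSite_hop_mulVec hX hY hne, onSite_spin3_mulVec hX, onSite_spin3_mulVec hY]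
  have hval : (urnState L n g) σ = 0 := by rw [urnState_apply, if_neg hσ]
  have hex : (if σ ⟨x, hX⟩ = σ ⟨x + 1, hY⟩ then 0
      else (urnState L n g).ofLp (exchange σ ⟨x, hX⟩ ⟨x + 1, hY⟩) / 2) = 0 := by
    split_ifs with h
    · rfl
    · have m1 := mem_downSet (σ := σ) hX
      have m2 := mem_downSet (σ := σ) hY
      have hc : downCount (exchange σ ⟨x, hX⟩ ⟨x + 1, hY⟩) = downCount σ := by
        rw [← card_downSet, ← card_downSet]
        by_cases h1 : x ∈ downSet σ
        · have h2 : x + 1 ∉ downSet σ := fun h2 => h (by rw [m1.1 h1, m2.1 h2])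
          rw [downSet_exchange_right hX hY h1 h2, card_moveRight h1 h2]
        · have h2 : x + 1 ∈ downSet σ := by
            by_contra h2
            exact h (by rw [fin_two_ne_one.1 (fun h => h1 (m1.2 h)),
              fin_two_ne_one.1 (fun h => h2 (m2.2 h))])
          rw [downSet_exchange_left hX hY h1 h2, card_moveLeft h1 h2]
      rw [urnState_apply, if_neg (by rwa [hc]), zero_div]
  rw [hex, hval]; simp

/-- The Hamiltonian acts on functions of the occupation numbers as `urnOp` minus the boundary
field. -/
theorem hamiltonian_urnState {Δ q : ℝ} (hop_eq : hop q = 1 / (2 * Δ))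
    (field_eq : fieldA Δ = field q) {L n : ℕ} (hL : 1 ≤ L) (g : (ℕ → ℕ) → ℂ) :
    hamiltonian L Δ (urnState L n g)
      = urnState L n (fun ℓ => urnOp q (L - n) g ℓ - field q * g ℓ) := by
  have h1 : (1 : ℕ) ∈ Finset.Icc 1 L := Finset.mem_Icc.2 ⟨le_rfl, hL⟩
  have h2 : L ∈ Finset.Icc 1 L := Finset.mem_Icc.2 ⟨hL, le_rfl⟩
  ext σ
  rw [hamiltonian, Matrix.toLpLin_apply]
  show (hamiltonianMatrix L Δ *ᵥ (urnState L n g).ofLp) σ = _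
  rw [hamiltonianMatrix, Matrix.sub_mulVec, Matrix.neg_mulVec, Matrix.smul_mulVec,
    Matrix.add_mulVec, Matrix.sum_mulVec, Pi.sub_apply, Pi.neg_apply, Finset.sum_apply,
    Pi.smul_apply, Pi.add_apply, onSite_spin3_mulVec h1, onSite_spin3_mulVec h2, urnState_apply,
    field_eq, urnState_apply]
  by_cases hσ : downCount σ = n
  · rw [if_pos hσ, if_pos hσ, Finset.sum_congr rfl fun x hx => bond_mulVec_urnState hop_eq hx g hσ]
    have h3 := urnOp_occ (q := q) (downSet_subset σ) g
    rw [card_downSet, hσ] at h3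
    rw [h3, Finset.sum_neg_distrib, neg_neg]
    split_ifs <;> simp only [smul_eq_mul] <;> ring
  · rw [if_neg hσ, if_neg hσ, Finset.sum_eq_zero fun x hx => bond_mulVec_urnState_of_ne hx g hσ]
    simp

theorem inner_hamiltonian_urnState {Δ q : ℝ} (hop_eq : hop q = 1 / (2 * Δ))
    (field_eq : fieldA Δ = field q) {L n : ℕ} (hn : n + 1 ≤ L) (g : (ℕ → ℕ) → ℂ) :
    inner ℂ (urnState L (n + 1) g) (hamiltonian L Δ (urnState L (n + 1) g))
      = ((urnForm q (L - (n + 1)) n g - field q * ‖urnState L (n + 1) g‖ ^ 2 : ℝ) : ℂ) := by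
  rw [hamiltonian_urnState hop_eq field_eq (by omega), inner_urnState hn, norm_urnState_sq hn]
  push_cast
  rw [← sum_conj_mul_urnOp, Finset.mul_sum, ← Finset.sum_sub_distrib]
  refine Finset.sum_congr rfl fun ℓ _ => ?_
  have := Complex.conj_mul' (g ℓ)
  linear_combination -(field q : ℂ) * this

theorem hop_eq_of_anisotropy {Δ q : ℝ} (hq0 : 0 < q) (hΔq : Δ = (q + q⁻¹) / 2) :
    hop q = 1 / (2 * Δ) := by
  have : (1 + q ^ 2) ≠ 0 := by positivity
  rw [hΔq, hop]; field_simp; ring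

theorem gap_eq_of_anisotropy {Δ q : ℝ} (hq0 : 0 < q) (hΔq : Δ = (q + q⁻¹) / 2) :
    1 - Δ⁻¹ = gap q := by
  rw [gap_eq, hop_eq_of_anisotropy hq0 hΔq, one_div, mul_inv]; ring

theorem fieldA_eq_of_anisotropy {Δ q : ℝ} (hq0 : 0 < q) (hq1 : q < 1)
    (hΔq : Δ = (q + q⁻¹) / 2) : fieldA Δ = field q := by
  have h1 : (1 + q ^ 2) ≠ 0 := by positivity
  have h2 : 1 - (Δ ^ 2)⁻¹ = (2 * field q) ^ 2 := by
    rw [hΔq, field]; field_simp; ring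
  rw [fieldA, h2, Real.sqrt_sq (by have := field_nonneg hq0.le hq1; linarith)]
  ring

/-! ### Sums of powers -/

theorem sum_pow_le_of_injOn {ι : Type*} {w : ℝ} (hw0 : 0 ≤ w) (hw1 : w < 1) (S : Finset ι)
    (e : ι → ℕ) (he : Set.InjOn e S) : ∑ i ∈ S, w ^ e i ≤ 1 / (1 - w) := by
  classical
  rw [← Finset.sum_image (f := fun k => w ^ k) he, one_div, ← tsum_geometric_of_lt_one hw0 hw1]
  exact (summable_geometric_of_lt_one hw0 hw1).sum_le_tsum _ fun _ _ => by positivity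

theorem sum_pow_urnDist_le {w : ℝ} (hw0 : 0 ≤ w) (hw1 : w < 1) (S : Finset ℕ) (y : ℕ) :
    ∑ i ∈ S, w ^ urnDist y i ≤ 2 / (1 - w) := by
  rw [← Finset.sum_filter_add_sum_filter_not S (fun i => i < y)]
  have h1 := sum_pow_le_of_injOn hw0 hw1 (S.filter fun i => i < y) (urnDist y) (by
    intro a ha b hb h
    have := (Finset.mem_filter.1 ha).2
    have := (Finset.mem_filter.1 hb).2
    unfold urnDist at h; omega)
  have h2 := sum_pow_le_of_injOn hw0 hw1 (S.filter fun i => ¬ i < y) (urnDist y) (by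
    intro a ha b hb h
    have := (Finset.mem_filter.1 ha).2
    have := (Finset.mem_filter.1 hb).2
    unfold urnDist at h; omega)
  have h3 : 2 / (1 - w) = 1 / (1 - w) + 1 / (1 - w) := by ring
  rw [h3]; exact add_le_add h1 h2

/-- A sum of product weights over a family that is determined by its coordinates is at most the
product of the geometric series. -/
theorem sum_prod_pow_le {α : Type*} (D : Finset α) (s : Finset ℕ) (F : α → ℕ → ℕ) (w : ℕ → ℝ)
    (hw : ∀ i ∈ s, 0 ≤ w i ∧ w i < 1)
    (hinj : ∀ x ∈ D, ∀ y ∈ D, (∀ i ∈ s, F x i = F y i) → x = y) :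
    ∑ x ∈ D, ∏ i ∈ s, w i ^ F x i ≤ ∏ i ∈ s, 1 / (1 - w i) := by
  classical
  obtain ⟨B, hB⟩ : ∃ B, ∀ x ∈ D, ∀ i ∈ s, F x i < B := by
    refine ⟨(∑ x ∈ D, ∑ i ∈ s, F x i) + 1, fun x hx i hi => Nat.lt_succ_of_le ?_⟩
    exact (Finset.single_le_sum (f := fun i => F x i) (fun _ _ => Nat.zero_le _) hi).trans
      (Finset.single_le_sum (f := fun x => ∑ i ∈ s, F x i) (fun _ _ => Nat.zero_le _) hx)
  have h1 : ∑ x ∈ D, ∏ i ∈ s, w i ^ F x i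
      ≤ ∑ p ∈ s.pi fun _ => Finset.range B, ∏ i ∈ s.attach, w i.1 ^ p i.1 i.2 := by
    rw [Finset.sum_congr rfl fun x _ => (Finset.prod_attach s (fun i => w i ^ F x i)).symm,
      ← Finset.sum_image (s := D) (g := fun x => (fun i _ => F x i : ∀ i ∈ s, ℕ))
      (f := fun p => ∏ i ∈ s.attach, w i.1 ^ p i.1 i.2)]
    · refine Finset.sum_le_sum_of_subset_of_nonneg ?_ fun p _ _ =>
        Finset.prod_nonneg fun i _ => pow_nonneg (hw i.1 i.2).1 _
      intro p hp
      obtain ⟨x, hx, rfl⟩ := Finset.mem_image.1 hp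
      exact Finset.mem_pi.2 fun i hi => Finset.mem_range.2 (hB x hx i hi)
    · intro x hx y hy h
      exact hinj x hx y hy fun i hi => congrFun (congrFun h i) hi
  refine h1.trans ((Finset.prod_sum s (fun _ => Finset.range B) fun i k => w i ^ k).symm.le.trans ?_)
  refine Finset.prod_le_prod (fun i hi => Finset.sum_nonneg fun k _ => pow_nonneg (hw i hi).1 _)
    fun i hi => ?_
  exact sum_pow_le_of_injOn (hw i hi).1 (hw i hi).2 _ _ (Set.injOn_id _)

/-- A bound on partition functions of the particles outside a given urn, uniform in their number
and in the number of urns. -/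
def partBound (q : ℝ) : ℝ := Real.exp (2 / (q * (1 - q) ^ 2))

/-- The product of the geometric series of weights `q ^ e i` that decay with the distance from `y`
is bounded, even if one unit of the distance has been given away. -/
theorem prod_geometric_le {q : ℝ} (hq0 : 0 < q) (hq1 : q < 1) (K y : ℕ) (e : ℕ → ℕ)
    (he1 : ∀ i, i ≠ y → 1 ≤ e i) (he2 : ∀ i, urnDist y i ≤ e i + 1) :
    ∏ i ∈ (Finset.range K).erase y, 1 / (1 - q ^ e i) ≤ partBound q := by
  have hq : 0 < 1 - q := by linarith
  have h1 : ∀ i ∈ (Finset.range K).erase y,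
      1 / (1 - q ^ e i) ≤ Real.exp (q ^ urnDist y i / (q * (1 - q))) := by
    intro i hi
    have h2 : q ^ e i ≤ q :=
      pow_le_of_le_one hq0.le hq1.le (by have := he1 i (Finset.ne_of_mem_erase hi); omega)
    have h3 : 0 < 1 - q ^ e i := by linarith
    have h4 : 0 < q ^ e i := by positivity
    have h5 : q * q ^ e i ≤ q ^ urnDist y i := by
      rw [← pow_succ']; exact pow_le_pow_of_le_one hq0.le hq1.le (he2 i)
    calc 1 / (1 - q ^ e i) = q ^ e i / (1 - q ^ e i) + 1 := by field_simp; ring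
      _ ≤ q ^ urnDist y i / (q * (1 - q)) + 1 := by
          refine add_le_add_left ?_ _
          rw [div_le_div_iff₀ h3 (by positivity)]
          nlinarith [mul_le_mul_of_nonneg_right h5 h3.le, mul_pos hq0 h4]
      _ ≤ _ := Real.add_one_le_exp _
  have h6 : ∀ i ∈ (Finset.range K).erase y, 0 ≤ 1 / (1 - q ^ e i) := by
    intro i _
    have h2 : q ^ e i ≤ 1 := pow_le_one₀ hq0.le hq1.le
    exact div_nonneg zero_le_one (by linarith)
  refine (Finset.prod_le_prod h6 h1).trans ?_
  rw [← Real.exp_sum, ← Finset.sum_div, partBound]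
  refine Real.exp_le_exp.2 ?_
  rw [div_le_div_iff₀ (by positivity) (by positivity)]
  have h7 := sum_pow_urnDist_le hq0.le hq1 ((Finset.range K).erase y) y
  rw [le_div_iff₀ hq] at h7
  have := mul_le_mul_of_nonneg_right h7 (show 0 ≤ q * (1 - q) by positivity)
  nlinarith

theorem urns_eq_of_eqOn {K n y : ℕ} (hy : y < K) {a b : ℕ → ℕ} (ha : a ∈ urns K n)
    (hb : b ∈ urns K n) (h : ∀ i ∈ (Finset.range K).erase y, a i = b i) : a = b := by
  refine update_zero_injOn K n y hy ha hb ?_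
  funext i
  by_cases hi : i = y
  · subst hi; simp
  · simp only [Function.update_of_ne hi]
    by_cases hiK : i < K
    · exact h i (Finset.mem_erase.2 ⟨hi, Finset.mem_range.2 hiK⟩)
    · rw [not_not.1 (mt ((mem_urns.1 ha).2 i) hiK), not_not.1 (mt ((mem_urns.1 hb).2 i) hiK)]

theorem spread_eq_erase {K y : ℕ} (ℓ : ℕ → ℕ) :
    spread K y ℓ = ∑ i ∈ (Finset.range K).erase y, urnDist y i * ℓ i := by
  rw [spread, Finset.sum_erase]
  simp [urnDist]

/-- The partition function of the droplet at `y` is bounded uniformly in the number of particles: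
the occupation number of `y` is determined by the others, which are summed independently. -/
theorem sum_pow_spread_le {q : ℝ} (hq0 : 0 < q) (hq1 : q < 1) {K n y : ℕ} (hy : y < K) :
    ∑ ℓ ∈ urns K n, q ^ spread K y ℓ ≤ partBound q := by
  have h1 : ∀ ℓ ∈ urns K n, q ^ spread K y ℓ
      = ∏ i ∈ (Finset.range K).erase y, (q ^ urnDist y i) ^ ℓ i := by
    intro ℓ _
    rw [spread_eq_erase, Finset.prod_congr rfl fun i _ => (pow_mul q (urnDist y i) (ℓ i)).symm,
      Finset.prod_pow_eq_pow_sum]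
  have hd : ∀ i, i ≠ y → 1 ≤ urnDist y i := fun i hi => by unfold urnDist; omega
  rw [Finset.sum_congr rfl h1]
  refine (sum_prod_pow_le _ _ (fun ℓ => ℓ) (fun i => q ^ urnDist y i) (fun i hi => ⟨by positivity,
    pow_lt_one₀ hq0.le hq1 (by have := hd i (Finset.ne_of_mem_erase hi); omega)⟩)
    fun a ha b hb h => urns_eq_of_eqOn hy ha hb h).trans ?_
  exact prod_geometric_le hq0 hq1 K y _ hd fun i => by omega

/-- If at least `c` particles have left the urn `y` to one side `P`, the weight is at most `q ^ c`
times a constant: use the number of particles in `P` as a coordinate in place of the number of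
those in the urn `j` of `P` next to `y`. -/
theorem sum_pow_spread_tail_le {q : ℝ} (hq0 : 0 < q) (hq1 : q < 1) {K n y : ℕ} (hy : y < K)
    (P : Finset ℕ) (hP : P ⊆ (Finset.range K).erase y) {j : ℕ} (hj : j ∈ P)
    (hj1 : urnDist y j = 1) (hPd : ∀ i ∈ P, i ≠ j → 2 ≤ urnDist y i) (c : ℕ) :
    ∑ ℓ ∈ (urns K n).filter (fun ℓ => c ≤ ∑ i ∈ P, ℓ i), q ^ spread K y ℓ
      ≤ q ^ c * partBound q := by
  set e : ℕ → ℕ := fun i => if i ∈ P ∧ i ≠ j then urnDist y i - 1 else urnDist y i with he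
  set F : (ℕ → ℕ) → ℕ → ℕ := fun ℓ i => if i = j then (∑ i ∈ P, ℓ i) - c else ℓ i with hF
  have hd : ∀ i, i ≠ y → 1 ≤ urnDist y i := fun i hi => by unfold urnDist; omega
  have he1 : ∀ i, i ≠ y → 1 ≤ e i := by
    intro i hi
    simp only [he]
    split_ifs with h
    · have := hPd i h.1 h.2; omega
    · exact hd i hi
  have hsum : ∀ ℓ ∈ (urns K n).filter (fun ℓ => c ≤ ∑ i ∈ P, ℓ i),
      spread K y ℓ = c + ∑ i ∈ (Finset.range K).erase y, e i * F ℓ i := by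
    intro ℓ hℓ
    have hc := (Finset.mem_filter.1 hℓ).2
    rw [spread_eq_erase, ← Finset.sum_sdiff hP, ← Finset.sum_sdiff hP]
    have e1 : ∑ i ∈ (Finset.range K).erase y \ P, e i * F ℓ i
        = ∑ i ∈ (Finset.range K).erase y \ P, urnDist y i * ℓ i := by
      refine Finset.sum_congr rfl fun i hi => ?_
      have hiP := (Finset.mem_sdiff.1 hi).2
      have hij : i ≠ j := fun h => hiP (h ▸ hj)
      simp [he, hF, hiP, hij]
    have e2 : ∑ i ∈ P, e i * F ℓ i
        = (∑ i ∈ P, ℓ i - c) + ∑ i ∈ P.erase j, (urnDist y i - 1) * ℓ i := by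
      rw [← Finset.add_sum_erase _ _ hj]
      congr 1
      · simp [he, hF, hj1]
      · refine Finset.sum_congr rfl fun i hi => ?_
        obtain ⟨h1, h2⟩ := Finset.mem_erase.1 hi
        simp [he, hF, h1, h2]
    have e3 : ∑ i ∈ P, urnDist y i * ℓ i
        = ∑ i ∈ P, ℓ i + ∑ i ∈ P.erase j, (urnDist y i - 1) * ℓ i := by
      rw [← Finset.add_sum_erase _ _ hj, ← Finset.add_sum_erase _ (fun i => ℓ i) hj, hj1, one_mul,
        add_assoc, ← Finset.sum_add_distrib]
      congr 1
      refine Finset.sum_congr rfl fun i hi => ?_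
      obtain ⟨h1, h2⟩ := Finset.mem_erase.1 hi
      have := hPd i h2 h1
      obtain ⟨k, hk⟩ := Nat.exists_eq_add_of_le this
      rw [hk, show 2 + k - 1 = 1 + k by omega]; ring
    rw [e1, e2, e3]; omega
  have h1 : ∀ ℓ ∈ (urns K n).filter (fun ℓ => c ≤ ∑ i ∈ P, ℓ i), q ^ spread K y ℓ
      = q ^ c * ∏ i ∈ (Finset.range K).erase y, (q ^ e i) ^ F ℓ i := by
    intro ℓ hℓ
    rw [hsum ℓ hℓ, pow_add, Finset.prod_congr rfl fun i _ => (pow_mul q (e i) (F ℓ i)).symm,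
      Finset.prod_pow_eq_pow_sum]
  rw [Finset.sum_congr rfl h1, ← Finset.mul_sum]
  refine mul_le_mul_of_nonneg_left ?_ (by positivity)
  refine (sum_prod_pow_le _ _ F (fun i => q ^ e i) (fun i hi => ⟨by positivity,
    pow_lt_one₀ hq0.le hq1 (by have := he1 i (Finset.ne_of_mem_erase hi); omega)⟩) ?_).trans ?_
  · intro a ha b hb h
    obtain ⟨ha1, ha2⟩ := Finset.mem_filter.1 ha
    obtain ⟨hb1, hb2⟩ := Finset.mem_filter.1 hb
    have hne : ∀ i ∈ (Finset.range K).erase y, i ≠ j → a i = b i := by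
      intro i hi hij
      have := h i hi
      simpa [hF, hij] using this
    have hsum : ∑ i ∈ P, a i = ∑ i ∈ P, b i := by
      have := h j (hP hj)
      simp only [hF, if_true] at this
      omega
    have hjj : a j = b j := by
      have h1 := Finset.add_sum_erase P a hj
      have h2 := Finset.add_sum_erase P b hj
      have h3 : ∑ i ∈ P.erase j, a i = ∑ i ∈ P.erase j, b i :=
        Finset.sum_congr rfl fun i hi => hne i (hP (Finset.mem_of_mem_erase hi))
          (Finset.ne_of_mem_erase hi)
      omega
    refine urns_eq_of_eqOn hy ha1 hb1 fun i hi => ?_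
    by_cases hij : i = j
    · rw [hij, hjj]
    · exact hne i hi hij
  · refine prod_geometric_le hq0 hq1 K y e he1 fun i => ?_
    simp only [he]; split_ifs <;> omega

/-! ### The droplet functions `q ^ spread` -/

theorem urnDist_mul_le_spread {K n y z : ℕ} {ℓ : ℕ → ℕ} (hℓ : ℓ ∈ urns K n) :
    urnDist y z * n ≤ spread K y ℓ + spread K z ℓ := by
  rw [← (mem_urns.1 hℓ).1, spread, spread, ← Finset.sum_add_distrib, Finset.mul_sum]
  refine Finset.sum_le_sum fun i _ => ?_
  rw [← add_mul]
  refine Nat.mul_le_mul_right _ ?_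
  unfold urnDist; omega

theorem le_spread_of_eq_zero {K n y : ℕ} {ℓ : ℕ → ℕ} (hℓ : ℓ ∈ urns K n) (h : ℓ y = 0) :
    n ≤ spread K y ℓ := by
  rw [← (mem_urns.1 hℓ).1, spread]
  refine Finset.sum_le_sum fun i _ => ?_
  by_cases hi : i = y
  · subst hi; simp [h]
  · exact Nat.le_mul_of_pos_left _ (by unfold urnDist; omega)

/-- The droplet functions that are at most `q ^ (n / 2)` at a given configuration, where
`q = s ^ 2`, have a sum of this order: away from the largest of them they decrease
geometrically. -/
theorem sum_pow_spread_rows_le {s : ℝ} (hs0 : 0 < s) (hs1 : s < 1) {K n : ℕ} (hn : 1 ≤ n)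
    {ℓ : ℕ → ℕ} (hℓ : ℓ ∈ urns K n) (B : Finset ℕ) (hB : ∀ z ∈ B, n ≤ 2 * spread K z ℓ) :
    ∑ z ∈ B, (s ^ 2) ^ spread K z ℓ ≤ 2 / (s * (1 - s)) * s ^ n := by
  have hs : 0 < 1 - s := by linarith
  rcases B.eq_empty_or_nonempty with rfl | hne
  · rw [Finset.sum_empty]; positivity
  obtain ⟨z0, hz0, hmin⟩ := B.exists_min_image (fun z => spread K z ℓ) hne
  have h1 : ∀ z ∈ B, (s ^ 2) ^ spread K z ℓ ≤ s ^ n / s * s ^ urnDist z0 z := by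
    intro z hz
    have h2 := urnDist_mul_le_spread (y := z0) (z := z) hℓ
    have h3 := hmin z hz
    have h4 := hB z hz
    have h5 : n + urnDist z0 z ≤ 2 * spread K z ℓ + 1 := by
      rcases Nat.eq_zero_or_pos (urnDist z0 z) with h | h
      · omega
      · obtain ⟨d, hd⟩ := Nat.exists_eq_add_of_le h
        obtain ⟨k, hk⟩ := Nat.exists_eq_add_of_le hn
        have : n + (urnDist z0 z - 1) ≤ urnDist z0 z * n := by
          rw [hd, hk, show (0 + 1 + d : ℕ) - 1 = d by omega]; nlinarith
        omega
    rw [div_mul_eq_mul_div, le_div_iff₀ hs0, ← pow_mul, ← pow_succ, ← pow_add]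
    exact pow_le_pow_of_le_one hs0.le hs1.le h5
  refine (Finset.sum_le_sum h1).trans ?_
  rw [← Finset.mul_sum]
  refine (mul_le_mul_of_nonneg_left (sum_pow_urnDist_le hs0.le hs1 B z0) (by positivity)).trans
    (le_of_eq ?_)
  field_simp

/-- The overlap of two droplet functions on the configurations with an empty urn `z` is of order
`q ^ n`, where `q = s ^ 2`, and decays with the distance. Up to a factor these are the matrix
elements of the Hamiltonian minus `A(Δ)`. -/
theorem sum_pow_spread_add_le {s : ℝ} (hs0 : 0 < s) (hs1 : s < 1) {K n y z : ℕ} (hn : 1 ≤ n)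
    (hy : y < K) :
    ∑ ℓ ∈ (urns K n).filter (fun ℓ => ℓ z = 0), (s ^ 2) ^ (spread K y ℓ + spread K z ℓ)
      ≤ partBound s / s * (s ^ 2) ^ n * s ^ urnDist y z := by
  have h1 : ∀ ℓ ∈ (urns K n).filter (fun ℓ => ℓ z = 0),
      (s ^ 2) ^ (spread K y ℓ + spread K z ℓ)
        ≤ s ^ spread K y ℓ * ((s ^ 2) ^ n * s ^ urnDist y z / s) := by
    intro ℓ hℓ
    obtain ⟨hℓ1, hℓ2⟩ := Finset.mem_filter.1 hℓ
    have h2 := urnDist_mul_le_spread (y := y) (z := z) hℓ1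
    have h3 := le_spread_of_eq_zero hℓ1 hℓ2
    have h5 : spread K y ℓ + 2 * n + urnDist y z ≤ 2 * (spread K y ℓ + spread K z ℓ) + 1 := by
      rcases Nat.eq_zero_or_pos (urnDist y z) with h | h
      · have : y = z := by unfold urnDist at h; omega
        subst this; omega
      · obtain ⟨d, hd⟩ := Nat.exists_eq_add_of_le h
        obtain ⟨k, hk⟩ := Nat.exists_eq_add_of_le hn
        have : n + (urnDist y z - 1) ≤ urnDist y z * n := by
          rw [hd, hk, show (0 + 1 + d : ℕ) - 1 = d by omega]; nlinarith
        omega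
    rw [← mul_div_assoc, le_div_iff₀ hs0, ← pow_mul, ← pow_mul, ← pow_succ, ← pow_add, ← pow_add]
    exact pow_le_pow_of_le_one hs0.le hs1.le (by omega)
  refine (Finset.sum_le_sum h1).trans ?_
  rw [← Finset.sum_mul]
  have h6 : ∑ ℓ ∈ (urns K n).filter (fun ℓ => ℓ z = 0), s ^ spread K y ℓ ≤ partBound s :=
    (Finset.sum_le_sum_of_subset_of_nonneg (Finset.filter_subset _ _)
      fun _ _ _ => by positivity).trans (sum_pow_spread_le hs0 hs1 hy)
  refine (mul_le_mul_of_nonneg_right h6 (by positivity)).trans (le_of_eq ?_)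
  field_simp

/-- The Schur test: a matrix with nonnegative entries, row sums at most `R` and column sums at most
`C` has a squared norm of at most `R * C`. -/
theorem schur_test {ι κ : Type*} (X : Finset ι) (Y : Finset κ) (a : ι → κ → ℝ)
    (ha : ∀ x y, 0 ≤ a x y) {R C : ℝ} (hR : ∀ x ∈ X, ∑ y ∈ Y, a x y ≤ R)
    (hC : ∀ y ∈ Y, ∑ x ∈ X, a x y ≤ C) (hR0 : 0 ≤ R) (c : κ → ℂ) :
    ∑ x ∈ X, ‖∑ y ∈ Y, c y * (a x y : ℂ)‖ ^ 2 ≤ R * C * ∑ y ∈ Y, ‖c y‖ ^ 2 := by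
  have h1 : ∀ x ∈ X, ‖∑ y ∈ Y, c y * (a x y : ℂ)‖ ^ 2 ≤ R * ∑ y ∈ Y, a x y * ‖c y‖ ^ 2 := by
    intro x hx
    have h2 : ‖∑ y ∈ Y, c y * (a x y : ℂ)‖ ≤ ∑ y ∈ Y, ‖c y‖ * a x y := by
      refine (norm_sum_le _ _).trans (le_of_eq (Finset.sum_congr rfl fun y _ => ?_))
      rw [norm_mul, Complex.norm_real, Real.norm_eq_abs, abs_of_nonneg (ha x y)]
    have h3 : (∑ y ∈ Y, ‖c y‖ * a x y) ^ 2 ≤ (∑ y ∈ Y, a x y) * ∑ y ∈ Y, a x y * ‖c y‖ ^ 2 :=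
      Finset.sum_sq_le_sum_mul_sum_of_sq_le_mul Y (fun y _ => ha x y)
        (fun y _ => mul_nonneg (ha x y) (by positivity)) fun y _ => (by ring : _ = _).le
    refine (pow_le_pow_left₀ (norm_nonneg _) h2 2).trans (h3.trans ?_)
    exact mul_le_mul_of_nonneg_right (hR x hx)
      (Finset.sum_nonneg fun y _ => mul_nonneg (ha x y) (by positivity))
  refine (Finset.sum_le_sum h1).trans ?_
  rw [← Finset.mul_sum, Finset.sum_comm, mul_assoc]
  refine mul_le_mul_of_nonneg_left ?_ hR0
  rw [Finset.mul_sum]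
  refine Finset.sum_le_sum fun y hy => ?_
  rw [← Finset.sum_mul]
  exact mul_le_mul_of_nonneg_right (hC y hy) (by positivity)

/-! ### Estimates for superpositions of droplet functions -/

/-- The superposition with coefficients `c` of the functions `q ^ spread K y`. -/
def dropFn (q : ℝ) (K : ℕ) (c : ℕ → ℂ) (ℓ : ℕ → ℕ) : ℂ :=
  ∑ y ∈ Finset.range K, c y * ((q ^ spread K y ℓ : ℝ) : ℂ)

/-- A median of the `n` particles lies in the urn `y` or at its boundary: at most `n / 2` of them,
rounded down, are to the left of `y`, and at least as many are not to the right of `y`. -/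
def IsMedian (n y : ℕ) (ℓ : ℕ → ℕ) : Prop :=
  ∑ i ∈ Finset.range y, ℓ i ≤ n / 2 ∧ n / 2 ≤ ∑ i ∈ Finset.range (y + 1), ℓ i

open Classical in
/-- The superposition with coefficients `c` of the functions `q ^ spread K y`, cut off to the
configurations with median in `y`. -/
def cutFn (q : ℝ) (K n : ℕ) (c : ℕ → ℂ) (ℓ : ℕ → ℕ) : ℂ :=
  ∑ y ∈ Finset.range K, c y * ((if IsMedian n y ℓ then q ^ spread K y ℓ else 0 : ℝ) : ℂ)

/-- The function of the occupation numbers that represents `H - A` applied to a superposition of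
droplet functions. -/
def residueFn (q : ℝ) (K : ℕ) (c : ℕ → ℂ) (ℓ : ℕ → ℕ) : ℂ :=
  ∑ y ∈ Finset.range K, c y * ((if ℓ y = 0 then q ^ spread K y ℓ else 0 : ℝ) : ℂ)

/-- For large `n` the coefficients of a superposition of droplet functions are controlled by its
norm: on the configuration with all particles in the urn `y` the other droplet functions nearly
vanish. -/
theorem sum_norm_sq_coeff_le {q : ℝ} (hq0 : 0 < q) (hq1 : q < 1) {K n : ℕ} (hn : 1 ≤ n)
    (hsmall : q ^ (n - 1) * (2 / (1 - q)) ≤ 1 / 2) (c : ℕ → ℂ) :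
    ∑ y ∈ Finset.range K, ‖c y‖ ^ 2 ≤ 4 * ∑ ℓ ∈ urns K n, ‖dropFn q K c ℓ‖ ^ 2 := by
  classical
  have hq : 0 < 1 - q := by linarith
  -- `pile y` is the configuration with all particles in the urn `y`.
  set pile : ℕ → ℕ → ℕ := fun y => Pi.single y n with hpile
  have hspread : ∀ y ∈ Finset.range K, ∀ z, spread K z (pile y) = urnDist z y * n := by
    intro y hy z
    rw [spread, Finset.sum_eq_single y]
    · simp [hpile]
    · intro i _ hi; simp [hpile, hi]
    · exact fun h => absurd hy h
  have hmem : ∀ y ∈ Finset.range K, pile y ∈ urns K n := by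
    intro y hy
    refine mem_urns.2 ⟨?_, fun i hi => ?_⟩
    · rw [Finset.sum_eq_single y]
      · simp [hpile]
      · intro i _ hi; simp [hpile, hi]
      · exact fun h => absurd hy h
    · by_cases h : i = y
      · rw [h]; exact Finset.mem_range.1 hy
      · simp [hpile, h] at hi
  have hinj : Set.InjOn pile (Finset.range K : Finset ℕ) := by
    intro y _ z _ h
    by_contra hne
    have := congrFun h y
    simp only [hpile, Pi.single_eq_same, Pi.single_eq_of_ne hne] at this
    omega
  -- The off-diagonal values, whose row and column sums are at most `1 / 2` by assumption.
  set a : ℕ → ℕ → ℝ := fun y z => if z = y then 0 else q ^ (urnDist z y * n) with ha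
  have hval : ∀ y ∈ Finset.range K, dropFn q K c (pile y)
      = c y + ∑ z ∈ Finset.range K, c z * (a y z : ℂ) := by
    intro y hy
    rw [dropFn, ← Finset.add_sum_erase _ _ hy, ← Finset.add_sum_erase _ (fun z => c z * (a y z : ℂ)) hy,
      hspread y hy]
    have h0 : urnDist y y = 0 := by simp [urnDist]
    simp only [h0, ha, zero_mul, pow_zero, Complex.ofReal_one, mul_one, if_true,
      Complex.ofReal_zero, mul_zero, zero_add]
    congr 1
    refine Finset.sum_congr rfl fun z hz => ?_
    rw [hspread y hy, if_neg (Finset.ne_of_mem_erase hz)]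
  have hsym : ∀ y z, a y z = a z y := by
    intro y z
    simp only [ha, eq_comm (a := z), urnDist, add_comm]
  have hrow : ∀ y ∈ Finset.range K, ∑ z ∈ Finset.range K, a y z ≤ 1 / 2 := by
    intro y _
    have h1 : ∀ z ∈ Finset.range K, a y z ≤ q ^ (n - 1) * q ^ urnDist y z := by
      intro z _
      simp only [ha]
      split_ifs with h
      · positivity
      · rw [← pow_add]
        refine pow_le_pow_of_le_one hq0.le hq1.le ?_
        have h2 : urnDist z y = urnDist y z := by unfold urnDist; omega
        have h3 : 1 ≤ urnDist y z := by unfold urnDist; omega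
        rw [h2]
        obtain ⟨d, hd⟩ := Nat.exists_eq_add_of_le h3
        obtain ⟨k, hk⟩ := Nat.exists_eq_add_of_le hn
        rw [hd, hk, show (1 + k : ℕ) - 1 = k by omega]; nlinarith
    refine (Finset.sum_le_sum h1).trans ?_
    rw [← Finset.mul_sum]
    exact (mul_le_mul_of_nonneg_left (sum_pow_urnDist_le hq0.le hq1 _ y) (by positivity)).trans
      hsmall
  have hschur := schur_test (Finset.range K) (Finset.range K) a (fun y z => by
    simp only [ha]; split_ifs <;> positivity) hrow
    (fun z hz => by simpa only [hsym _ z] using hrow z hz) (by norm_num) c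
  have hsub : ∑ y ∈ Finset.range K, ‖dropFn q K c (pile y)‖ ^ 2
      ≤ ∑ ℓ ∈ urns K n, ‖dropFn q K c ℓ‖ ^ 2 := by
    rw [← Finset.sum_image (f := fun ℓ => ‖dropFn q K c ℓ‖ ^ 2) hinj]
    refine Finset.sum_le_sum_of_subset_of_nonneg ?_ fun _ _ _ => by positivity
    intro ℓ hℓ
    obtain ⟨y, hy, rfl⟩ := Finset.mem_image.1 hℓ
    exact hmem y hy
  have hpt : ∀ y ∈ Finset.range K, ‖c y‖ ^ 2 ≤ 2 * ‖dropFn q K c (pile y)‖ ^ 2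
      + 2 * ‖∑ z ∈ Finset.range K, c z * (a y z : ℂ)‖ ^ 2 := by
    intro y hy
    set r := ∑ z ∈ Finset.range K, c z * (a y z : ℂ)
    have h1 : c y = dropFn q K c (pile y) - r := by rw [hval y hy]; ring
    have h2 : ‖c y‖ ≤ ‖dropFn q K c (pile y)‖ + ‖r‖ := by rw [h1]; exact norm_sub_le _ _
    nlinarith [norm_nonneg (c y), sq_nonneg (‖dropFn q K c (pile y)‖ - ‖r‖)]
  have hfin := Finset.sum_le_sum hpt
  rw [Finset.sum_add_distrib, ← Finset.mul_sum, ← Finset.mul_sum] at hfin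
  linarith

/-- The residue of a superposition of droplet functions is of order `q ^ (n / 2)`, where
`q = s ^ 2`. -/
theorem sum_norm_residueFn_sq_le {s : ℝ} (hs0 : 0 < s) (hs1 : s < 1) {K n : ℕ} (hn : 1 ≤ n)
    (c : ℕ → ℂ) :
    ∑ ℓ ∈ urns K n, ‖residueFn (s ^ 2) K c ℓ‖ ^ 2
      ≤ 2 * partBound s / (s * (1 - s)) * (s ^ 2) ^ n * ∑ y ∈ Finset.range K, ‖c y‖ ^ 2 := by
  have hs : 0 < 1 - s := by linarith
  have h := schur_test (urns K n) (Finset.range K)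
    (fun ℓ y => if ℓ y = 0 then (s ^ 2) ^ spread K y ℓ else 0)
    (R := 2 / (s * (1 - s)) * s ^ n) (C := s ^ n * partBound s)
    (fun ℓ y => by split_ifs <;> positivity) ?_ ?_ (by positivity) c
  · refine h.trans (le_of_eq ?_)
    field_simp; ring
  · intro ℓ hℓ
    rw [← Finset.sum_filter]
    refine sum_pow_spread_rows_le hs0 hs1 hn hℓ _ fun z hz => ?_
    have := le_spread_of_eq_zero hℓ (Finset.mem_filter.1 hz).2
    omega
  · intro y hy
    rw [← Finset.sum_filter]
    have h1 : ∀ ℓ ∈ (urns K n).filter (fun ℓ => ℓ y = 0), (s ^ 2) ^ spread K y ℓ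
        ≤ s ^ n * s ^ spread K y ℓ := by
      intro ℓ hℓ
      obtain ⟨hℓ1, hℓ2⟩ := Finset.mem_filter.1 hℓ
      have := le_spread_of_eq_zero hℓ1 hℓ2
      rw [← pow_mul, ← pow_add]
      exact pow_le_pow_of_le_one hs0.le hs1.le (by omega)
    refine (Finset.sum_le_sum h1).trans ?_
    rw [← Finset.mul_sum]
    refine mul_le_mul_of_nonneg_left ?_ (by positivity)
    exact (Finset.sum_le_sum_of_subset_of_nonneg (Finset.filter_subset _ _)
      fun _ _ _ => by positivity).trans (sum_pow_spread_le hs0 hs1 (Finset.mem_range.1 hy))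

/-- The expectation of the Hamiltonian minus `A(Δ)` in a superposition of droplet functions is of
order `q ^ n`, where `q = s ^ 2`: better than what follows from the norm of the residue. -/
theorem norm_sum_conj_mul_residueFn_le {s : ℝ} (hs0 : 0 < s) (hs1 : s < 1) {K n : ℕ}
    (hn : 1 ≤ n) (c : ℕ → ℂ) :
    ‖∑ ℓ ∈ urns K n, (starRingEnd ℂ) (dropFn (s ^ 2) K c ℓ) * residueFn (s ^ 2) K c ℓ‖
      ≤ 2 * partBound s / (s * (1 - s)) * (s ^ 2) ^ n * ∑ y ∈ Finset.range K, ‖c y‖ ^ 2 := by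
  have hs : 0 < 1 - s := by linarith
  have hp : 0 ≤ partBound s := (Real.exp_pos _).le
  set b : ℕ → ℕ → ℝ := fun y z => if y < K then
    ∑ ℓ ∈ (urns K n).filter (fun ℓ => ℓ z = 0), (s ^ 2) ^ (spread K y ℓ + spread K z ℓ) else 0
    with hb
  have hb0 : ∀ y z, 0 ≤ b y z := fun y z => by
    simp only [hb]; split_ifs
    · exact Finset.sum_nonneg fun _ _ => by positivity
    · exact le_rfl
  have hbl : ∀ y z, b y z ≤ partBound s / s * (s ^ 2) ^ n * s ^ urnDist y z := by
    intro y z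
    simp only [hb]; split_ifs with h
    · exact sum_pow_spread_add_le hs0 hs1 hn h
    · positivity
  set R := 2 * partBound s / (s * (1 - s)) * (s ^ 2) ^ n with hR
  have hR0 : 0 ≤ R := by positivity
  have hRe : partBound s / s * (s ^ 2) ^ n * (2 / (1 - s)) = R := by rw [hR]; field_simp
  have hrow : ∀ y ∈ Finset.range K, ∑ z ∈ Finset.range K, b y z ≤ R := by
    intro y _
    refine (Finset.sum_le_sum fun z _ => hbl y z).trans ?_
    rw [← Finset.mul_sum, ← hRe]
    exact mul_le_mul_of_nonneg_left (sum_pow_urnDist_le hs0.le hs1 _ y) (by positivity)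
  have hcol : ∀ z ∈ Finset.range K, ∑ y ∈ Finset.range K, b y z ≤ R := by
    intro z _
    refine (Finset.sum_le_sum fun y _ => hbl y z).trans ?_
    rw [← Finset.mul_sum, ← hRe]
    refine mul_le_mul_of_nonneg_left ?_ (by positivity)
    have := sum_pow_urnDist_le hs0.le hs1 (Finset.range K) z
    simpa only [urnDist, add_comm] using this
  have hschur := schur_test (Finset.range K) (Finset.range K) b hb0 hrow hcol hR0 c
  have hexp : ∑ ℓ ∈ urns K n, (starRingEnd ℂ) (dropFn (s ^ 2) K c ℓ) * residueFn (s ^ 2) K c ℓ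
      = ∑ y ∈ Finset.range K, (starRingEnd ℂ) (c y) * ∑ z ∈ Finset.range K, c z * (b y z : ℂ) := by
    have h1 : ∀ ℓ ∈ urns K n,
        (starRingEnd ℂ) (dropFn (s ^ 2) K c ℓ) * residueFn (s ^ 2) K c ℓ
        = ∑ y ∈ Finset.range K, ∑ z ∈ Finset.range K, (starRingEnd ℂ) (c y) * (c z *
          ((if ℓ z = 0 then (s ^ 2) ^ (spread K y ℓ + spread K z ℓ) else 0 : ℝ) : ℂ)) := by
      intro ℓ _
      rw [dropFn, residueFn, map_sum, Finset.sum_mul_sum]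
      refine Finset.sum_congr rfl fun y _ => Finset.sum_congr rfl fun z _ => ?_
      rw [map_mul, Complex.conj_ofReal]
      split_ifs
      · push_cast; ring
      · simp
    rw [Finset.sum_congr rfl h1, Finset.sum_comm]
    refine Finset.sum_congr rfl fun y hy => ?_
    rw [Finset.sum_comm, Finset.mul_sum]
    refine Finset.sum_congr rfl fun z _ => ?_
    rw [← Finset.mul_sum, ← Finset.mul_sum]
    simp only [hb, if_pos (Finset.mem_range.1 hy), Finset.sum_filter, Complex.ofReal_sum]
  rw [hexp]
  have h2 : ‖∑ y ∈ Finset.range K, (starRingEnd ℂ) (c y) * ∑ z ∈ Finset.range K, c z * (b y z : ℂ)‖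
      ≤ ∑ y ∈ Finset.range K, ‖c y‖ * ‖∑ z ∈ Finset.range K, c z * (b y z : ℂ)‖ := by
    refine (norm_sum_le _ _).trans (le_of_eq (Finset.sum_congr rfl fun y _ => ?_))
    rw [norm_mul, Complex.norm_conj]
  have hS : 0 ≤ ∑ y ∈ Finset.range K, ‖c y‖ ^ 2 := Finset.sum_nonneg fun _ _ => by positivity
  refine h2.trans (le_of_sq_le_sq ?_ (by positivity))
  refine (Finset.sum_mul_sq_le_sq_mul_sq _ _ _).trans ?_
  refine (mul_le_mul_of_nonneg_left hschur hS).trans (le_of_eq (by ring))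

/-- The configurations without a median in `y` have a total weight of order `q ^ (n / 2)`, where
`q = s ^ 2`, since about half of the particles are on one side of `y`. -/
theorem sum_not_isMedian_le {s : ℝ} (hs0 : 0 < s) (hs1 : s < 1) {K n y : ℕ} (hy : y < K)
    [DecidablePred fun ℓ : ℕ → ℕ => ¬ IsMedian n y ℓ] :
    ∑ ℓ ∈ (urns K n).filter (fun ℓ => ¬ IsMedian n y ℓ), (s ^ 2) ^ spread K y ℓ
      ≤ 2 * (s ^ n * partBound (s ^ 2)) := by
  classical
  have hq0 : 0 < s ^ 2 := by positivity
  have hq1 : s ^ 2 < 1 := pow_lt_one₀ hs0.le hs1 two_ne_zero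
  have hp : 0 ≤ partBound (s ^ 2) := (Real.exp_pos _).le
  -- The bound for one side `P` of `y`, whose urn next to `y` is `j`.
  have hside : ∀ (P : Finset ℕ) (j k : ℕ), P ⊆ (Finset.range K).erase y →
      (P.Nonempty → j ∈ P) → urnDist y j = 1 → (∀ i ∈ P, i ≠ j → 2 ≤ urnDist y i) →
      n ≤ 2 * (k + 1) →
      ∑ ℓ ∈ (urns K n).filter (fun ℓ => k + 1 ≤ ∑ i ∈ P, ℓ i), (s ^ 2) ^ spread K y ℓ
        ≤ s ^ n * partBound (s ^ 2) := by
    intro P j k hP hj hj1 hPd hk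
    rcases P.eq_empty_or_nonempty with rfl | hne
    · rw [Finset.sum_eq_zero]
      · positivity
      · intro ℓ hℓ
        have := (Finset.mem_filter.1 hℓ).2
        simp at this
    · refine (sum_pow_spread_tail_le hq0 hq1 hy P hP (hj hne) hj1 hPd (k + 1)).trans ?_
      rw [← pow_mul]
      exact mul_le_mul_of_nonneg_right (pow_le_pow_of_le_one hs0.le hs1.le hk) hp
  have hr : (Finset.Ico (y + 1) K).Nonempty → y + 1 ∈ Finset.Ico (y + 1) K := fun ⟨i, hi⟩ => by
    have := Finset.mem_Ico.1 hi; exact Finset.mem_Ico.2 (by omega)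
  have hright := hside (Finset.Ico (y + 1) K) (y + 1) (n - n / 2) (fun i hi => by
      have := Finset.mem_Ico.1 hi
      exact Finset.mem_erase.2 ⟨by omega, Finset.mem_range.2 (by omega)⟩) hr
    (by unfold urnDist; omega) (fun i hi hne => by
      have := Finset.mem_Ico.1 hi; unfold urnDist; omega) (by omega)
  have hleft : ∑ ℓ ∈ (urns K n).filter (fun ℓ => n / 2 + 1 ≤ ∑ i ∈ Finset.range y, ℓ i),
      (s ^ 2) ^ spread K y ℓ ≤ s ^ n * partBound (s ^ 2) := by
    rcases Nat.eq_zero_or_pos y with rfl | hpos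
    · rw [Finset.sum_eq_zero]
      · positivity
      · intro ℓ hℓ
        have := (Finset.mem_filter.1 hℓ).2
        simp at this
    · refine hside (Finset.range y) (y - 1) (n / 2) (fun i hi => ?_) (fun _ => ?_) ?_ ?_ (by omega)
      · have := Finset.mem_range.1 hi
        exact Finset.mem_erase.2 ⟨by omega, Finset.mem_range.2 (by omega)⟩
      · exact Finset.mem_range.2 (by omega)
      · unfold urnDist; omega
      · intro i hi hne
        have := Finset.mem_range.1 hi
        unfold urnDist; omega
  rw [two_mul]
  refine le_trans ?_ (add_le_add hleft hright)
  rw [← Finset.sum_union_inter]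
  refine le_trans (Finset.sum_le_sum_of_subset_of_nonneg ?_ fun _ _ _ => by positivity)
    (le_add_of_nonneg_right (Finset.sum_nonneg fun _ _ => by positivity))
  intro ℓ hℓ
  obtain ⟨h1, h2⟩ := Finset.mem_filter.1 hℓ
  have h3 := Finset.sum_range_add_sum_Ico (fun i => ℓ i) (show y + 1 ≤ K by omega)
  rw [(mem_urns.1 h1).1] at h3
  rw [Finset.mem_union, Finset.mem_filter, Finset.mem_filter]
  unfold IsMedian at h2
  by_cases h4 : n / 2 + 1 ≤ ∑ i ∈ Finset.range y, ℓ i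
  · exact Or.inl ⟨h1, h4⟩
  · exact Or.inr ⟨h1, by omega⟩

theorem le_two_mul_spread_of_not_isMedian {K n y : ℕ} {ℓ : ℕ → ℕ} (hℓ : ℓ ∈ urns K n) (hy : y < K)
    (h : ¬ IsMedian n y ℓ) : n ≤ 2 * spread K y ℓ := by
  have h1 : ∑ i ∈ Finset.range K, ℓ i ≤ spread K y ℓ + ℓ y := by
    rw [spread_eq_erase, ← Finset.sum_erase_add _ _ (Finset.mem_range.2 hy)]
    refine Nat.add_le_add_right (Finset.sum_le_sum fun i hi => ?_) _
    have := Finset.ne_of_mem_erase hi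
    exact Nat.le_mul_of_pos_left _ (by unfold urnDist; omega)
  have h3 := Finset.sum_range_add_sum_Ico (fun i => ℓ i) (show y + 1 ≤ K by omega)
  have h4 := Finset.sum_range_succ (fun i => ℓ i) y
  rw [(mem_urns.1 hℓ).1] at h1 h3
  unfold IsMedian at h
  omega

theorem sum_norm_dropFn_sub_cutFn_sq_le {s : ℝ} (hs0 : 0 < s) (hs1 : s < 1) {K n : ℕ}
    (hn : 1 ≤ n) (c : ℕ → ℂ) :
    ∑ ℓ ∈ urns K n, ‖dropFn (s ^ 2) K c ℓ - cutFn (s ^ 2) K n c ℓ‖ ^ 2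
      ≤ 4 * partBound (s ^ 2) / (s * (1 - s)) * (s ^ 2) ^ n
        * ∑ y ∈ Finset.range K, ‖c y‖ ^ 2 := by
  classical
  have hs : 0 < 1 - s := by linarith
  have h := schur_test (urns K n) (Finset.range K)
    (fun ℓ y => if ¬ IsMedian n y ℓ then (s ^ 2) ^ spread K y ℓ else 0)
    (R := 2 / (s * (1 - s)) * s ^ n) (C := 2 * (s ^ n * partBound (s ^ 2)))
    (fun ℓ y => by split_ifs <;> positivity) ?_ ?_ (by positivity) c
  · refine le_trans (le_of_eq (Finset.sum_congr rfl fun ℓ _ => ?_)) (h.trans (le_of_eq ?_))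
    · rw [dropFn, cutFn, ← Finset.sum_sub_distrib]
      congr 2
      refine Finset.sum_congr rfl fun y _ => ?_
      by_cases h : IsMedian n y ℓ <;> simp [h]
    · field_simp; ring
  · intro ℓ hℓ
    rw [← Finset.sum_filter]
    refine sum_pow_spread_rows_le hs0 hs1 hn hℓ _ fun z hz => ?_
    obtain ⟨h1, h2⟩ := Finset.mem_filter.1 hz
    exact le_two_mul_spread_of_not_isMedian hℓ (Finset.mem_range.1 h1) h2
  · intro y hy
    rw [← Finset.sum_filter]
    exact sum_not_isMedian_le hs0 hs1 (Finset.mem_range.1 hy)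

/-! ### Droplet states in terms of occupation numbers -/

theorem sum_range_occ (D : Finset ℕ) (y : ℕ) :
    ∑ i ∈ Finset.range y, occ D i = (D.filter fun p => ups D p < y).card := by
  rw [Finset.card_eq_sum_card_fiberwise (f := ups D) (t := Finset.range y)
    fun p hp => by simpa using (Finset.mem_filter.1 hp).2]
  refine Finset.sum_congr rfl fun i hi => ?_
  rw [occ, Finset.filter_filter]
  congr 1
  refine Finset.filter_congr fun p _ => ⟨fun h => ⟨?_, h⟩, fun h => h.2⟩
  rw [h]; exact Finset.mem_range.1 hi

theorem spread_occ {L : ℕ} {D : Finset ℕ} (hD : D ⊆ Finset.Icc 1 L) (y : ℕ) :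
    spread (L - D.card + 1) y (occ D) = ∑ p ∈ D, urnDist y (ups D p) := by
  have h : ∀ p ∈ D, ups D p ∈ Finset.range (L - D.card + 1) := fun p hp => by
    have := ups_mono D (Finset.mem_Icc.1 (hD hp)).2
    rw [ups_last hD] at this; exact Finset.mem_range.2 (by omega)
  rw [← Finset.sum_fiberwise_of_maps_to h, spread]
  refine Finset.sum_congr rfl fun i _ => ?_
  rw [Finset.sum_congr rfl fun p hp => by rw [(Finset.mem_filter.1 hp).2], Finset.sum_const, occ,
    smul_eq_mul, mul_comm]

/-- The site `y + n / 2` has `n / 2` down spins up to it, and hence `y` up spins, exactly if a median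
of the `n` down spins lies in the urn `y`. -/
theorem card_inter_eq_iff_isMedian {D : Finset ℕ} {n y : ℕ} (h0 : 0 ∉ D) :
    (D ∩ Finset.Icc 1 (y + n / 2)).card = n / 2 ↔ IsMedian n y (occ D) := by
  have hx := ups_add_card D (y + n / 2)
  rw [IsMedian, sum_range_occ, sum_range_occ]
  constructor
  · intro h
    have hu : ups D (y + n / 2) = y := by omega
    constructor
    · refine (Finset.card_le_card ?_).trans h.le
      intro p hp
      obtain ⟨h1, h2⟩ := Finset.mem_filter.1 hp
      refine Finset.mem_inter.2 ⟨h1, Finset.mem_Icc.2 ⟨?_, ?_⟩⟩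
      · by_contra h3
        exact h0 ((show p = 0 by omega) ▸ h1)
      · by_contra h3
        have := ups_mono D (show y + n / 2 ≤ p by omega); omega
    · refine h.symm.le.trans (Finset.card_le_card ?_)
      intro p hp
      obtain ⟨h1, h2⟩ := Finset.mem_inter.1 hp
      have := ups_mono D (Finset.mem_Icc.1 h2).2
      exact Finset.mem_filter.2 ⟨h1, by omega⟩
  · rintro ⟨h1, h2⟩
    by_contra hne
    rcases lt_or_gt_of_ne hne with h | h
    · refine absurd (h2.trans (Finset.card_le_card (t := D ∩ Finset.Icc 1 (y + n / 2)) ?_))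
        (by omega)
      intro p hp
      obtain ⟨h3, h4⟩ := Finset.mem_filter.1 hp
      refine Finset.mem_inter.2 ⟨h3, Finset.mem_Icc.2 ⟨?_, ?_⟩⟩
      · by_contra h5
        exact h0 ((show p = 0 by omega) ▸ h3)
      · by_contra h5
        have := ups_mono D (show y + n / 2 ≤ p by omega); omega
    · refine absurd ((Finset.card_le_card (s := D ∩ Finset.Icc 1 (y + n / 2)) ?_).trans h1)
        (by omega)
      intro p hp
      obtain ⟨h3, h4⟩ := Finset.mem_inter.1 hp
      have := ups_mono D (Finset.mem_Icc.1 h4).2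
      exact Finset.mem_filter.2 ⟨h3, by omega⟩

/-- The `k`-th down spin is at a site with `k` down spins to the left of it, itself included. -/
theorem sum_rank {D : Finset ℕ} (h0 : 0 ∉ D) (g : ℕ → ℕ) :
    ∑ p ∈ D, g (D ∩ Finset.Icc 1 p).card = ∑ k ∈ Finset.Icc 1 D.card, g k := by
  have hmem : ∀ p ∈ D, p ∈ D ∩ Finset.Icc 1 p := fun p hp =>
    Finset.mem_inter.2 ⟨hp, Finset.mem_Icc.2 ⟨Nat.pos_of_ne_zero fun h => h0 (h ▸ hp), le_rfl⟩⟩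
  have hlt : ∀ a ∈ D, ∀ b ∈ D, a < b →
      (D ∩ Finset.Icc 1 a).card < (D ∩ Finset.Icc 1 b).card := by
    intro a _ b hb hab
    refine Finset.card_lt_card ((Finset.ssubset_iff_of_subset ?_).2 ⟨b, hmem b hb, ?_⟩)
    · exact Finset.inter_subset_inter_left (Finset.Icc_subset_Icc_right hab.le)
    · intro h
      have := (Finset.mem_Icc.1 (Finset.mem_inter.1 h).2).2
      omega
  have hinj : Set.InjOn (fun p => (D ∩ Finset.Icc 1 p).card) D := by
    intro a ha b hb h
    rcases lt_trichotomy a b with h1 | h1 | h1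
    · exact absurd h (hlt a ha b hb h1).ne
    · exact h1
    · exact absurd h (hlt b hb a ha h1).ne'
  have himg : D.image (fun p => (D ∩ Finset.Icc 1 p).card) = Finset.Icc 1 D.card := by
    refine Finset.eq_of_subset_of_card_le ?_ ?_
    · intro k hk
      obtain ⟨p, hp, rfl⟩ := Finset.mem_image.1 hk
      exact Finset.mem_Icc.2 ⟨Finset.card_pos.2 ⟨p, hmem p hp⟩,
        Finset.card_le_card Finset.inter_subset_left⟩
    · rw [Finset.card_image_of_injOn hinj, Nat.card_Icc, Nat.add_sub_cancel]
  rw [← himg, Finset.sum_image hinj]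

/-- The exponent in the normalization of a droplet. -/
def dropletExp (n : ℕ) : ℕ :=
  ∑ k ∈ Finset.Icc 1 n, if k ≤ n / 2 then n / 2 + 1 - k else k - n / 2

/-- The exponent of `q` in the droplet state with cut at `y + n / 2`. The `k`-th down spin is at the
site `k + ups`, so that its distance to the cut is the distance of its urn to `y` up to a number that
depends on `k` only. -/
theorem sum_droplet_exponent {L : ℕ} {D : Finset ℕ} (hD : D ⊆ Finset.Icc 1 L) {y : ℕ}
    (h : (D ∩ Finset.Icc 1 (y + D.card / 2)).card = D.card / 2) :
    (∑ p ∈ D with p ≤ y + D.card / 2, (y + D.card / 2 + 1 - p))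
        + (∑ p ∈ D with ¬ p ≤ y + D.card / 2, (p + 1 - (y + D.card / 2 + 1)))
      = spread (L - D.card + 1) y (occ D) + dropletExp D.card := by
  have h0 : 0 ∉ D := fun h => by have := Finset.mem_Icc.1 (hD h); omega
  have hu : ups D (y + D.card / 2) = y := by
    have := ups_add_card D (y + D.card / 2); omega
  rw [spread_occ hD, dropletExp, ← sum_rank h0, ← Finset.sum_add_distrib,
    ← Finset.sum_filter_add_sum_filter_not D (fun p => p ≤ y + D.card / 2)]
  refine congrArg₂ (· + ·) (Finset.sum_congr rfl fun p hp => ?_)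
    (Finset.sum_congr rfl fun p hp => ?_)
  · have hp2 := (Finset.mem_filter.1 hp).2
    have h1 := ups_add_card D p
    have h2 := ups_mono D hp2
    have h3 : (D ∩ Finset.Icc 1 p).card ≤ D.card / 2 :=
      (Finset.card_le_card (Finset.inter_subset_inter_left
        (Finset.Icc_subset_Icc_right hp2))).trans h.le
    rw [if_pos h3]; unfold urnDist; omega
  · obtain ⟨hp1, hp2⟩ := Finset.mem_filter.1 hp
    have h1 := ups_add_card D p
    have h2 := ups_mono D (show y + D.card / 2 ≤ p by omega)
    have h3 : D.card / 2 < (D ∩ Finset.Icc 1 p).card := by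
      refine h.symm.le.trans_lt (Finset.card_lt_card ((Finset.ssubset_iff_of_subset ?_).2
        ⟨p, ?_, ?_⟩))
      · exact Finset.inter_subset_inter_left (Finset.Icc_subset_Icc_right (by omega))
      · exact Finset.mem_inter.2 ⟨hp1, Finset.mem_Icc.2 ⟨by omega, le_rfl⟩⟩
      · intro h4
        have := (Finset.mem_Icc.1 (Finset.mem_inter.1 h4).2).2
        omega
    rw [if_neg (by omega)]; unfold urnDist; omega

theorem ket_apply {a b : ℕ} (X : Finset (Site a b)) (τ : Config a b) :
    ket X τ = if X = Finset.univ.filter (fun y => τ y = 1) then 1 else 0 := by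
  rw [ket, PiLp.single_apply]
  refine if_congr ⟨fun h => ?_, fun h => ?_⟩ rfl rfl
  · ext y
    rw [h]; simp
  · funext y
    rw [h]
    by_cases hy : τ y = 1
    · simp [hy]
    · simp [fin_two_ne_one.1 hy]

theorem sum_powersetCard_ket {a b : ℕ} (m : ℕ) (f : Finset (Site a b) → ℂ) (τ : Config a b) :
    (∑ X ∈ (Finset.univ : Finset (Site a b)).powersetCard m, f X • ket X) τ
      = if downCount τ = m then f (Finset.univ.filter fun y => τ y = 1) else 0 := by
  rw [WithLp.ofLp_sum, Finset.sum_apply]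
  simp only [PiLp.smul_apply, ket_apply, smul_eq_mul, mul_ite, mul_one, mul_zero]
  rw [Finset.sum_ite_eq']
  refine if_congr ?_ rfl rfl
  rw [Finset.mem_powersetCard, downCount]
  simp

theorem sum_restrict {L a b : ℕ} (h : Finset.Icc a b ⊆ Finset.Icc 1 L) (σ : Config 1 L)
    (f : ℕ → ℕ) :
    ∑ y ∈ (Finset.univ : Finset (Site a b)).filter (fun y : Site a b => σ ⟨y, h y.2⟩ = 1), f (y : ℕ)
      = ∑ p ∈ downSet σ ∩ Finset.Icc a b, f p := by
  refine Finset.sum_bij (fun y _ => (y : ℕ)) ?_ ?_ ?_ ?_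
  · intro y hy
    exact Finset.mem_inter.2 ⟨(mem_downSet (h y.2)).2 (Finset.mem_filter.1 hy).2, y.2⟩
  · intro y _ z _ h; exact Subtype.ext h
  · intro p hp
    obtain ⟨h1, h2⟩ := Finset.mem_inter.1 hp
    exact ⟨⟨p, h2⟩, Finset.mem_filter.2 ⟨Finset.mem_univ _, (mem_downSet (h h2)).1 h1⟩, rfl⟩
  · intro _ _; rfl

theorem downCount_restrict {L a b : ℕ} (h : Finset.Icc a b ⊆ Finset.Icc 1 L) (σ : Config 1 L) :
    downCount (fun y : Site a b => σ ⟨y, h y.2⟩) = (downSet σ ∩ Finset.Icc a b).card := by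
  rw [downCount, Finset.card_eq_sum_ones, Finset.card_eq_sum_ones]
  exact sum_restrict h σ fun _ => 1

open Classical in
/-- A droplet state is, up to normalization, a cut-off function `q ^ spread`. -/
theorem droplet_eq {q : ℝ} {L n y : ℕ} (hx : y + n / 2 ≤ L) :
    droplet q L n (y + n / 2) hx = ((q : ℂ) ^ dropletExp n) • urnState L n
      (fun ℓ => ((if IsMedian n y ℓ then q ^ spread (L - n + 1) y ℓ else 0 : ℝ) : ℂ)) := by
  ext σ
  have hsub1 : Finset.Icc 1 (y + n / 2) ⊆ Finset.Icc 1 L := Finset.Icc_subset_Icc le_rfl hx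
  have hsub2 : Finset.Icc (y + n / 2 + 1) L ⊆ Finset.Icc 1 L :=
    Finset.Icc_subset_Icc (Nat.le_add_left 1 _) le_rfl
  have hD := downSet_subset σ
  have e1 : downSet σ ∩ Finset.Icc 1 (y + n / 2) = (downSet σ).filter (· ≤ y + n / 2) := by
    ext p
    rw [Finset.mem_inter, Finset.mem_filter, Finset.mem_Icc]
    exact and_congr_right fun h => ⟨fun h => h.2, fun h' => ⟨(Finset.mem_Icc.1 (hD h)).1, h'⟩⟩
  have e2 : downSet σ ∩ Finset.Icc (y + n / 2 + 1) L
      = (downSet σ).filter (¬ · ≤ y + n / 2) := by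
    ext p
    rw [Finset.mem_inter, Finset.mem_filter, Finset.mem_Icc]
    exact and_congr_right fun h => ⟨fun h => by omega,
      fun h' => ⟨by omega, (Finset.mem_Icc.1 (hD h)).2⟩⟩
  have e3 := Finset.card_filter_add_card_filter_not (s := downSet σ) (· ≤ y + n / 2)
  rw [← e1, ← e2, card_downSet] at e3
  have lhs : droplet q L n (y + n / 2) hx σ
      = (if (downSet σ ∩ Finset.Icc 1 (y + n / 2)).card = n / 2 then
          (q : ℂ) ^ (∑ p ∈ downSet σ ∩ Finset.Icc 1 (y + n / 2), (y + n / 2 + 1 - p)) else 0)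
        * (if (downSet σ ∩ Finset.Icc (y + n / 2 + 1) L).card = (n + 1) / 2 then
          (q : ℂ) ^ (∑ p ∈ downSet σ ∩ Finset.Icc (y + n / 2 + 1) L,
            (p + 1 - (y + n / 2 + 1))) else 0) := by
    rw [← downCount_restrict hsub1, ← downCount_restrict hsub2,
      ← sum_restrict hsub1 σ fun p => y + n / 2 + 1 - p,
      ← sum_restrict hsub2 σ fun p => p + 1 - (y + n / 2 + 1)]
    show kink q 1 _ _ _ * antikink q _ L _ _ = _
    rw [kink, antikink, sum_powersetCard_ket, sum_powersetCard_ket]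
  rw [lhs, PiLp.smul_apply, urnState_apply, smul_eq_mul]
  by_cases hσ : downCount σ = n
  · rw [if_pos hσ]
    have h1 := card_inter_eq_iff_isMedian (n := n) (y := y) (zero_notMem_downSet σ)
    by_cases h2 : IsMedian n y (occ (downSet σ))
    · have h3 := h1.2 h2
      have h4 := sum_droplet_exponent hD (y := y) (by rw [card_downSet, hσ]; exact h3)
      rw [card_downSet, hσ, ← e1, ← e2] at h4
      rw [if_pos h3, if_pos (by omega), if_pos h2, ← pow_add, h4, pow_add]
      push_cast; ring
    · rw [if_neg (fun h => h2 (h1.1 h)), if_neg h2]; simp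
  · rw [if_neg hσ]
    by_cases h3 : (downSet σ ∩ Finset.Icc 1 (y + n / 2)).card = n / 2
    · rw [if_neg (show (downSet σ ∩ Finset.Icc (y + n / 2 + 1) L).card ≠ (n + 1) / 2 by omega)]
      simp
    · rw [if_neg h3]; simp

theorem urnState_sum (L n : ℕ) {ι : Type*} (s : Finset ι) (c : ι → ℂ) (f : ι → (ℕ → ℕ) → ℂ) :
    urnState L n (fun ℓ => ∑ y ∈ s, c y * f y ℓ) = ∑ y ∈ s, c y • urnState L n (f y) := by
  ext σ
  rw [WithLp.ofLp_sum, Finset.sum_apply]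
  simp only [PiLp.smul_apply, urnState_apply, smul_eq_mul]
  split_ifs <;> simp

/-- The droplet space consists of the cut-off superpositions of droplet functions. -/
theorem mem_dropletSpace_iff {q : ℝ} (hq0 : 0 < q) {L n : ℕ} (hn : n ≤ L) (ψ : Space 1 L) :
    ψ ∈ dropletSpace q L n ↔ ∃ c, ψ = urnState L n (cutFn q (L - n + 1) n c) := by
  classical
  set k : ℕ → Space 1 L := fun y => urnState L n
    (fun ℓ => ((if IsMedian n y ℓ then q ^ spread (L - n + 1) y ℓ else 0 : ℝ) : ℂ)) with hk
  have hcut : ∀ c, urnState L n (cutFn q (L - n + 1) n c)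
      = ∑ y ∈ Finset.range (L - n + 1), c y • k y := fun c => urnState_sum _ _ _ _ _
  have hq : (q : ℂ) ^ dropletExp n ≠ 0 := pow_ne_zero _ (by exact_mod_cast hq0.ne')
  constructor
  · intro h
    rw [dropletSpace] at h
    induction h using Submodule.span_induction with
    | mem v hv =>
      obtain ⟨x, hx, h1, h2, rfl⟩ := hv
      obtain ⟨y, rfl⟩ := Nat.exists_eq_add_of_le' h1
      refine ⟨Pi.single y ((q : ℂ) ^ dropletExp n), ?_⟩
      rw [hcut, droplet_eq, Finset.sum_eq_single y]
      · simp [hk]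
      · intro z _ hz; simp [hz]
      · intro h; exact absurd (Finset.mem_range.2 (by omega)) h
    | zero => exact ⟨0, by rw [hcut]; simp⟩
    | add u v _ _ hu hv =>
      obtain ⟨c, rfl⟩ := hu
      obtain ⟨d, rfl⟩ := hv
      refine ⟨c + d, ?_⟩
      rw [hcut, hcut, hcut, ← Finset.sum_add_distrib]
      simp [add_smul]
    | smul a u _ hu =>
      obtain ⟨c, rfl⟩ := hu
      refine ⟨a • c, ?_⟩
      rw [hcut, hcut, Finset.smul_sum]
      simp [mul_smul]
  · rintro ⟨c, rfl⟩
    rw [hcut]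
    refine Submodule.sum_mem _ fun y hy => Submodule.smul_mem _ _ ?_
    have hy' := Finset.mem_range.1 hy
    have h1 : k y = ((q : ℂ) ^ dropletExp n)⁻¹ • droplet q L n (y + n / 2) (by omega) := by
      rw [droplet_eq, inv_smul_smul₀ hq]
    rw [h1]
    exact Submodule.smul_mem _ _ (Submodule.subset_span
      ⟨y + n / 2, by omega, by omega, by omega, rfl⟩)

/-! ### Spectral estimates from approximate eigenvectors -/

section Spectral

/-- The indices of the first `K` eigenvalues. -/
abbrev lowIdx (F K : ℕ) : Finset (Fin F) := Finset.univ.filter fun j => (j : ℕ) < K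

/-- The indices of the eigenvalues after the first `K` ones. -/
abbrev highIdx (F K : ℕ) : Finset (Fin F) := Finset.univ.filter fun j => K ≤ (j : ℕ)

variable {E : Type*} [NormedAddCommGroup E] [InnerProductSpace ℂ E]

/-- Two subspaces each of which is close to the other have nearby orthogonal projections. -/
theorem norm_starProjection_sub_le {U W : Submodule ℂ E} [U.HasOrthogonalProjection]
    [W.HasOrthogonalProjection] {δ : ℝ} (hδ : 0 ≤ δ)
    (hU : ∀ u ∈ U, ∃ w ∈ W, ‖u - w‖ ≤ δ * ‖u‖) (hW : ∀ w ∈ W, ∃ u ∈ U, ‖w - u‖ ≤ δ * ‖w‖) :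
    ‖U.starProjection - W.starProjection‖ ≤ 2 * δ := by
  refine ContinuousLinearMap.opNorm_le_bound _ (by positivity) fun x => ?_
  set z := x - U.starProjection x with hz
  have h1 : ‖U.starProjection x - W.starProjection (U.starProjection x)‖ ≤ δ * ‖x‖ := by
    obtain ⟨w, hw, h⟩ := hU _ (U.starProjection_apply_mem x)
    rw [W.starProjection_minimal]
    refine (ciInf_le ⟨0, ?_⟩ (⟨w, hw⟩ : W)).trans (h.trans
      (mul_le_mul_of_nonneg_left (U.norm_starProjection_apply_le x) hδ))
    rintro _ ⟨y, rfl⟩; exact norm_nonneg _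
  have hzx : ‖z‖ ≤ ‖x‖ := by
    have := Uᗮ.norm_starProjection_apply_le x
    rwa [Submodule.starProjection_orthogonal_val] at this
  have hzU : ∀ u ∈ U, inner ℂ u z = 0 := fun u hu =>
    (Submodule.mem_orthogonal _ _).1 (U.sub_starProjection_mem_orthogonal x) u hu
  have h2 : ‖W.starProjection z‖ ≤ δ * ‖x‖ := by
    set w := W.starProjection z with hw
    obtain ⟨u, hu, h⟩ := hW w (W.starProjection_apply_mem z)
    have h3 : inner ℂ w w = inner ℂ (w - u) z := by
      rw [inner_sub_left, hzU u hu, sub_zero]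
      have h4 : inner ℂ w (z - w) = 0 :=
        (Submodule.mem_orthogonal _ _).1 (W.sub_starProjection_mem_orthogonal z) w
          (W.starProjection_apply_mem z)
      rw [inner_sub_right, sub_eq_zero] at h4
      exact h4.symm
    have h5 : ‖w‖ * ‖w‖ ≤ δ * ‖w‖ * ‖z‖ := by
      have h6 : ‖w‖ * ‖w‖ = ‖inner ℂ w w‖ := by
        rw [inner_self_eq_norm_sq_to_K]; simp [sq]
      rw [h6, h3]
      exact (norm_inner_le_norm _ _).trans (mul_le_mul_of_nonneg_right h (norm_nonneg _))
    rcases (norm_nonneg w).eq_or_lt' with h0 | h0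
    · rw [h0]; positivity
    · have : ‖w‖ ≤ δ * ‖z‖ := by
        by_contra hlt; nlinarith
      exact this.trans (mul_le_mul_of_nonneg_left hzx hδ)
  have h7 : (U.starProjection - W.starProjection) x
      = (U.starProjection x - W.starProjection (U.starProjection x)) - W.starProjection z := by
    rw [hz, map_sub]; simp
  rw [h7]
  refine (norm_sub_le _ _).trans ?_
  linarith

variable {S : Submodule ℂ E} {F : ℕ} (b : OrthonormalBasis (Fin F) ℂ S)

theorem sum_inner_smul {ψ : E} (hψ : ψ ∈ S) :
    ∑ j, inner ℂ (b j : E) ψ • (b j : E) = ψ := by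
  have := congrArg Subtype.val (b.sum_repr' ⟨ψ, hψ⟩)
  simpa using this

theorem sum_norm_inner_sq {ψ : E} (hψ : ψ ∈ S) : ∑ j, ‖inner ℂ (b j : E) ψ‖ ^ 2 = ‖ψ‖ ^ 2 :=
  b.sum_sq_norm_inner_right ⟨ψ, hψ⟩

theorem inner_basis (i j : Fin F) : inner ℂ (b i : E) (b j : E) = if i = j then 1 else 0 :=
  orthonormal_iff_ite.1 b.orthonormal i j

theorem inner_sum_smul (a : Fin F → ℂ) (j : Fin F) :
    inner ℂ (b j : E) (∑ i, a i • (b i : E)) = a j := by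
  rw [inner_sum]
  simp [inner_smul_right, inner_basis]

variable {val : Fin F → ℝ} {H : E →ₗ[ℂ] E} (heig : ∀ j, H (b j) = (val j : ℂ) • (b j : E))
include heig

theorem inner_apply_eq {ψ : E} (hψ : ψ ∈ S) (j : Fin F) :
    inner ℂ (b j : E) (H ψ) = val j * inner ℂ (b j : E) ψ := by
  have h : H ψ = ∑ i, (val i * inner ℂ (b i : E) ψ) • (b i : E) := by
    conv_lhs => rw [← sum_inner_smul b hψ]
    rw [map_sum]
    refine Finset.sum_congr rfl fun i _ => ?_
    rw [map_smul, heig, smul_smul, mul_comm]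
  rw [h, inner_sum_smul]

theorem re_inner_apply {ψ : E} (hψ : ψ ∈ S) :
    (inner ℂ ψ (H ψ)).re = ∑ j, val j * ‖inner ℂ (b j : E) ψ‖ ^ 2 := by
  have h : inner ℂ ψ (H ψ) = ∑ j, ((val j * ‖inner ℂ (b j : E) ψ‖ ^ 2 : ℝ) : ℂ) := by
    conv_lhs => rw [← sum_inner_smul b hψ]
    rw [sum_inner]
    refine Finset.sum_congr rfl fun j _ => ?_
    rw [sum_inner_smul b hψ, inner_smul_left, inner_apply_eq b heig hψ]
    have := Complex.conj_mul' (inner ℂ (b j : E) ψ)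
    push_cast
    linear_combination (val j : ℂ) * this
  rw [h, ← Complex.ofReal_sum, Complex.ofReal_re]

/-- The min-max principle: `K` linear constraints leave a trial state below each eigenvalue from
number `K` (counted from `0`) on. -/
theorem exists_orthogonal_trial (hmono : Monotone val) {K : ℕ} (φ : Fin K → E) {j : Fin F}
    (hj : K ≤ (j : ℕ)) :
    ∃ ψ ∈ S, ψ ≠ 0 ∧ (∀ y, inner ℂ (φ y) ψ = 0) ∧ (inner ℂ ψ (H ψ)).re ≤ val j * ‖ψ‖ ^ 2 := by
  set vec : (Fin (j + 1) → ℂ) →ₗ[ℂ] E :=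
    { toFun := fun a => ∑ i : Fin F, (if h : (i : ℕ) < j + 1 then a ⟨i, h⟩ else 0) • (b i : E)
      map_add' := fun a a' => by
        rw [← Finset.sum_add_distrib]
        refine Finset.sum_congr rfl fun i _ => ?_
        split_ifs <;> simp [add_smul]
      map_smul' := fun r a => by
        rw [RingHom.id_apply, Finset.smul_sum]
        refine Finset.sum_congr rfl fun i _ => ?_
        split_ifs <;> simp [mul_smul] } with hvec
  set Φ : (Fin (j + 1) → ℂ) →ₗ[ℂ] (Fin K → ℂ) :=
    { toFun := fun a y => inner ℂ (φ y) (vec a)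
      map_add' := fun a a' => by funext y; simp
      map_smul' := fun r a => by funext y; simp } with hΦ
  have hker : LinearMap.ker Φ ≠ ⊥ := LinearMap.ker_ne_bot_of_finrank_lt (by simp; omega)
  obtain ⟨a, ha, hne⟩ := Submodule.exists_mem_ne_zero_of_ne_bot hker
  have hmem : vec a ∈ S := Submodule.sum_mem (t := Finset.univ) _ fun i _ => Submodule.smul_mem _ _ (b i).2
  have hcoef : ∀ i : Fin F, inner ℂ (b i : E) (vec a) = if h : (i : ℕ) < j + 1 then a ⟨i, h⟩ else 0 :=
    fun i => inner_sum_smul b _ i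
  refine ⟨vec a, hmem, fun h0 => hne ?_, fun y => congrFun (LinearMap.mem_ker.1 ha) y, ?_⟩
  · funext i
    have := hcoef ⟨i, by omega⟩
    rw [h0, inner_zero_right, dif_pos i.2] at this
    exact this.symm
  · rw [re_inner_apply b heig hmem, ← sum_norm_inner_sq b hmem, Finset.mul_sum]
    refine Finset.sum_le_sum fun i _ => ?_
    rw [hcoef]
    split_ifs with h
    · exact mul_le_mul_of_nonneg_right (hmono (Fin.le_def.2 (by omega))) (by positivity)
    · simp

variable {K : ℕ} {A g : ℝ} (hg : 0 < g) (hgap : ∀ j : Fin F, K ≤ (j : ℕ) → A + g ≤ val j)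
include hg hgap

/-- The part of an approximate eigenvector outside the low energy space is bounded by the
residue. -/
theorem sum_high_le {ψ : E} (hψ : ψ ∈ S) :
    g * ∑ j ∈ highIdx F K, ‖inner ℂ (b j : E) ψ‖ ^ 2
      ≤ ∑ j ∈ highIdx F K, (val j - A) * ‖inner ℂ (b j : E) ψ‖ ^ 2 ∧
    g * ∑ j ∈ highIdx F K, (val j - A) * ‖inner ℂ (b j : E) ψ‖ ^ 2
      ≤ ‖H ψ - (A : ℂ) • ψ‖ ^ 2 := by
  constructor
  · rw [Finset.mul_sum]
    refine Finset.sum_le_sum fun j hj => mul_le_mul_of_nonneg_right ?_ (by positivity)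
    have := hgap j (Finset.mem_filter.1 hj).2
    linarith
  · have hHS : H ψ - (A : ℂ) • ψ ∈ S := by
      refine Submodule.sub_mem _ ?_ (Submodule.smul_mem _ _ hψ)
      rw [← sum_inner_smul b hψ, map_sum]
      refine Submodule.sum_mem _ fun i _ => ?_
      rw [map_smul, heig]
      exact Submodule.smul_mem _ _ (Submodule.smul_mem _ _ (b i).2)
    rw [← sum_norm_inner_sq b hHS, Finset.mul_sum]
    refine (Finset.sum_le_sum (g := fun j => ‖inner ℂ (b j : E) (H ψ - (A : ℂ) • ψ)‖ ^ 2)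
      fun j hj => ?_).trans
      (Finset.sum_le_sum_of_subset_of_nonneg (Finset.filter_subset _ _) fun _ _ _ => by positivity)
    have h1 := hgap j (Finset.mem_filter.1 hj).2
    have h2 : inner ℂ (b j : E) (H ψ - (A : ℂ) • ψ)
        = ((val j - A : ℝ) : ℂ) * inner ℂ (b j : E) ψ := by
      rw [inner_sub_right, inner_smul_right, inner_apply_eq b heig hψ]; push_cast; ring
    rw [h2, norm_mul, Complex.norm_real, mul_pow, Real.norm_eq_abs, sq_abs, ← mul_assoc]
    refine mul_le_mul_of_nonneg_right ?_ (by positivity)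
    nlinarith

variable (v : (Fin K → ℂ) →ₗ[ℂ] E) (hvS : ∀ c, v c ∈ S) (hinj : ∀ c, v c = 0 → c = 0)
  {η : ℝ} (hη0 : 0 ≤ η) (hη : 2 * η ≤ g) (hres : ∀ c, ‖H (v c) - (A : ℂ) • v c‖ ≤ η * ‖v c‖)
include hvS hη0 hη hres

/-- A superposition of approximate eigenvectors is close to its projection on the low energy space,
which therefore has at least half its norm. -/
theorem norm_high_le (c : Fin K → ℂ) :
    ‖v c - ∑ j ∈ lowIdx F K, inner ℂ (b j : E) (v c) • (b j : E)‖ ≤ η / g * ‖v c‖ ∧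
      ‖v c‖ ≤ 2 * ‖∑ j ∈ lowIdx F K, inner ℂ (b j : E) (v c) • (b j : E)‖ := by
  set w := ∑ j ∈ lowIdx F K, inner ℂ (b j : E) (v c) • (b j : E) with hw
  have hwS : w ∈ S := Submodule.sum_mem _ fun i _ => Submodule.smul_mem _ _ (b i).2
  have hcoef : ∀ j, inner ℂ (b j : E) (v c - w)
      = if K ≤ (j : ℕ) then inner ℂ (b j : E) (v c) else 0 := by
    intro j
    rw [inner_sub_right, hw, Finset.sum_filter]
    have := inner_sum_smul b (fun i => if (i : ℕ) < K then inner ℂ (b i : E) (v c) else 0) j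
    simp only [ite_smul, zero_smul] at this
    rw [this]
    by_cases h : (j : ℕ) < K
    · simp [h]
    · simp [h, not_lt.1 h]
  have h1 : ‖v c - w‖ ^ 2 = ∑ j ∈ highIdx F K, ‖inner ℂ (b j : E) (v c)‖ ^ 2 := by
    rw [← sum_norm_inner_sq b (Submodule.sub_mem _ (hvS c) hwS), Finset.sum_filter]
    refine Finset.sum_congr rfl fun j _ => ?_
    rw [hcoef]; split_ifs <;> simp
  obtain ⟨h2, h3⟩ := sum_high_le b heig hg hgap (hvS c)
  rw [← h1] at h2
  have h4 : (g * ‖v c - w‖) ^ 2 ≤ (η * ‖v c‖) ^ 2 := by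
    have := pow_le_pow_left₀ (norm_nonneg _) (hres c) 2
    calc (g * ‖v c - w‖) ^ 2 = g * (g * ‖v c - w‖ ^ 2) := by ring
      _ ≤ _ := (mul_le_mul_of_nonneg_left h2 hg.le).trans (h3.trans this)
  have h5 : g * ‖v c - w‖ ≤ η * ‖v c‖ := le_of_sq_le_sq h4 (by positivity)
  refine ⟨by rw [div_mul_eq_mul_div, le_div_iff₀ hg]; linarith, ?_⟩
  have h6 : ‖v c‖ ≤ ‖v c - w‖ + ‖w‖ := by
    have := norm_add_le (v c - w) w
    rwa [sub_add_cancel] at this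
  have h7 : 2 * η * ‖v c‖ ≤ g * ‖v c‖ := mul_le_mul_of_nonneg_right hη (norm_nonneg _)
  have h8 : g * ‖v c‖ ≤ g * (2 * ‖w‖) := by
    have := mul_le_mul_of_nonneg_left h6 hg.le
    nlinarith
  exact le_of_mul_le_mul_left h8 hg

include hinj

/-- As many independent approximate eigenvectors as there are low eigenvalues project onto the
low energy space. -/
theorem exists_inner_eq (a : Fin F → ℂ) :
    ∃ c, ∀ j : Fin F, (j : ℕ) < K → inner ℂ (b j : E) (v c) = a j := by
  set Φ : (Fin K → ℂ) →ₗ[ℂ] ({j : Fin F // (j : ℕ) < K} → ℂ) :=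
    { toFun := fun c j => inner ℂ (b j : E) (v c)
      map_add' := fun c c' => by funext y; simp
      map_smul' := fun r c => by funext y; simp } with hΦ
  have hΦi : Function.Injective Φ := by
    refine (injective_iff_map_eq_zero Φ).2 fun c hc => hinj c ?_
    have h := (norm_high_le b heig hg hgap v hvS hη0 hη hres c).2
    rw [Finset.sum_eq_zero, norm_zero, mul_zero] at h
    · exact norm_le_zero_iff.1 h
    · intro j hj
      have : inner ℂ (b j : E) (v c) = 0 := congrFun hc ⟨j, (Finset.mem_filter.1 hj).2⟩
      rw [this, zero_smul]
  -- Injectivity also shows that there are at least `K` eigenvalues.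
  have h1 := LinearMap.finrank_le_finrank_of_injective hΦi
  have h2 : Fintype.card {j : Fin F // (j : ℕ) < K} ≤ Fintype.card (Fin K) :=
    Fintype.card_le_of_injective (fun j => (⟨j.1, j.2⟩ : Fin K)) fun i j h => by
      rw [Fin.mk.injEq] at h; exact Subtype.ext (Fin.ext h)
  rw [Module.finrank_fintype_fun_eq_card, Module.finrank_fintype_fun_eq_card] at h1
  have hΦs : Function.Surjective Φ := (LinearMap.injective_iff_surjective_of_finrank_eq_finrank (by
    rw [Module.finrank_fintype_fun_eq_card, Module.finrank_fintype_fun_eq_card]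
    exact le_antisymm h1 h2)).1 hΦi
  obtain ⟨c, hc⟩ := hΦs fun j => a j
  exact ⟨c, fun j hj => congrFun hc ⟨j, hj⟩⟩

/-- The low eigenvalues are as close to `A` as the expectations in the approximate eigenvectors: for
an approximate eigenvector `v c` with projection `b j` on the low energy space, the expectation of
`H - A` is `val j - A` up to a term of second order in the residue. -/
theorem abs_val_sub_le (hquad : ∀ c, |(inner ℂ (v c) (H (v c) - (A : ℂ) • v c)).re|
      ≤ η ^ 2 * ‖v c‖ ^ 2) {j : Fin F} (hj : (j : ℕ) < K) :
    |val j - A| ≤ 4 * (1 + 1 / g) * η ^ 2 := by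
  obtain ⟨c, hc⟩ := exists_inner_eq b heig hg hgap v hvS hinj hη0 hη hres (Pi.single j 1)
  have hw : ∑ i ∈ lowIdx F K, inner ℂ (b i : E) (v c) • (b i : E) = (b j : E) := by
    rw [Finset.sum_eq_single j]
    · rw [hc j hj]; simp
    · intro i hi hij
      rw [hc i (Finset.mem_filter.1 hi).2, Pi.single_eq_of_ne hij, zero_smul]
    · intro h; exact absurd (show j ∈ lowIdx F K from Finset.mem_filter.2 ⟨Finset.mem_univ _, hj⟩) h
  have hb : ‖(b j : E)‖ = 1 := b.orthonormal.1 j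
  have h1 := (norm_high_le b heig hg hgap v hvS hη0 hη hres c).2
  rw [hw, hb] at h1
  have hv4 : ‖v c‖ ^ 2 ≤ 4 := by nlinarith [norm_nonneg (v c)]
  obtain ⟨h2, h3⟩ := sum_high_le b heig hg hgap (hvS c)
  set Q := ∑ i ∈ highIdx F K, (val i - A) * ‖inner ℂ (b i : E) (v c)‖ ^ 2 with hQ
  have hQ0 : 0 ≤ Q := le_trans (mul_nonneg hg.le (Finset.sum_nonneg fun _ _ => by positivity)) h2
  have hform : (inner ℂ (v c) (H (v c) - (A : ℂ) • v c)).re = (val j - A) + Q := by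
    have e1 : (inner ℂ (v c) (H (v c) - (A : ℂ) • v c)).re
        = ∑ i, (val i - A) * ‖inner ℂ (b i : E) (v c)‖ ^ 2 := by
      have e2 : (inner ℂ (v c) ((A : ℂ) • v c)).re = A * ‖v c‖ ^ 2 := by
        rw [inner_smul_right, inner_self_eq_norm_sq_to_K, Complex.re_ofReal_mul]
        simp [← Complex.ofReal_pow]
      rw [inner_sub_right, Complex.sub_re, re_inner_apply b heig (hvS c), e2,
        ← sum_norm_inner_sq b (hvS c), Finset.mul_sum, ← Finset.sum_sub_distrib]
      exact Finset.sum_congr rfl fun i _ => by ring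
    rw [e1, ← Finset.sum_filter_add_sum_filter_not _ (fun i : Fin F => (i : ℕ) < K)]
    congr 1
    · rw [Finset.sum_eq_single j]
      · rw [hc j hj]; simp
      · intro i hi hij
        rw [hc i (Finset.mem_filter.1 hi).2, Pi.single_eq_of_ne hij]; simp
      · intro h; exact absurd (show j ∈ lowIdx F K from Finset.mem_filter.2 ⟨Finset.mem_univ _, hj⟩) h
    · rw [hQ]; simp only [not_lt]
  have h5 : Q ≤ 4 * η ^ 2 / g := by
    rw [le_div_iff₀ hg]
    have := pow_le_pow_left₀ (norm_nonneg _) (hres c) 2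
    nlinarith [mul_le_mul_of_nonneg_left hv4 (sq_nonneg η)]
  have h6 := abs_le.1 (hquad c)
  have h7 := mul_le_mul_of_nonneg_left hv4 (sq_nonneg η)
  have h8 : 4 * (1 + 1 / g) * η ^ 2 = 4 * η ^ 2 + 4 * η ^ 2 / g := by field_simp
  rw [hform] at h6
  rw [h8, abs_le]
  have h9 : 0 ≤ 4 * η ^ 2 / g := by positivity
  constructor <;> linarith [h6.1, h6.2]

/-- If the approximate eigenvectors `v c` are close to the elements `k c` of `U`, then `U` is close to
the low energy space. -/
theorem norm_starProjection_sub_low_le {U W : Submodule ℂ E} [U.HasOrthogonalProjection]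
    [W.HasOrthogonalProjection] (k : (Fin K → ℂ) → E) (hU : ∀ x, x ∈ U ↔ ∃ c, x = k c)
    (hW : W = Submodule.span ℂ {x | ∃ j : Fin F, (j : ℕ) < K ∧ x = (b j : E)})
    {ζ : ℝ} (hζ0 : 0 ≤ ζ) (hζ : 2 * ζ ≤ 1) (hcut : ∀ c, ‖v c - k c‖ ≤ ζ * ‖v c‖) :
    ‖U.starProjection - W.starProjection‖ ≤ 4 * (ζ + η / g) := by
  have hmemW : ∀ a : Fin F → ℂ, ∑ j ∈ lowIdx F K, a j • (b j : E) ∈ W := by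
    intro a
    refine Submodule.sum_mem _ fun j hj => Submodule.smul_mem _ _ ?_
    rw [hW]
    exact Submodule.subset_span ⟨j, (Finset.mem_filter.1 hj).2, rfl⟩
  have hrep : ∀ w ∈ W, ∃ a : Fin F → ℂ, w = ∑ j ∈ lowIdx F K, a j • (b j : E) := by
    intro w hw
    rw [hW] at hw
    induction hw using Submodule.span_induction with
    | mem x hx =>
      obtain ⟨j, hj, rfl⟩ := hx
      refine ⟨Pi.single j 1, ?_⟩
      rw [Finset.sum_eq_single j]
      · simp
      · intro i _ hij; simp [hij]
      · intro h; exact absurd (show j ∈ lowIdx F K from Finset.mem_filter.2 ⟨Finset.mem_univ _, hj⟩) h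
    | zero => exact ⟨0, by simp⟩
    | add x y _ _ hx hy =>
      obtain ⟨a, rfl⟩ := hx
      obtain ⟨a', rfl⟩ := hy
      exact ⟨a + a', by rw [← Finset.sum_add_distrib]; simp [add_smul]⟩
    | smul r x _ hx =>
      obtain ⟨a, rfl⟩ := hx
      exact ⟨r • a, by rw [Finset.smul_sum]; simp [mul_smul]⟩
  have hδ : 0 ≤ ζ + η / g := add_nonneg hζ0 (div_nonneg hη0 hg.le)
  have hdist : ∀ c, ‖k c - ∑ j ∈ lowIdx F K, inner ℂ (b j : E) (v c) • (b j : E)‖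
      ≤ (ζ + η / g) * ‖v c‖ := by
    intro c
    have h1 := (norm_high_le b heig hg hgap v hvS hη0 hη hres c).1
    have h2 := norm_sub_le (v c - ∑ j ∈ lowIdx F K, inner ℂ (b j : E) (v c) • (b j : E))
      (v c - k c)
    rw [sub_sub_sub_cancel_left] at h2
    rw [add_mul]
    linarith [hcut c]
  have h4 : 4 * (ζ + η / g) = 2 * (2 * (ζ + η / g)) := by ring
  rw [h4]
  refine norm_starProjection_sub_le (by positivity) ?_ ?_
  · intro x hx
    obtain ⟨c, rfl⟩ := (hU x).1 hx
    refine ⟨_, hmemW _, (hdist c).trans ?_⟩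
    have h5 : ‖v c‖ ≤ 2 * ‖k c‖ := by
      have h6 : ‖v c‖ ≤ ‖v c - k c‖ + ‖k c‖ := by
        have := norm_add_le (v c - k c) (k c)
        rwa [sub_add_cancel] at this
      nlinarith [hcut c, norm_nonneg (v c)]
    nlinarith
  · intro w hw
    obtain ⟨a, rfl⟩ := hrep w hw
    obtain ⟨c, hc⟩ := exists_inner_eq b heig hg hgap v hvS hinj hη0 hη hres a
    have he : ∑ j ∈ lowIdx F K, inner ℂ (b j : E) (v c) • (b j : E)
        = ∑ j ∈ lowIdx F K, a j • (b j : E) :=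
      Finset.sum_congr rfl fun j hj => by rw [hc j (Finset.mem_filter.1 hj).2]
    have h1 := hdist c
    have h2 := (norm_high_le b heig hg hgap v hvS hη0 hη hres c).2
    rw [he] at h1 h2
    refine ⟨k c, (hU _).2 ⟨c, rfl⟩, ?_⟩
    rw [norm_sub_rev]
    refine h1.trans ?_
    nlinarith

end Spectral

/-! ### The low energy spectrum and the gap above it -/

/-- The droplet functions are approximate eigenvectors with the eigenvalue `A(Δ)`: the eigenvalue
equation fails only at the configurations with an empty central urn. -/
theorem hamiltonian_sub_dropFn {Δ q : ℝ} (hop_eq : hop q = 1 / (2 * Δ))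
    (field_eq : fieldA Δ = field q) {L n : ℕ} (hL : 1 ≤ L) (c : ℕ → ℂ) :
    hamiltonian L Δ (urnState L n (dropFn q (L - n + 1) c))
        - (field q : ℂ) • urnState L n (dropFn q (L - n + 1) c)
      = (-(2 * field q) : ℂ) • urnState L n (residueFn q (L - n + 1) c) := by
  have h1 : urnState L n (dropFn q (L - n + 1) c) = _ := urnState_sum L n _ _ _
  have h2 : urnState L n (residueFn q (L - n + 1) c) = _ := urnState_sum L n _ _ _
  rw [h1, h2, map_sum, Finset.smul_sum, Finset.smul_sum, ← Finset.sum_sub_distrib]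
  refine Finset.sum_congr rfl fun y hy => ?_
  have hy' := Finset.mem_range.1 hy
  rw [map_smul, smul_comm _ (c y), smul_comm _ (c y), ← smul_sub,
    hamiltonian_urnState hop_eq field_eq hL]
  congr 1
  ext σ
  rw [PiLp.sub_apply, PiLp.smul_apply, PiLp.smul_apply, urnState_apply, urnState_apply,
    urnState_apply, smul_eq_mul, smul_eq_mul]
  split_ifs with hσ h0
  · have := urnOp_pow_spread (q := q) (show y ≤ L - n by omega) (occ (downSet σ))
    push_cast
    rw [this, if_neg (not_not.2 h0)]; ring
  · have := urnOp_pow_spread (q := q) (show y ≤ L - n by omega) (occ (downSet σ))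
    push_cast
    rw [this, if_pos h0]; ring
  · simp

/-- The superposition of droplet functions with the given coefficients, as a state. -/
def dropState (q : ℝ) (L n K : ℕ) : (Fin K → ℂ) →ₗ[ℂ] Space 1 L where
  toFun c := urnState L n (dropFn q K fun y => if h : y < K then c ⟨y, h⟩ else 0)
  map_add' c d := by
    have h : ∀ c, urnState L n (dropFn q K c) = _ := fun c => urnState_sum L n _ _ _
    rw [h, h, h, ← Finset.sum_add_distrib]
    refine Finset.sum_congr rfl fun y _ => ?_
    split_ifs <;> simp [add_smul]
  map_smul' r c := by
    have h : ∀ c, urnState L n (dropFn q K c) = _ := fun c => urnState_sum L n _ _ _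
    rw [h, h, RingHom.id_apply, Finset.smul_sum]
    refine Finset.sum_congr rfl fun y _ => ?_
    split_ifs <;> simp [mul_smul]

/-- The eigenvalues after the first `L - n + 1` ones are above the gap, up to `O(1 / n)`. -/
theorem val_ge {Δ q : ℝ} (hq0 : 0 < q) (hq1 : q < 1) (hop_eq : hop q = 1 / (2 * Δ))
    (field_eq : fieldA Δ = field q) {L n : ℕ} (hn : 1 ≤ n) (hnL : n ≤ L) (e : Eigensystem L n Δ)
    {j : Fin (Module.finrank ℂ (sector L n))} (hj : L - n + 1 ≤ (j : ℕ)) :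
    field q + gap q - (2 * field q + gap q) * (2 * hop q / gap q) / n ≤ e.val j := by
  obtain ⟨n, rfl⟩ := Nat.exists_eq_add_of_le' hn
  set M := L - (n + 1) with hM
  obtain ⟨ψ, hψS, hψ0, horth, hle⟩ := exists_orthogonal_trial e.vec e.eigen e.val_mono
    (fun y : Fin (M + 1) => urnState L (n + 1)
      fun ℓ => (q : ℂ) ^ spread (M + 1) y ℓ * (loc M y ℓ : ℂ)) hj
  obtain ⟨f, rfl⟩ := exists_urnState_eq hψS
  rw [inner_hamiltonian_urnState hop_eq field_eq hnL, Complex.ofReal_re] at hle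
  have hge := urnForm_ge hq0.le hq1 M n f fun y hy => by
    have := horth ⟨y, by omega⟩
    rw [inner_urnState hnL] at this
    rw [← this]
    refine Finset.sum_congr rfl fun ℓ _ => ?_
    simp only [map_mul, map_pow, Complex.conj_ofReal]
    ring
  rw [← norm_urnState_sq hnL] at hge
  have hpos : 0 < ‖urnState L (n + 1) f‖ ^ 2 := by
    have := norm_pos_iff.2 hψ0; positivity
  have hA := field_nonneg hq0.le hq1
  have hγ := gap_pos hq1
  have hh := hop_nonneg hq0.le
  have hnn : (0 : ℝ) < n + 1 := by positivity
  set ε : ℝ := 2 * hop q / (gap q * (n + 1)) with hε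
  have hε0 : 0 ≤ ε := by positivity
  have h1 : 2 * field q + gap q ≤ (1 + ε) * (e.val j + field q) := by
    refine le_of_mul_le_mul_right ?_ hpos
    have := mul_le_mul_of_nonneg_left
      (show urnForm q M n f ≤ (e.val j + field q) * ‖urnState L (n + 1) f‖ ^ 2 by linarith)
      (show 0 ≤ 1 + ε by positivity)
    linarith
  have h2 : (2 * field q + gap q) * (1 - ε) ≤ e.val j + field q := by
    refine le_of_mul_le_mul_left ?_ (show 0 < 1 + ε by positivity)
    refine le_trans ?_ h1
    nlinarith [mul_nonneg (show 0 ≤ 2 * field q + gap q by positivity) (sq_nonneg ε)]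
  have h3 : (2 * field q + gap q) * (2 * hop q / gap q) / ((n + 1 : ℕ) : ℝ)
      = (2 * field q + gap q) * ε := by
    rw [hε]; push_cast; field_simp
  rw [h3]; linarith

/-- A crude bound, which serves for the finitely many small `n`. -/
theorem abs_val_sub_field_le {Δ q : ℝ} (hq0 : 0 < q) (hq1 : q < 1)
    (hop_eq : hop q = 1 / (2 * Δ)) (field_eq : fieldA Δ = field q) {L n : ℕ} (hn : 1 ≤ n)
    (hnL : n ≤ L) (e : Eigensystem L n Δ) (j : Fin (Module.finrank ℂ (sector L n))) :
    |e.val j - field q| ≤ 3 * n + 1 := by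
  obtain ⟨n, rfl⟩ := Nat.exists_eq_add_of_le' hn
  have h1 := congrArg (fun x => (inner ℂ (e.vec j : Space 1 L) x).re) (e.eigen j)
  obtain ⟨f, hf⟩ := exists_urnState_eq (e.vec j).2
  have hnorm : ‖urnState L (n + 1) f‖ = 1 := by rw [hf]; exact e.vec.orthonormal.1 j
  simp only [← hf] at h1
  rw [inner_hamiltonian_urnState hop_eq field_eq hnL, Complex.ofReal_re, inner_smul_right,
    inner_self_eq_norm_sq_to_K, hnorm] at h1
  simp only [one_pow, mul_one, Complex.ofReal_re, RCLike.ofReal_one] at h1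
  have h2 := urnForm_nonneg hq0.le hq1 (L - (n + 1)) n f
  have h3 := urnForm_le hq0.le (L - (n + 1)) n f
  rw [← norm_urnState_sq hnL, hnorm] at h3
  have hA := field_nonneg hq0.le hq1
  have hA' := field_le_half q
  rw [abs_le]
  push_cast
  constructor <;> linarith

/-- The constant in the estimates of the residues of the droplet functions. -/
def residueConst (s : ℝ) : ℝ := 2 * partBound s / (s * (1 - s))

/-- The constant in the estimates of the cut-off of the droplet functions. -/
def cutConst (s : ℝ) : ℝ := 4 * partBound (s ^ 2) / (s * (1 - s))

theorem residueConst_nonneg {s : ℝ} (hs0 : 0 < s) (hs1 : s < 1) : 0 ≤ residueConst s :=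
  div_nonneg (mul_nonneg zero_le_two (Real.exp_pos _).le) (mul_nonneg hs0.le (by linarith))

theorem cutConst_nonneg {s : ℝ} (hs0 : 0 < s) (hs1 : s < 1) : 0 ≤ cutConst s :=
  div_nonneg (mul_nonneg zero_le_four (Real.exp_pos _).le) (mul_nonneg hs0.le (by linarith))

/-- The low eigenvalues and the low energy space for large `n`, given that the other eigenvalues are
at least `A(Δ) + g`. Here `q = s ^ 2`. -/
theorem low_energy_of_large {Δ s : ℝ} (hs0 : 0 < s) (hs1 : s < 1)
    (hop_eq : hop (s ^ 2) = 1 / (2 * Δ)) (field_eq : fieldA Δ = field (s ^ 2)) {g : ℝ}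
    (hg : 0 < g) {L n : ℕ} (hn : 1 ≤ n) (hnL : n ≤ L)
    (hsmall : (s ^ 2) ^ (n - 1) * (2 / (1 - s ^ 2)) ≤ 1 / 2)
    (hη : 2 * (2 * √(residueConst s) * s ^ n) ≤ g)
    (hζ : 2 * (2 * √(cutConst s) * s ^ n) ≤ 1) (e : Eigensystem L n Δ)
    (hgap : ∀ j : Fin (Module.finrank ℂ (sector L n)), L - n + 1 ≤ (j : ℕ) →
      field (s ^ 2) + g ≤ e.val j) :
    (∀ j : Fin (Module.finrank ℂ (sector L n)), (j : ℕ) < L - n + 1 →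
      |e.val j - field (s ^ 2)| ≤ 16 * (1 + 1 / g) * residueConst s * (s ^ 2) ^ n) ∧
    ‖(dropletSpace (s ^ 2) L n).starProjection - (e.lowSpace (L - n + 1)).starProjection‖
      ≤ 8 * (√(cutConst s) + √(residueConst s) / g) * s ^ n := by
  have hq0 : 0 < s ^ 2 := by positivity
  have hq1 : s ^ 2 < 1 := pow_lt_one₀ hs0.le hs1 two_ne_zero
  have hR := residueConst_nonneg hs0 hs1
  have hR' := cutConst_nonneg hs0 hs1
  set K := L - n + 1 with hK
  -- The abstract estimates are applied with `η` for the relative residue of the superpositions of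
  -- droplet functions and `ζ` for the relative error of the cut-off. Since `2 A(Δ) ≤ 1`, the factor
  -- `2 A(Δ)` in the residue is dropped.
  set ext : (Fin K → ℂ) → ℕ → ℂ := fun c y => if h : y < K then c ⟨y, h⟩ else 0 with hext
  set T : (Fin K → ℂ) → ℝ := fun c => ∑ y ∈ Finset.range K, ‖ext c y‖ ^ 2 with hT
  set v := dropState (s ^ 2) L n K with hv
  have hve : ∀ c, v c = urnState L n (dropFn (s ^ 2) K (ext c)) := fun _ => rfl
  set η := 2 * √(residueConst s) * s ^ n with hηd
  set ζ := 2 * √(cutConst s) * s ^ n with hζd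
  have hη0 : 0 ≤ η := by positivity
  have hζ0 : 0 ≤ ζ := by positivity
  have hη2 : η ^ 2 = 4 * residueConst s * (s ^ 2) ^ n := by
    rw [hηd, mul_pow, mul_pow, Real.sq_sqrt hR, ← pow_mul, ← pow_mul, mul_comm n]; ring
  have hζ2 : ζ ^ 2 = 4 * cutConst s * (s ^ 2) ^ n := by
    rw [hζd, mul_pow, mul_pow, Real.sq_sqrt hR', ← pow_mul, ← pow_mul, mul_comm n]; ring
  have hA := field_nonneg hq0.le hq1
  have hA' := field_le_half (s ^ 2)
  have hTv : ∀ c, T c ≤ 4 * ‖v c‖ ^ 2 := by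
    intro c
    rw [hve, norm_urnState_sq hnL]
    exact sum_norm_sq_coeff_le hq0 hq1 hn hsmall _
  have hinj : ∀ c, v c = 0 → c = 0 := by
    intro c hc
    have h := hTv c
    rw [hc, norm_zero, zero_pow two_ne_zero, mul_zero] at h
    have h0 := (Finset.sum_eq_zero_iff_of_nonneg fun _ _ => by positivity).1
      (le_antisymm h (Finset.sum_nonneg fun _ _ => by positivity))
    funext y
    have := h0 y (Finset.mem_range.2 y.2)
    simp only [hext, y.2, dif_pos] at this
    exact norm_eq_zero.1 (pow_eq_zero_iff two_ne_zero |>.1 this)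
  have hresid : ∀ c, hamiltonian L Δ (v c) - (field (s ^ 2) : ℂ) • v c
      = (-(2 * field (s ^ 2)) : ℂ) • urnState L n (residueFn (s ^ 2) K (ext c)) := fun c =>
    hamiltonian_sub_dropFn hop_eq field_eq (by omega) _
  have hnormA : ‖(-(2 * field (s ^ 2)) : ℂ)‖ ≤ 1 := by
    rw [norm_neg, show (2 * field (s ^ 2) : ℂ) = ((2 * field (s ^ 2) : ℝ) : ℂ) by push_cast; rfl,
      Complex.norm_real, Real.norm_eq_abs, abs_of_nonneg (by positivity)]
    linarith
  have hbound : ∀ c, residueConst s * (s ^ 2) ^ n * T c ≤ η ^ 2 * ‖v c‖ ^ 2 := by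
    intro c
    have := mul_le_mul_of_nonneg_left (hTv c)
      (show 0 ≤ residueConst s * (s ^ 2) ^ n by positivity)
    rw [hη2]; linarith
  have hres : ∀ c, ‖hamiltonian L Δ (v c) - (field (s ^ 2) : ℂ) • v c‖ ≤ η * ‖v c‖ := by
    intro c
    have h1 : ‖urnState L n (residueFn (s ^ 2) K (ext c))‖ ^ 2 ≤ (η * ‖v c‖) ^ 2 := by
      rw [norm_urnState_sq hnL, mul_pow]
      exact (sum_norm_residueFn_sq_le hs0 hs1 hn _).trans (hbound c)
    rw [hresid, norm_smul]
    refine (mul_le_of_le_one_left (norm_nonneg _) hnormA).trans (le_of_sq_le_sq h1 ?_)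
    positivity
  have hquad : ∀ c, |(inner ℂ (v c)
      (hamiltonian L Δ (v c) - (field (s ^ 2) : ℂ) • v c)).re| ≤ η ^ 2 * ‖v c‖ ^ 2 := by
    intro c
    rw [hresid, inner_smul_right]
    refine (Complex.abs_re_le_norm _).trans ?_
    rw [norm_mul]
    refine (mul_le_of_le_one_left (norm_nonneg _) hnormA).trans ?_
    rw [hve, inner_urnState hnL]
    exact (norm_sum_conj_mul_residueFn_le hs0 hs1 hn _).trans (hbound c)
  have hcut : ∀ c, ‖v c - urnState L n (cutFn (s ^ 2) K n (ext c))‖ ≤ ζ * ‖v c‖ := by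
    intro c
    refine le_of_sq_le_sq ?_ (by positivity)
    have h1 : v c - urnState L n (cutFn (s ^ 2) K n (ext c))
        = urnState L n (fun ℓ => dropFn (s ^ 2) K (ext c) ℓ - cutFn (s ^ 2) K n (ext c) ℓ) := by
      ext σ
      rw [hve, PiLp.sub_apply, urnState_apply, urnState_apply, urnState_apply]
      split_ifs <;> simp
    rw [h1, norm_urnState_sq hnL, mul_pow, hζ2]
    refine (sum_norm_dropFn_sub_cutFn_sq_le hs0 hs1 hn _).trans ?_
    have := mul_le_mul_of_nonneg_left (hTv c)
      (show 0 ≤ cutConst s * (s ^ 2) ^ n by positivity)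
    calc _ = cutConst s * (s ^ 2) ^ n * T c := rfl
      _ ≤ _ := this
      _ = _ := by ring
  have hvS : ∀ c, v c ∈ sector L n := fun c => urnState_mem_sector _ _ _
  constructor
  · intro j hj
    refine (abs_val_sub_le e.vec e.eigen hg hgap v hvS hinj hη0 hη hres hquad hj).trans
      (le_of_eq ?_)
    rw [hη2]; ring
  · refine (norm_starProjection_sub_low_le e.vec e.eigen hg hgap v hvS hinj hη0 hη hres
      (fun c => urnState L n (cutFn (s ^ 2) K n (ext c))) (fun x => ?_) rfl hζ0 hζ hcut).trans
      (le_of_eq ?_)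
    · rw [mem_dropletSpace_iff hq0 hnL]
      constructor
      · rintro ⟨c, rfl⟩
        refine ⟨fun y => c y, congrArg _ (funext fun ℓ => Finset.sum_congr rfl fun y hy => ?_)⟩
        simp only [hext, Finset.mem_range.1 hy, dif_pos]
        rfl
      · rintro ⟨c, rfl⟩
        exact ⟨_, rfl⟩
    · rw [hζd, hηd]; ring

theorem tendsto_pow_sub_one {q : ℝ} (hq0 : 0 ≤ q) (hq1 : q < 1) :
    Filter.Tendsto (fun n : ℕ => q ^ (n - 1)) Filter.atTop (nhds 0) :=
  (tendsto_pow_atTop_nhds_zero_of_lt_one hq0 hq1).comp (Filter.tendsto_sub_atTop_nat 1)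

end XXZ

end

theorem mainTheorem1 (Δ q : ℝ) (hΔ : 1 < Δ) (hq0 : 0 < q) (hq1 : q < 1)
    (hΔq : Δ = (q + q⁻¹) / 2) :
    ∃ (C : ℝ) (N : ℕ),
      -- (a) the first `L - n + 1` eigenvalues
      (∀ L n : ℕ, 1 ≤ n → n ≤ L → ∀ e : XXZ.Eigensystem L n Δ,
        ∀ j : Fin (Module.finrank ℂ (XXZ.sector L n)), (j : ℕ) < L - n + 1 →
          e.val j ∈ Set.Icc (XXZ.fieldA Δ - C * q ^ n) (XXZ.fieldA Δ + C * q ^ n)) ∧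
      -- (b) the rest of the spectrum
      (∀ L n : ℕ, 1 ≤ n → N ≤ n → n ≤ L → ∀ e : XXZ.Eigensystem L n Δ,
        ∀ j : Fin (Module.finrank ℂ (XXZ.sector L n)), L - n + 1 ≤ (j : ℕ) →
          XXZ.fieldA Δ + (1 - Δ⁻¹) - C * (n : ℝ) ^ (-(1 / 4) : ℝ) ≤ e.val j) ∧
      -- (c) the projections
      (∀ L n : ℕ, 1 ≤ n → N ≤ n → n ≤ L → ∀ e : XXZ.Eigensystem L n Δ,
        ‖(XXZ.dropletSpace q L n).starProjection
            - (e.lowSpace (L - n + 1)).starProjection‖ ≤ C * q ^ ((n : ℝ) / 2)) := by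
  have hop_eq := XXZ.hop_eq_of_anisotropy hq0 hΔq
  have gap_eq := XXZ.gap_eq_of_anisotropy hq0 hΔq
  have field_eq := XXZ.fieldA_eq_of_anisotropy hq0 hq1 hΔq
  have hγ := XXZ.gap_pos hq1
  have hA := XXZ.field_nonneg hq0.le hq1
  have hh := XXZ.hop_nonneg hq0.le
  rw [gap_eq, field_eq]
  obtain ⟨s, hs0, rfl⟩ : ∃ s : ℝ, 0 < s ∧ q = s ^ 2 :=
    ⟨√q, Real.sqrt_pos.2 hq0, (Real.sq_sqrt hq0.le).symm⟩
  have hs1 : s < 1 := by nlinarith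
  have hR := XXZ.residueConst_nonneg hs0 hs1
  have hR' := XXZ.cutConst_nonneg hs0 hs1
  set A := XXZ.field (s ^ 2) with hAd
  set γ := XXZ.gap (s ^ 2) with hγd
  -- The error in the gap is `B / n`.
  set B := (2 * A + γ) * (2 * XXZ.hop (s ^ 2) / γ) with hB
  have hB0 : 0 ≤ B := by positivity
  have hg : 0 < γ / 2 := by positivity
  -- `N` is such that for `n ≥ N` the droplet functions are nearly orthogonal, the residues and the
  -- errors of the cut-off are small, and half the gap is left.
  have hpow := tendsto_pow_atTop_nhds_zero_of_lt_one hs0.le hs1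
  have e1 : ∀ᶠ n : ℕ in Filter.atTop, (s ^ 2) ^ (n - 1) * (2 / (1 - s ^ 2)) ≤ 1 / 2 := by
    have h := (XXZ.tendsto_pow_sub_one hq0.le hq1).mul_const (2 / (1 - s ^ 2))
    rw [zero_mul] at h
    exact h.eventually_le_const (by norm_num)
  have e2 : ∀ᶠ n : ℕ in Filter.atTop, 2 * (2 * √(XXZ.residueConst s) * s ^ n) ≤ γ / 2 := by
    have h := (hpow.const_mul (2 * √(XXZ.residueConst s))).const_mul 2
    rw [mul_zero, mul_zero] at h
    exact h.eventually_le_const hg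
  have e3 : ∀ᶠ n : ℕ in Filter.atTop, 2 * (2 * √(XXZ.cutConst s) * s ^ n) ≤ 1 := by
    have h := (hpow.const_mul (2 * √(XXZ.cutConst s))).const_mul 2
    rw [mul_zero, mul_zero] at h
    exact h.eventually_le_const one_pos
  have e4 : ∀ᶠ n : ℕ in Filter.atTop, B / (n : ℝ) ≤ γ / 2 :=
    (tendsto_const_div_atTop_nhds_zero_nat B).eventually_le_const hg
  obtain ⟨N, hN⟩ := Filter.eventually_atTop.1 (e1.and (e2.and (e3.and e4)))
  have hlarge : ∀ L n : ℕ, 1 ≤ n → N ≤ n → n ≤ L → ∀ e : XXZ.Eigensystem L n Δ, _ :=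
    fun L n hn hNn hnL e =>
      XXZ.low_energy_of_large (g := γ / 2) hs0 hs1 hop_eq field_eq hg hn hnL (hN n hNn).1
        (hN n hNn).2.1 (hN n hNn).2.2.1 e fun j hj => by
          have h1 := XXZ.val_ge hq0 hq1 hop_eq field_eq hn hnL e hj
          have h2 := (hN n hNn).2.2.2
          linarith
  -- `C1` serves the low eigenvalues for `n ≥ N`, `C2` those for `n < N`, and `C3` the projections.
  set C1 := 16 * (1 + 1 / (γ / 2)) * XXZ.residueConst s with hC1
  set C2 := (3 * N + 1) / (s ^ 2) ^ N with hC2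
  set C3 := 8 * (√(XXZ.cutConst s) + √(XXZ.residueConst s) / (γ / 2)) with hC3
  have hC1' : 0 ≤ C1 := by positivity
  have hC2' : 0 ≤ C2 := by positivity
  have hC3' : 0 ≤ C3 := by positivity
  refine ⟨C1 + C2 + C3 + B, N, ?_, ?_, ?_⟩
  · intro L n hn hnL e j hj
    have hp : 0 ≤ (s ^ 2) ^ n := by positivity
    have key : |e.val j - A| ≤ (C1 + C2 + C3 + B) * (s ^ 2) ^ n := by
      rcases le_or_gt N n with h | h
      · refine ((hlarge L n hn h hnL e).1 j hj).trans (mul_le_mul_of_nonneg_right ?_ hp)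
        linarith
      · refine (XXZ.abs_val_sub_field_le hq0 hq1 hop_eq field_eq hn hnL e j).trans ?_
        have h1 : (n : ℝ) ≤ N := by exact_mod_cast h.le
        have h2 : C2 * (s ^ 2) ^ N ≤ C2 * (s ^ 2) ^ n :=
          mul_le_mul_of_nonneg_left (pow_le_pow_of_le_one hq0.le hq1.le h.le) hC2'
        rw [hC2, div_mul_cancel₀ _ (by positivity)] at h2
        have h3 : C2 * (s ^ 2) ^ n ≤ (C1 + C2 + C3 + B) * (s ^ 2) ^ n :=
          mul_le_mul_of_nonneg_right (by linarith) hp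
        linarith
    rw [abs_le] at key
    exact ⟨by linarith [key.1], by linarith [key.2]⟩
  · intro L n hn _ hnL e j hj
    have h1 := XXZ.val_ge hq0 hq1 hop_eq field_eq hn hnL e hj
    have hn' : (1 : ℝ) ≤ n := by exact_mod_cast hn
    have h2 : (n : ℝ)⁻¹ ≤ (n : ℝ) ^ (-(1 / 4) : ℝ) := by
      rw [← Real.rpow_neg_one]
      exact Real.rpow_le_rpow_of_exponent_le hn' (by norm_num)
    have h3 : B / n ≤ (C1 + C2 + C3 + B) * (n : ℝ) ^ (-(1 / 4) : ℝ) := by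
      rw [div_eq_mul_inv]
      exact mul_le_mul (by linarith) h2 (by positivity) (by linarith)
    linarith
  · intro L n hn hNn hnL e
    have h1 : (s ^ 2) ^ ((n : ℝ) / 2) = s ^ n := by
      rw [← Real.rpow_natCast, ← Real.rpow_mul hs0.le, ← Real.rpow_natCast]
      congr 1
      push_cast; ring
    rw [h1]
    refine (hlarge L n hn hNn hnL e).2.trans (mul_le_mul_of_nonneg_right ?_ (by positivity))
    linarith
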